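/- **Setting.** Let $d\ge 1$, let $\mathcal X=\{x\in\mathbb R^d:\|x\|_2\le 1\}$, and let $\rho$ be a Borel probability measure on $\mathbb R^d\times[-1,1]$ whose marginal $\rho_{\mathcal X}$ on $\mathbb R^d$ has support exactly $\mathcal X$ (it is supported on $\mathcal X$ and non-degenerate). Let $g_\rho(x)=\int y\,d\rho(y|x)$ be the regression function and $\|\cdot\|_\rho$ the norm of $L^2(\rho_{\mathcal X})$. Let $\gamma\in[0,1]$, and let $\sigma:\mathbb R\to\mathbb R$ be twice differentiable with $|\sigma'|\le C_\sigma$, $|\sigma''|\le C_\sigma$ and $|\sigma(u)|\le 1+|u|$ for all $u$, where $C_\sigma>0$; put $\kappa=\sqrt{4+2C_\sigma^2}$. For an even width $M$ and parameters $\Theta=(a_r,b_r,c_r)_{r=1}^M$ with $a_r,c_r\in\mathbb R$, $b_r\in\mathbb R^d$, let $g_\Theta(x)=M^{-1/2}\sum_{r=1}^M a_r\,\sigma(b_r^\top x+\gamma c_r)$. Initialize $\Theta^{(0)}$ symmetrically: $a_r^{(0)}=1$ and $a^{(0)}_{r+M/2}=-1$ for $r\le M/2$; $b_r^{(0)}=b_{r+M/2}^{(0)}$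 for $r\le M/2$, with $b_1^{(0)},\dots,b_{M/2}^{(0)}$ i.i.d. uniform on the unit sphere $\mathbb S^{d-1}$; and $c_r^{(0)}=0$ for all $r$. Given $\lambda>0$, $\eta>0$ and $\theta\in(1/2,1)$, draw i.i.d. samples $z_t=(x_t,y_t)\sim\rho$, put $\Theta^{(1)}=\Theta^{(0)}$ and $\eta_t=\eta t^{-\theta}$, and iterate for $t=1,\dots,T$ $$\Theta^{(t+1)}=\Theta^{(t)}-\eta_t\bigl(g_{\Theta^{(t)}}(x_t)-y_t\bigr)\nabla_\Theta g_\Theta(x_t)\big|_{\Theta=\Theta^{(t)}}-\eta_t\lambda\bigl(\Theta^{(t)}-\Theta^{(0)}\bigr).$$ Let $$k_\infty(x,x')=\mathbb E_b[\sigma(b^\top x)\sigma(b^\top x')]+(x^\top x'+\gamma^2)\,\mathbb E_b[\sigma'(b^\top x)\sigma'(b^\top x')],\qquad b\ \text{uniform on}\ \mathbb S^{d-1},$$ and let $L_\infty f=\int f(x)k_\infty(x,\cdot)\,d\rho_{\mathcal X}(x)$ on $L^2(\rho_{\mathcal X})$. Let $(\mu_k,\phi_k)_{k\ge1}$ be an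 orthonormal eigensystem of $L_\infty$ that is complete up to $\ker L_\infty$, with $\mu_1\ge\mu_2\ge\dots$ counted with multiplicity, and let $L_\infty^r h=\sum_k\mu_k^r\langle\phi_k,h\rangle\phi_k$. Assume that $g_\rho\in L_\infty^r(L^2(\rho_{\mathcal X}))$ for some $\tfrac12<r\le1$, and that for some $\beta>1$ and $b,c>0$ one has $b\,i^{-\beta}\le\mu_i\le c\,i^{-\beta}$ for all $i\ge1$. **Corollary 1.** Let $\theta=\frac{2r}{2r+1}$ and let $\eta>0$. (a) If $r<1-\frac1{2\beta}$, then there is a constant $C>0$, which does not depend on $T$, $M$ or $\delta$, such that the following holds. Let $T\ge1$ be an integer, put $\lambda=T^{-\frac1{2r+1}}$, and suppose that $$\eta<\left(\lambda+\frac{208(1+\kappa)^4}{(1-2^{\theta-1})(2\theta-1)}\Bigl(\log\frac8{1-\theta}+\frac1{1-\theta}\Bigr)\right)^{-1}.\tag{1}$$ Then for every even $M\ge T^{1+\frac5{2r+1}}=T^{\frac{2r+6}{2r+1}}$ and every $\delta\in(0,1)$, with probability at least $1-\delta$ over the random choice of $\Theta^{(0)}$, $$\mathbb E_{z_1,\dots,z_T}\bigl[\|g_{\Theta^{(T+1)}}-g_\rho\|_\rho^2\bigr]\le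 C\,T^{-\frac{2r}{2r+1}}\log\frac2\delta .$$ (b) If $r\ge1-\frac1{2\beta}$, then for every $0<\epsilon<\frac{2r}{2r+1}$ there is a constant $C>0$, which does not depend on $T$, $M$ or $\delta$, such that the following holds. Let $T\ge1$ be an integer, put $\lambda=T^{-\frac1{2r+1}+\frac{\epsilon}{2r}}$, and suppose that (1) holds. Then for every even $M\ge T^{1+\frac5{2r+1}}$ and every $\delta\in(0,1)$, with probability at least $1-\delta$ over the random choice of $\Theta^{(0)}$, $$\mathbb E_{z_1,\dots,z_T}\bigl[\|g_{\Theta^{(T+1)}}-g_\rho\|_\rho^2\bigr]\le C\,T^{-\frac{2r}{2r+1}+\epsilon}\log\frac2\delta .$$ -/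

import Mathlib

open MeasureTheory ProbabilityTheory

noncomputable section

namespace TwoLayerSGD

/-- The input space `ℝᵈ` with its Euclidean norm. -/
abbrev Inp (d : ℕ) : Type := EuclideanSpace ℝ (Fin d)

/-- The activation `σ` is twice differentiable, `‖σ'‖_∞ ≤ C`, `‖σ''‖_∞ ≤ C` and
`|σ u| ≤ 1 + |u|`. -/
structure IsActivation (σ : ℝ → ℝ) (C : ℝ) : Prop where
  pos : 0 < C
  diff : Differentiable ℝ σ
  diff_deriv : Differentiable ℝ (deriv σ)
  deriv_le : ∀ u, |deriv σ u| ≤ C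
  deriv_deriv_le : ∀ u, |deriv (deriv σ) u| ≤ C
  growth : ∀ u, |σ u| ≤ 1 + |u|

/-- The uniform distribution on the unit sphere of `ℝᵈ` (for `d ≥ 1`): the normalized surface
measure, as a measure on `ℝᵈ`. -/
def sphereUniform (d : ℕ) : Measure (Inp d) :=
  (((volume : Measure (Inp d)).toSphere Set.univ)⁻¹ • (volume : Measure (Inp d)).toSphere).map
    Subtype.val

/-- The neurons of a network of even width `M = 2 m`: `Sum.inl r` is neuron `r` of the first half
and `Sum.inr r` is neuron `r + M / 2`. -/
abbrev Neuron (m : ℕ) : Type := Fin m ⊕ Fin m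

/-- Parameters `Θ = (a, B, c)` of a network of width `2 m`. -/
structure Params (d m : ℕ) where
  a : Neuron m → ℝ
  b : Neuron m → Inp d
  c : Neuron m → ℝ

/-- `g_Θ(x) = M^{-1/2} ∑_r a_r σ(b_rᵀ x + γ c_r)` with `M = 2 m`. -/
def network {d m : ℕ} (σ : ℝ → ℝ) (γ : ℝ) (Θ : Params d m) (x : Inp d) : ℝ :=
  (Real.sqrt (2 * m : ℝ))⁻¹ * ∑ r, Θ.a r * σ (inner ℝ (Θ.b r) x + γ * Θ.c r)

/-- Symmetric initialization from the vectors `w₁, …, w_{M/2}`. -/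
def initParams {d m : ℕ} (R : ℝ) (w : Fin m → Inp d) : Params d m where
  a := Sum.elim (fun _ => R) (fun _ => -R)
  b := Sum.elim w w
  c := fun _ => 0

/-- One step of regularized stochastic gradient descent with step size `s`, regularization
parameter `lam`, initial parameters `Θ₀` and sample `z = (x, y)`. -/
def sgdStep {d m : ℕ} (σ : ℝ → ℝ) (γ lam s : ℝ) (Θ₀ Θ : Params d m) (z : Inp d × ℝ) :
    Params d m where
  a := fun r => Θ₀.a r + ((1 - s * lam) * (Θ.a r - Θ₀.a r)
    - s * (Real.sqrt (2 * m : ℝ))⁻¹ * (network σ γ Θ z.1 - z.2)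
        * σ (inner ℝ (Θ.b r) z.1 + γ * Θ.c r))
  b := fun r => Θ₀.b r + ((1 - s * lam) • (Θ.b r - Θ₀.b r)
    - (s * (Real.sqrt (2 * m : ℝ))⁻¹ * (network σ γ Θ z.1 - z.2)
        * (Θ.a r * deriv σ (inner ℝ (Θ.b r) z.1 + γ * Θ.c r))) • z.1)
  c := fun r => Θ₀.c r + ((1 - s * lam) * (Θ.c r - Θ₀.c r)
    - s * (Real.sqrt (2 * m : ℝ))⁻¹ * (network σ γ Θ z.1 - z.2)
        * (Θ.a r * γ * deriv σ (inner ℝ (Θ.b r) z.1 + γ * Θ.c r)))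

/-- `sgd … T z` is the iterate `Θ^{(T+1)}` after the `T` samples `z = (z₁, …, z_T)`, started at
`Θ^{(1)} = Θ₀`, with step sizes `η_t = η t^{-θ}`. -/
def sgd {d m : ℕ} (σ : ℝ → ℝ) (γ lam η θ : ℝ) (Θ₀ : Params d m) :
    (T : ℕ) → (Fin T → Inp d × ℝ) → Params d m
  | 0, _ => Θ₀
  | T + 1, z =>
      sgdStep σ γ lam (η * ((T + 1 : ℕ) : ℝ) ^ (-θ)) Θ₀
        (sgd σ γ lam η θ Θ₀ T (fun i => z i.castSucc)) (z (Fin.last T))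

/-- The regression function `g_ρ(x) = ∫ y dρ(y|x)`. -/
def regression {d : ℕ} (ρ : Measure (Inp d × ℝ)) [IsFiniteMeasure ρ] (x : Inp d) : ℝ :=
  ∫ y, y ∂(ρ.condKernel x)

/-- The squared distance `‖g - g_ρ‖²` in `L²(ρ_X)`, that is, the excess risk of `g`. -/
def excessRisk {d : ℕ} (ρ : Measure (Inp d × ℝ)) [IsFiniteMeasure ρ] (g : Inp d → ℝ) : ENNReal :=
  eLpNorm (fun x => g x - regression ρ x) 2 ρ.fst ^ 2

/-- The expectation over `z₁, …, z_T ∼ ρ` (i.i.d.) of the excess risk of the last iterate, for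
the initialization given by `w`. -/
def expectedExcessRisk {d m : ℕ} (σ : ℝ → ℝ) (γ R lam η θ : ℝ)
    (ρ : Measure (Inp d × ℝ)) [IsFiniteMeasure ρ] (T : ℕ) (w : Fin m → Inp d) : ENNReal :=
  ∫⁻ z, excessRisk ρ (network σ γ (sgd σ γ lam η θ (initParams R w) T z))
    ∂(Measure.pi fun _ : Fin T => ρ)

/-- The law of the random vectors used for initialization: i.i.d. uniform on the sphere. -/
def initLaw (d m : ℕ) : Measure (Fin m → Inp d) :=
  Measure.pi fun _ : Fin m => sphereUniform d

/-- The neural tangent kernel `k_∞`. -/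
def ntk {d : ℕ} (σ : ℝ → ℝ) (R γ : ℝ) (x x' : Inp d) : ℝ :=
  (∫ b, σ (inner ℝ b x) * σ (inner ℝ b x') ∂(sphereUniform d))
    + R ^ 2 * (inner ℝ x x' + γ ^ 2)
      * ∫ b, deriv σ (inner ℝ b x) * deriv σ (inner ℝ b x') ∂(sphereUniform d)

/-- The integral operator of the kernel `k` and the measure `ν`. -/
def integralOp {d : ℕ} (k : Inp d → Inp d → ℝ) (ν : Measure (Inp d)) (f : Inp d → ℝ) :
    Inp d → ℝ :=
  fun x' => ∫ x, f x * k x x' ∂ν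

/-- `(μ_k, φ_k)` is an orthonormal eigensystem in `L²(ν)` of the integral operator `L` of the
kernel `k`: the eigenvalues are listed with multiplicity in non-ascending order, and the
eigenfunctions are complete up to the kernel of `L`. The index `k : ℕ` stands for `k + 1`. -/
structure IsEigensystem {d : ℕ} (k : Inp d → Inp d → ℝ) (ν : Measure (Inp d))
    (μ : ℕ → ℝ) (φ : ℕ → Lp ℝ 2 ν) : Prop where
  antitone : Antitone μ
  nonneg : ∀ i, 0 ≤ μ i
  orthonormal : Orthonormal ℝ φ
  eigen : ∀ i, integralOp k ν (φ i) =ᵐ[ν] fun x => μ i * φ i x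
  complete : ∀ f : Lp ℝ 2 ν, (∀ i, inner ℝ (φ i) f = 0) → integralOp k ν f =ᵐ[ν] 0

/-- `f ∈ L^r(L²(ν))`, where `L^r h = ∑_k μ_k^r ⟨φ_k, h⟩ φ_k` for the eigensystem `(μ_k, φ_k)`. -/
def InPowRange {d : ℕ} {ν : Measure (Inp d)} (μ : ℕ → ℝ) (φ : ℕ → Lp ℝ 2 ν) (r : ℝ)
    (f : Inp d → ℝ) : Prop :=
  ∃ h F : Lp ℝ 2 ν, HasSum (fun k => (μ k ^ r * inner ℝ (φ k) h) • φ k) F ∧ F =ᵐ[ν] f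

/-- `b i^{-β} ≤ μ_i ≤ c i^{-β}` for all `i ≥ 1`, for some constants `b, c > 0`. -/
def PolynomialDecay (μ : ℕ → ℝ) (β : ℝ) : Prop :=
  ∃ b > 0, ∃ c > 0, ∀ i : ℕ,
    b * ((i : ℝ) + 1) ^ (-β) ≤ μ i ∧ μ i ≤ c * ((i : ℝ) + 1) ^ (-β)

/-- The upper bound on the step size constant `η`, with `κ² = 4 + 2 C²`. -/
def stepBound (C lam θ : ℝ) : ℝ :=
  (lam + 208 * (1 + Real.sqrt (4 + 2 * C ^ 2)) ^ 4 / ((1 - 2 ^ (θ - 1)) * (2 * θ - 1))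
    * (Real.log (8 / (1 - θ)) + 1 / (1 - θ)))⁻¹

end TwoLayerSGD

end

/-!
A wide network barely moves during training: as long as `T ≤ M lam⁵`, the displacement of each
neuron is so small that the trained network stays within `O(1 / √T)` of stochastic gradient descent
for the linear model whose features are the gradients of the network at initialization. It therefore
suffices to bound the risk of that linear iteration.

In the eigenbasis of the feature covariance the regularized linear iteration splits exactly into the
bias of ridge regression, the forgetting of the initial error, and the noise accumulated along the
way. The covariance is random through the initialization, but the empirical kernel concentrates
around the neural tangent kernel in the Hilbert–Schmidt norm, at rate `m ^ (-1/2)`; hence the bias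
of ridge regression is controlled by the source condition on the regression function.

The noise of the last half of the steps is of the order of the step size. The noise of the first
half is either damped by the effective dimension of the kernel, when its eigenvalues are
summable to the power `2 - 2 r`, or, when `lam` is chosen slightly larger, forgotten exponentially
fast without any assumption on the spectrum.
-/

noncomputable section

namespace TwoLayerSGD

section Orthonormal

variable {K ι : Type*} [NormedAddCommGroup K] [InnerProductSpace ℝ K] {φ : ι → K} {c d : ι → ℝ}
  {v w : K}

lemma inner_eq_of_hasSum_smul (hφ : Orthonormal ℝ φ) (hw : HasSum (fun i => c i • φ i) w) (i : ι) :
    inner ℝ (φ i) w = c i := by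
  classical
  have h := hw.mapL (innerSL ℝ (φ i))
  simp only [innerSL_apply_apply, inner_smul_right, orthonormal_iff_ite.1 hφ, mul_ite, mul_one,
    mul_zero] at h
  simpa using h.unique (hasSum_single i fun j hj => if_neg hj.symm)

lemma hasSum_mul_of_hasSum_smul (hφ : Orthonormal ℝ φ) (hv : HasSum (fun i => c i • φ i) v)
    (hw : HasSum (fun i => d i • φ i) w) : HasSum (fun i => c i * d i) (inner ℝ v w) := by
  have h := hw.mapL (innerSL ℝ v)
  simp only [innerSL_apply_apply, inner_smul_right] at h
  refine h.congr_fun fun i => ?_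
  rw [real_inner_comm, inner_eq_of_hasSum_smul hφ hv, mul_comm]

lemma hasSum_sq_of_hasSum_smul (hφ : Orthonormal ℝ φ) (hw : HasSum (fun i => c i • φ i) w) :
    HasSum (fun i => c i ^ 2) (‖w‖ ^ 2) := by
  simpa only [← sq, real_inner_self_eq_norm_sq] using hasSum_mul_of_hasSum_smul hφ hw hw

lemma tsum_inner_sq_le (hφ : Orthonormal ℝ φ) (h : K) : ∑' i, inner ℝ (φ i) h ^ 2 ≤ ‖h‖ ^ 2 := by
  simpa using hφ.tsum_inner_products_le h

lemma summable_inner_sq (hφ : Orthonormal ℝ φ) (h : K) :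
    Summable fun i => inner ℝ (φ i) h ^ 2 := by
  simpa using hφ.inner_products_summable h

lemma summable_mul_inner_sq {a : ι → ℝ} {B : ℝ} (hφ : Orthonormal ℝ φ) (ha : ∀ i, |a i| ≤ B)
    (h : K) : Summable fun i => (a i * inner ℝ (φ i) h) ^ 2 := by
  refine .of_nonneg_of_le (fun i => sq_nonneg _) (fun i => ?_)
    ((summable_inner_sq hφ h).mul_left (B ^ 2))
  rw [mul_pow, ← sq_abs (a i)]
  gcongr
  exact ha i

lemma exists_hasSum_mul_inner_smul [CompleteSpace K] {a : ι → ℝ} {B : ℝ} (hφ : Orthonormal ℝ φ)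
    (ha : ∀ i, |a i| ≤ B) (h : K) : ∃ w, HasSum (fun i => (a i * inner ℝ (φ i) h) • φ i) w := by
  refine (hφ.orthogonalFamily.summable_iff_norm_sq_summable
    fun i => a i * inner ℝ (φ i) h).2 ?_
  simpa only [Real.norm_eq_abs, sq_abs] using summable_mul_inner_sq hφ ha h

lemma tsum_mul_inner_sq_le {a : ι → ℝ} {B : ℝ} (hφ : Orthonormal ℝ φ) (ha0 : ∀ i, 0 ≤ a i)
    (ha : ∀ i, a i ≤ B) (hB : 0 ≤ B) (h : K) :
    ∑' i, a i * inner ℝ (φ i) h ^ 2 ≤ B * ‖h‖ ^ 2 := by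
  have hs := (summable_inner_sq hφ h).mul_left B
  have hle : ∀ i, a i * inner ℝ (φ i) h ^ 2 ≤ B * inner ℝ (φ i) h ^ 2 := fun i =>
    mul_le_mul_of_nonneg_right (ha i) (sq_nonneg _)
  calc ∑' i, a i * inner ℝ (φ i) h ^ 2
      ≤ ∑' i, B * inner ℝ (φ i) h ^ 2 :=
        (hs.of_nonneg_of_le (fun i => mul_nonneg (ha0 i) (sq_nonneg _)) hle).tsum_le_tsum hle hs
    _ = B * ∑' i, inner ℝ (φ i) h ^ 2 := tsum_mul_left
    _ ≤ B * ‖h‖ ^ 2 := by gcongr; exact tsum_inner_sq_le hφ h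

end Orthonormal

section Ridge

variable {K : Type*} [NormedAddCommGroup K] [InnerProductSpace ℝ K] {S L : K →L[ℝ] K}
  {lam D : ℝ} {g h w w' : K}

lemma mul_norm_le_norm_add_smul (hS : ∀ f, 0 ≤ inner ℝ (S f) f) (w : K) :
    lam * ‖w‖ ≤ ‖S w + lam • w‖ := by
  rcases (norm_nonneg w).eq_or_lt with h0 | h0
  · simp [← h0]
  refine le_of_mul_le_mul_right ?_ h0
  calc lam * ‖w‖ * ‖w‖ ≤ inner ℝ (S w) w + lam * ‖w‖ ^ 2 := by linarith [hS w]
    _ = inner ℝ (S w + lam • w) w := by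
        simp [inner_add_left, inner_smul_left]
    _ ≤ ‖S w + lam • w‖ * ‖w‖ := real_inner_le_norm _ _

lemma mul_inner_le_norm_add_smul_sq (hS : ∀ f, 0 ≤ inner ℝ (S f) f) (hlam : 0 ≤ lam) (w : K) :
    lam * inner ℝ (S w) w ≤ ‖S w + lam • w‖ ^ 2 := by
  have hle : inner ℝ (S w) w ≤ ‖S w + lam • w‖ * ‖w‖ :=
    calc inner ℝ (S w) w ≤ inner ℝ (S w) w + lam * ‖w‖ ^ 2 := by
          have : 0 ≤ lam * ‖w‖ ^ 2 := by positivity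
          linarith
      _ = inner ℝ (S w + lam • w) w := by
          simp [inner_add_left, inner_smul_left]
      _ ≤ ‖S w + lam • w‖ * ‖w‖ := real_inner_le_norm _ _
  calc lam * inner ℝ (S w) w ≤ lam * (‖S w + lam • w‖ * ‖w‖) := by gcongr
    _ = ‖S w + lam • w‖ * (lam * ‖w‖) := by ring
    _ ≤ ‖S w + lam • w‖ * ‖S w + lam • w‖ := by gcongr; exact mul_norm_le_norm_add_smul hS w
    _ = ‖S w + lam • w‖ ^ 2 := (sq _).symm

lemma inner_add_le_two_mul (hS : ∀ f, 0 ≤ inner ℝ (S f) f) (u v : K) :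
    inner ℝ (S (u + v)) (u + v) ≤ 2 * inner ℝ (S u) u + 2 * inner ℝ (S v) v := by
  have h := hS (u - v)
  simp only [map_sub, map_add, inner_sub_left, inner_sub_right, inner_add_left,
    inner_add_right] at h ⊢
  linarith

lemma rpow_div_add_le {x lam r : ℝ} (hx : 0 ≤ x) (hlam : 0 < lam) (hr : 0 ≤ r) (hr1 : r ≤ 1) :
    x ^ r / (x + lam) ≤ lam ^ (r - 1) := by
  have hp : 0 < x + lam := by linarith
  rw [div_le_iff₀ hp]
  calc x ^ r ≤ (x + lam) ^ r := Real.rpow_le_rpow hx (by linarith) hr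
    _ = (x + lam) ^ (r - 1) * (x + lam) := by rw [Real.rpow_sub_one hp.ne']; field_simp
    _ ≤ lam ^ (r - 1) * (x + lam) := mul_le_mul_of_nonneg_right
        (Real.rpow_le_rpow_of_nonpos hlam (by linarith) (by linarith)) hp.le

lemma mul_sq_rpow_div_add_le {x lam r : ℝ} (hx : 0 ≤ x) (hlam : 0 ≤ lam) :
    x * (x ^ r / (x + lam)) ^ 2 ≤ x ^ (2 * r - 1) := by
  rcases hx.eq_or_lt with rfl | hx
  · rw [zero_mul]; exact Real.rpow_nonneg le_rfl _
  calc x * (x ^ r / (x + lam)) ^ 2 ≤ x * (x ^ r / x) ^ 2 := by gcongr; linarith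
    _ = x ^ (2 * r - 1) := by
        rw [Real.rpow_sub_one hx.ne', two_mul, Real.rpow_add hx]; field_simp

theorem exists_ridge_solution_of_source [CompleteSpace K] {ι : Type*} {μ : ι → ℝ} {φ : ι → K}
    {B r : ℝ} (hμ0 : ∀ i, 0 ≤ μ i) (hμB : ∀ i, μ i ≤ B) (hB : 0 ≤ B) (hφ : Orthonormal ℝ φ)
    (hL : ∀ i, L (φ i) = μ i • φ i) (hlam : 0 < lam) (hr : 1 / 2 ≤ r) (hr1 : r ≤ 1)
    (hg : HasSum (fun i => (μ i ^ r * inner ℝ (φ i) h) • φ i) g) :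
    ∃ w, L w + lam • w = g ∧ ‖w‖ ≤ lam ^ (r - 1) * ‖h‖ ∧
      inner ℝ (L w) w ≤ B ^ (2 * r - 1) * ‖h‖ ^ 2 := by
  set a : ι → ℝ := fun i => μ i ^ r / (μ i + lam) with ha
  have hpos : ∀ i, 0 < μ i + lam := fun i => by linarith [hμ0 i]
  have ha0 : ∀ i, 0 ≤ a i := fun i =>
    div_nonneg (Real.rpow_nonneg (hμ0 i) r) (hpos i).le
  have hale : ∀ i, a i ≤ lam ^ (r - 1) := fun i =>
    rpow_div_add_le (hμ0 i) hlam (by linarith) hr1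
  obtain ⟨w, hw⟩ := exists_hasSum_mul_inner_smul hφ
    (fun i => (abs_of_nonneg (ha0 i)).trans_le (hale i)) h
  have hLw : HasSum (fun i => (μ i * (a i * inner ℝ (φ i) h)) • φ i) (L w) := by
    simpa only [map_smul, hL, smul_smul, mul_comm] using hw.mapL L
  refine ⟨w, ?_, ?_, ?_⟩
  · refine (hLw.add (hw.const_smul lam)).unique ?_
    convert hg using 2 with i
    rw [smul_smul, ← add_smul, ← add_mul, ← mul_assoc, ha, mul_div_cancel₀ _ (hpos i).ne']
  · refine le_of_sq_le_sq ?_ (by positivity)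
    rw [← (hasSum_sq_of_hasSum_smul hφ hw).tsum_eq, mul_pow]
    simp_rw [mul_pow]
    exact tsum_mul_inner_sq_le hφ (fun i => sq_nonneg _)
      (fun i => pow_le_pow_left₀ (ha0 i) (hale i) 2) (by positivity) h
  · rw [← (hasSum_mul_of_hasSum_smul hφ hLw hw).tsum_eq]
    have hterm : ∀ i, μ i * (a i * inner ℝ (φ i) h) * (a i * inner ℝ (φ i) h)
        = μ i * a i ^ 2 * inner ℝ (φ i) h ^ 2 := fun i => by ring
    simp_rw [hterm]
    exact tsum_mul_inner_sq_le hφ (fun i => mul_nonneg (hμ0 i) (sq_nonneg _))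
      (fun i => (mul_sq_rpow_div_add_le (hμ0 i) hlam.le).trans
        (Real.rpow_le_rpow (hμ0 i) (hμB i) (by linarith))) (by positivity) h

lemma ridge_sub_eq (hw : S w + lam • w = g) (hw' : L w' + lam • w' = g) :
    S (w - w') + lam • (w - w') = L w' - S w' := by
  rw [map_sub, smul_sub, sub_add_sub_comm, hw, ← hw']
  abel

lemma mul_norm_sub_ridge_le (hS : ∀ f, 0 ≤ inner ℝ (S f) f)
    (hSL : ∀ f, ‖L f - S f‖ ≤ D * ‖f‖) (hw : S w + lam • w = g) (hw' : L w' + lam • w' = g) :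
    lam * ‖w - w'‖ ≤ D * ‖w'‖ := by
  refine (mul_norm_le_norm_add_smul hS (w - w')).trans ?_
  rw [ridge_sub_eq hw hw']
  exact hSL w'

lemma mul_inner_sub_ridge_le (hS : ∀ f, 0 ≤ inner ℝ (S f) f) (hlam : 0 ≤ lam)
    (hSL : ∀ f, ‖L f - S f‖ ≤ D * ‖f‖) (hw : S w + lam • w = g) (hw' : L w' + lam • w' = g) :
    lam * inner ℝ (S (w - w')) (w - w') ≤ (D * ‖w'‖) ^ 2 := by
  refine (mul_inner_le_norm_add_smul_sq hS hlam (w - w')).trans ?_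
  rw [ridge_sub_eq hw hw']
  gcongr
  exact hSL w'

lemma inner_le_inner_add_of_norm_sub_le (hSL : ∀ f, ‖L f - S f‖ ≤ D * ‖f‖) (f : K) :
    inner ℝ (S f) f ≤ inner ℝ (L f) f + D * ‖f‖ ^ 2 := by
  have h : inner ℝ (L f - S f) f ≥ -(D * ‖f‖ ^ 2) :=
    calc inner ℝ (L f - S f) f ≥ -(‖L f - S f‖ * ‖f‖) :=
          (abs_le.1 (abs_real_inner_le_norm _ _)).1
      _ ≥ -(D * ‖f‖ * ‖f‖) := by gcongr; exact hSL f
      _ = -(D * ‖f‖ ^ 2) := by ring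
  rw [inner_sub_left] at h
  linarith

variable {N E : ℝ}

lemma norm_ridge_le (hS : ∀ f, 0 ≤ inner ℝ (S f) f) (hlam : 0 < lam) (hD : 0 ≤ D)
    (hSL : ∀ f, ‖L f - S f‖ ≤ D * ‖f‖) (hw : S w + lam • w = g) (hw' : L w' + lam • w' = g)
    (hN : ‖w'‖ ≤ N) : ‖w‖ ≤ N * (1 + D / lam) :=
  calc ‖w‖ ≤ ‖w'‖ + ‖w - w'‖ := by simpa using norm_add_le w' (w - w')
    _ ≤ N + D * N / lam := by
        gcongr
        rw [le_div_iff₀' hlam]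
        exact (mul_norm_sub_ridge_le hS hSL hw hw').trans (by gcongr)
    _ = N * (1 + D / lam) := by ring

lemma inner_ridge_le (hS : ∀ f, 0 ≤ inner ℝ (S f) f) (hlam : 0 < lam) (hD : 0 ≤ D)
    (hSL : ∀ f, ‖L f - S f‖ ≤ D * ‖f‖) (hw : S w + lam • w = g) (hw' : L w' + lam • w' = g)
    (hN : ‖w'‖ ≤ N) (hE : inner ℝ (L w') w' ≤ E) :
    inner ℝ (S w) w ≤ 2 * (E + D * N ^ 2) + 2 * ((D * N) ^ 2 / lam) :=
  calc inner ℝ (S w) w ≤ 2 * inner ℝ (S w') w' + 2 * inner ℝ (S (w - w')) (w - w') := by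
        simpa using inner_add_le_two_mul hS w' (w - w')
    _ ≤ 2 * (E + D * N ^ 2) + 2 * ((D * N) ^ 2 / lam) := by
        gcongr
        · exact (inner_le_inner_add_of_norm_sub_le hSL w').trans (by gcongr)
        · rw [le_div_iff₀' hlam]
          exact (mul_inner_sub_ridge_le hS hlam.le hSL hw hw').trans (by gcongr)

theorem ridge_bounds_of_source [CompleteSpace K] {ι : Type*} {μ : ι → ℝ} {φ : ι → K} {B r : ℝ}
    (hS : ∀ f, 0 ≤ inner ℝ (S f) f) (hlam : 0 < lam) (hD : 0 ≤ D)
    (hSL : ∀ f, ‖L f - S f‖ ≤ D * ‖f‖) (hw : S w + lam • w = g)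
    (hμ0 : ∀ i, 0 ≤ μ i) (hμB : ∀ i, μ i ≤ B) (hB : 0 ≤ B) (hφ : Orthonormal ℝ φ)
    (hL : ∀ i, L (φ i) = μ i • φ i) (hr : 1 / 2 ≤ r) (hr1 : r ≤ 1)
    (hg : HasSum (fun i => (μ i ^ r * inner ℝ (φ i) h) • φ i) g) :
    lam * ‖w‖ ≤ lam ^ r * ‖h‖ * (1 + D / lam) ∧
      inner ℝ (S w) w ≤ 2 * (B ^ (2 * r - 1) + D * (lam ^ (r - 1)) ^ 2) * ‖h‖ ^ 2
        + 2 * D ^ 2 * (lam ^ (r - 1)) ^ 2 * ‖h‖ ^ 2 / lam := by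
  obtain ⟨w', hw', hN, hE⟩ := exists_ridge_solution_of_source hμ0 hμB hB hφ hL hlam hr hr1 hg
  constructor
  · calc lam * ‖w‖ ≤ lam * (lam ^ (r - 1) * ‖h‖ * (1 + D / lam)) := by
          gcongr
          exact norm_ridge_le hS hlam hD hSL hw hw' hN
      _ = lam ^ r * ‖h‖ * (1 + D / lam) := by
          rw [Real.rpow_sub_one hlam.ne']
          field_simp
  · refine (inner_ridge_le hS hlam hD hSL hw hw' hN hE).trans_eq ?_
    ring

lemma inner_ridge_le_div (hS : ∀ f, 0 ≤ inner ℝ (S f) f) (hlam : 0 < lam)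
    (hw : S w + lam • w = g) : inner ℝ (S w) w ≤ ‖g‖ ^ 2 / lam := by
  rw [le_div_iff₀' hlam, ← hw]
  exact mul_inner_le_norm_add_smul_sq hS hlam.le w

end Ridge

section EffectiveDimension

variable {K : Type*} [NormedAddCommGroup K] [InnerProductSpace ℝ K]

lemma hasSum_hilbertBasis_inner_sq {κ : Type*} (b : HilbertBasis κ ℝ K) (x : K) :
    HasSum (fun k => inner ℝ (b k) x ^ 2) (‖x‖ ^ 2) := by
  simpa only [real_inner_self_eq_norm_sq, real_inner_comm, ← sq] using b.hasSum_inner_mul_inner x x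

lemma sq_div_add_mul_sq_le {s m lam : ℝ} (hs : 0 ≤ s) (hm : 0 ≤ m) (hlam : 0 < lam) (a : ℝ) :
    (s / (s + lam)) ^ 2 * a ^ 2
      ≤ 2 * (m / (m + lam)) ^ 2 * a ^ 2 + 2 / lam ^ 2 * (m * a - s * a) ^ 2 := by
  set x := m / (m + lam) * a with hx
  set y := (m * a - s * a) / lam with hy
  set q := lam ^ 2 / ((s + lam) * (m + lam)) with hq
  have hq1 : q ≤ 1 := by
    rw [hq, div_le_one (by positivity)]
    nlinarith [mul_nonneg hs hm]
  have hqy : (q * y) ^ 2 ≤ y ^ 2 := by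
    rw [mul_pow]
    exact mul_le_of_le_one_left (sq_nonneg _) (pow_le_one₀ (by positivity) hq1)
  have hxy : s / (s + lam) * a = x - q * y := by rw [hx, hq, hy]; field_simp; ring
  calc (s / (s + lam)) ^ 2 * a ^ 2 = (x - q * y) ^ 2 := by rw [← mul_pow, hxy]
    _ ≤ 2 * x ^ 2 + 2 * (q * y) ^ 2 := by linarith [sq_nonneg (x + q * y)]
    _ ≤ 2 * x ^ 2 + 2 * y ^ 2 := by gcongr
    _ = _ := by rw [hx, hy]; ring

theorem sum_effectiveDim_le {κ ι : Type*} [Fintype ι] (b : HilbertBasis κ ℝ K) {m : κ → ℝ}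
    (hm : ∀ k, 0 ≤ m k) {L : K →L[ℝ] K} (hL : ∀ k f, inner ℝ (b k) (L f) = m k * inner ℝ (b k) f)
    {f : ι → K} (hf : Orthonormal ℝ f) {s : ι → ℝ} (hs : ∀ i, 0 ≤ s i) {lam : ℝ} (hlam : 0 < lam)
    {N : ℝ} (hN : HasSum (fun k => (m k / (m k + lam)) ^ 2) N) :
    ∑ i, (s i / (s i + lam)) ^ 2 ≤ 2 * N + 2 / lam ^ 2 * ∑ i, ‖L (f i) - s i • f i‖ ^ 2 := by
  have hleft : HasSum (fun k => ∑ i, (s i / (s i + lam)) ^ 2 * inner ℝ (b k) (f i) ^ 2)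
      (∑ i, (s i / (s i + lam)) ^ 2) := by
    refine hasSum_sum fun i _ => ?_
    simpa [hf.1 i] using (hasSum_hilbertBasis_inner_sq b (f i)).mul_left ((s i / (s i + lam)) ^ 2)
  have hres : HasSum (fun k => ∑ i, inner ℝ (b k) (L (f i) - s i • f i) ^ 2)
      (∑ i, ‖L (f i) - s i • f i‖ ^ 2) :=
    hasSum_sum fun i _ => hasSum_hilbertBasis_inner_sq b _
  refine hasSum_le (fun k => ?_) hleft ((hN.mul_left 2).add (hres.mul_left (2 / lam ^ 2)))
  have bessel : ∑ i, inner ℝ (b k) (f i) ^ 2 ≤ 1 := by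
    simpa [real_inner_comm, b.orthonormal.1 k] using
      hf.sum_inner_products_le (b k) (s := Finset.univ)
  calc ∑ i, (s i / (s i + lam)) ^ 2 * inner ℝ (b k) (f i) ^ 2
      ≤ ∑ i, (2 * (m k / (m k + lam)) ^ 2 * inner ℝ (b k) (f i) ^ 2
          + 2 / lam ^ 2 * inner ℝ (b k) (L (f i) - s i • f i) ^ 2) := by
        refine Finset.sum_le_sum fun i _ => ?_
        rw [inner_sub_right, hL, inner_smul_right]
        exact sq_div_add_mul_sq_le (hs i) (hm k) hlam _
    _ = 2 * (m k / (m k + lam)) ^ 2 * ∑ i, inner ℝ (b k) (f i) ^ 2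
          + 2 / lam ^ 2 * ∑ i, inner ℝ (b k) (L (f i) - s i • f i) ^ 2 := by
        rw [Finset.sum_add_distrib, ← Finset.mul_sum, ← Finset.mul_sum]
    _ ≤ _ := by
        refine add_le_add_left ?_ _
        exact mul_le_of_le_one_right (by positivity) bessel

variable [CompleteSpace K] {ι : Type*} {φ : ι → K}

lemma exists_hilbertBasis_extending (hφ : Orthonormal ℝ φ) :
    ∃ (w : Set K) (b : HilbertBasis w ℝ K) (j : ι ↪ w), ∀ i, b (j i) = φ i := by
  obtain ⟨w, b, hw, hb⟩ := hφ.toSubtypeRange.exists_hilbertBasis_extension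
  refine ⟨w, b, ⟨fun i => ⟨φ i, hw ⟨i, rfl⟩⟩, fun i i' h => ?_⟩, fun i => by rw [hb]; rfl⟩
  exact hφ.linearIndependent.injective (Subtype.ext_iff.1 h)

theorem exists_eigen_hilbertBasis {L : K →L[ℝ] K} {μ : ι → ℝ}
    (hsymm : ∀ f g, inner ℝ (L f) g = inner ℝ f (L g)) (hφ : Orthonormal ℝ φ)
    (hL : ∀ i, L (φ i) = μ i • φ i) (hcomplete : ∀ f, (∀ i, inner ℝ (φ i) f = 0) → L f = 0) :
    ∃ (w : Set K) (b : HilbertBasis w ℝ K) (j : ι ↪ w),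
      ∀ k f, inner ℝ (b k) (L f) = Function.extend j μ 0 k * inner ℝ (b k) f := by
  obtain ⟨w, b, j, hj⟩ := exists_hilbertBasis_extending hφ
  refine ⟨w, b, j, fun k f => ?_⟩
  suffices hLb : L (b k) = Function.extend j μ 0 k • b k by
    rw [← hsymm, hLb, inner_smul_left, conj_trivial]
  by_cases hk : ∃ i, j i = k
  · obtain ⟨i, rfl⟩ := hk
    rw [j.injective.extend_apply, hj, hL]
  · rw [Function.extend_apply' _ _ _ hk, Pi.zero_apply, zero_smul]
    refine hcomplete _ fun i => ?_
    rw [← hj]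
    exact b.orthonormal.2 fun h => hk ⟨i, h⟩

end EffectiveDimension

section LinearSGD

variable {X H : Type*} [NormedAddCommGroup H] [InnerProductSpace ℝ H] {Φ : X → H}
  {lam κ : ℝ} {u : H} {z : X × ℝ}

/-- The gradient at `u` of half the squared loss `(⟪Φ x, u⟫ - y) ^ 2 / 2` of the linear model with
feature map `Φ` at the sample `z = (x, y)`. -/
def linGrad (Φ : X → H) (u : H) (z : X × ℝ) : H :=
  (inner ℝ (Φ z.1) u - z.2) • Φ z.1

/-- One step of regularized stochastic gradient descent for the linear model with feature map
`Φ`. -/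
def linStep (Φ : X → H) (lam s : ℝ) (u : H) (z : X × ℝ) : H :=
  (1 - s * lam) • u - s • linGrad Φ u z

/-- Regularized stochastic gradient descent, started at zero, for the linear model with feature
map `Φ`; the step from `t` to `t + 1` samples has step size `s t`. -/
def linSgd (Φ : X → H) (lam : ℝ) (s : ℕ → ℝ) : (T : ℕ) → (Fin T → X × ℝ) → H
  | 0, _ => 0
  | T + 1, z => linStep Φ lam (s T) (linSgd Φ lam s T fun i => z i.castSucc) (z (Fin.last T))

lemma norm_linStep_sq_le {s : ℝ} (hs : 0 ≤ s) (hlam : 0 ≤ lam) (hsl : s * (lam + κ ^ 2) ≤ 1)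
    (hΦ : ‖Φ z.1‖ ≤ κ) (hy : |z.2| ≤ 1) :
    ‖linStep Φ lam s u z‖ ^ 2 ≤ (1 - s * lam) * ‖u‖ ^ 2 + s := by
  set f := inner ℝ (Φ z.1) u with hf
  have hexpand : ‖linStep Φ lam s u z‖ ^ 2 = (1 - s * lam) ^ 2 * ‖u‖ ^ 2
      - 2 * (1 - s * lam) * (s * (f - z.2)) * f + s * (f - z.2) ^ 2 * (s * ‖Φ z.1‖ ^ 2) := by
    rw [linStep, linGrad, smul_smul, norm_sub_sq_real, inner_smul_left, inner_smul_right,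
      norm_smul, norm_smul, real_inner_comm (Φ z.1) u, ← hf]
    simp only [mul_pow, Real.norm_eq_abs, sq_abs, conj_trivial]
    ring
  have hy2 : z.2 ^ 2 ≤ 1 := (sq_le_one_iff_abs_le_one _).2 hy
  have hsΦ : s * ‖Φ z.1‖ ^ 2 ≤ 1 - s * lam := by
    have : s * ‖Φ z.1‖ ^ 2 ≤ s * κ ^ 2 := by gcongr
    linarith
  have h0 : 0 ≤ 1 - s * lam := le_trans (by positivity) hsΦ
  have h1 : 1 - s * lam ≤ 1 := by linarith [mul_nonneg hs hlam]
  have hfit : s * (f - z.2) ^ 2 * (s * ‖Φ z.1‖ ^ 2) ≤ s * (f - z.2) ^ 2 * (1 - s * lam) := by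
    gcongr
  have hshrink : (1 - s * lam) ^ 2 * ‖u‖ ^ 2 ≤ (1 - s * lam) * ‖u‖ ^ 2 := by
    gcongr
    exact pow_le_of_le_one h0 h1 two_ne_zero
  have hlabel : s * ((1 - s * lam) * (z.2 ^ 2 - f ^ 2)) ≤ s * 1 := by
    gcongr
    exact (mul_le_of_le_one_right h0 (by linarith [sq_nonneg f])).trans h1
  rw [hexpand]
  linarith

lemma norm_linSgd_sq_le {s : ℕ → ℝ} (hs : ∀ t, 0 ≤ s t) (hlam : 0 < lam)
    (hsl : ∀ t, s t * (lam + κ ^ 2) ≤ 1) {T : ℕ} {z : Fin T → X × ℝ}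
    (hΦ : ∀ i, ‖Φ (z i).1‖ ≤ κ) (hy : ∀ i, |(z i).2| ≤ 1) :
    ‖linSgd Φ lam s T z‖ ^ 2 ≤ 1 / lam := by
  induction T with
  | zero => simp [linSgd, hlam.le]
  | succ T ih =>
    have hprev := ih (z := fun i => z i.castSucc) (fun i => hΦ _) (fun i => hy _)
    refine (norm_linStep_sq_le (hs T) hlam.le (hsl T) (hΦ (Fin.last T)) (hy _)).trans ?_
    have hcontr : 0 ≤ 1 - s T * lam := by linarith [hsl T, mul_nonneg (hs T) (sq_nonneg κ)]
    calc _ ≤ (1 - s T * lam) * (1 / lam) + s T := by gcongr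
      _ = 1 / lam := by field_simp; ring

section Measurability

variable [MeasurableSpace X] [FiniteDimensional ℝ H] [MeasurableSpace H] [BorelSpace H]

lemma measurable_linGrad (hΦ : Measurable Φ) :
    Measurable fun q : H × (X × ℝ) => linGrad Φ q.1 q.2 := by
  have hΦ' : Measurable fun q : H × (X × ℝ) => Φ q.2.1 := hΦ.comp (by fun_prop)
  exact ((hΦ'.inner measurable_fst).sub (by fun_prop)).smul hΦ'

lemma measurable_linStep (hΦ : Measurable Φ) (lam s : ℝ) :
    Measurable fun q : H × (X × ℝ) => linStep Φ lam s q.1 q.2 :=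
  (measurable_fst.const_smul _).sub ((measurable_linGrad hΦ).const_smul s)

lemma measurable_linSgd (hΦ : Measurable Φ) (lam : ℝ) (s : ℕ → ℝ) (T : ℕ) :
    Measurable (linSgd Φ lam s T) := by
  induction T with
  | zero => exact measurable_const
  | succ T ih =>
    have hinit : Measurable fun z : Fin (T + 1) → X × ℝ => fun i : Fin T => z i.castSucc := by
      fun_prop
    exact (measurable_linStep hΦ lam (s T)).comp
      ((ih.comp hinit).prodMk (measurable_pi_apply (Fin.last T)))

end Measurability

end LinearSGD

section SecondMoments

variable {Z H ι : Type*} [MeasurableSpace Z] {μ : Measure Z} [NormedAddCommGroup H]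
  [InnerProductSpace ℝ H] [Fintype ι]

lemma ae_pi_of_ae [IsProbabilityMeasure μ] {P : Z → Prop} (h : ∀ᵐ z ∂μ, P z) (T : ℕ) :
    ∀ᵐ z ∂(Measure.pi fun _ : Fin T => μ), ∀ i, P (z i) :=
  ae_all_iff.2 fun i =>
    (measurePreserving_eval (fun _ : Fin T => μ) i).quasiMeasurePreserving.ae h

lemma integral_sub_mul_sq_le [IsProbabilityMeasure μ] {G : Z → ℝ} (hG : MemLp G 2 μ) (m s : ℝ) :
    ∫ z, (m - s * G z) ^ 2 ∂μ ≤ (m - s * ∫ z, G z ∂μ) ^ 2 + s ^ 2 * ∫ z, G z ^ 2 ∂μ := by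
  have hG1 : Integrable G μ := hG.integrable one_le_two
  have hG2 : Integrable (fun z => G z ^ 2) μ := hG.integrable_sq
  have hexpand : ∀ z, (m - s * G z) ^ 2 = m ^ 2 - 2 * m * s * G z + s ^ 2 * G z ^ 2 :=
    fun z => by ring
  calc ∫ z, (m - s * G z) ^ 2 ∂μ
      = m ^ 2 - 2 * m * s * ∫ z, G z ∂μ + s ^ 2 * ∫ z, G z ^ 2 ∂μ := by
        simp_rw [hexpand]
        rw [integral_add (by fun_prop) (by fun_prop), integral_sub (by fun_prop) (by fun_prop),
          integral_const_mul, integral_const_mul]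
        simp
    _ ≤ _ := by linarith [sq_nonneg (s * ∫ z, G z ∂μ)]

lemma sum_inner_sq (e : OrthonormalBasis ι ℝ H) (v : H) : ∑ i, inner ℝ (e i) v ^ 2 = ‖v‖ ^ 2 := by
  simpa using e.sum_sq_norm_inner_right v

lemma integral_norm_sq_eq_sum (e : OrthonormalBasis ι ℝ H) {f : Z → H} (hf : MemLp f 2 μ) :
    ∫ z, ‖f z‖ ^ 2 ∂μ = ∑ i, ∫ z, inner ℝ (e i) (f z) ^ 2 ∂μ := by
  rw [← integral_finsetSum _ fun i _ => (hf.const_inner (e i)).integrable_sq]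
  simp_rw [sum_inner_sq]

end SecondMoments

section LinearModel

variable {X H ι : Type*} [MeasurableSpace X] [NormedAddCommGroup H] [InnerProductSpace ℝ H]
  [MeasurableSpace H] [Fintype ι]

/-- The assumptions on a linear model: bounded features and labels, an orthonormal eigenbasis `e`
of the covariance of the features with eigenvalues `ev`, and the regularized minimizer `ul`. -/
structure IsLinearModel (ρ : Measure (X × ℝ)) (Φ : X → H) (κ lam : ℝ)
    (e : OrthonormalBasis ι ℝ H) (ev : ι → ℝ) (ul : H) : Prop where
  measurable : Measurable Φ
  bound : ∀ᵐ z ∂ρ, ‖Φ z.1‖ ≤ κ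
  label : ∀ᵐ z ∂ρ, |z.2| ≤ 1
  lam_pos : 0 < lam
  eigen : ∀ i u, ∫ z, inner ℝ (e i) (Φ z.1) * inner ℝ (Φ z.1) u ∂ρ = ev i * inner ℝ (e i) u
  minimizer : ∀ i, ∫ z, z.2 * inner ℝ (e i) (Φ z.1) ∂ρ = (ev i + lam) * inner ℝ (e i) ul

/-- The second moment, after `T` steps with step sizes `s`, of the error that unit gradient noise
causes in a direction contracted by the factor `1 - s t * x` in step `t`. -/
def accumulatedNoise (s : ℕ → ℝ) (x : ℝ) (T : ℕ) : ℝ :=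
  ∑ t ∈ Finset.range T, s t ^ 2 * ∏ j ∈ Finset.Ico (t + 1) T, (1 - s j * x) ^ 2

lemma accumulatedNoise_succ (s : ℕ → ℝ) (x : ℝ) (T : ℕ) :
    accumulatedNoise s x (T + 1) = (1 - s T * x) ^ 2 * accumulatedNoise s x T + s T ^ 2 := by
  rw [accumulatedNoise, Finset.sum_range_succ, Finset.Ico_self, Finset.prod_empty, mul_one,
    accumulatedNoise, Finset.mul_sum]
  congr 1
  refine Finset.sum_congr rfl fun t ht => ?_
  rw [Finset.prod_Ico_succ_top (Finset.mem_range.1 ht)]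
  ring

lemma contraction_factor_le_one {s a lam κ : ℝ} (hs : 0 ≤ s) (ha : 0 ≤ a) (haκ : a ≤ κ ^ 2)
    (hlam : 0 ≤ lam) (hsl : s * (lam + 2 * κ ^ 2) ≤ 1) :
    (1 - s * (a + lam)) ^ 2 + 2 * s ^ 2 * κ ^ 2 * a ≤ 1 := by
  have hnn : 0 ≤ s * (a + lam) := by positivity
  have hκ : s * (2 * κ ^ 2) ≤ 1 := by nlinarith
  have hle : s * (a + lam) ≤ 1 := by nlinarith
  have hnoise : s * a * (s * (2 * κ ^ 2)) ≤ s * a * 1 := by gcongr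
  have hsq : (s * (a + lam)) ^ 2 ≤ s * (a + lam) := pow_le_of_le_one hnn hle two_ne_zero
  linarith [mul_nonneg hs hlam]

namespace IsLinearModel

variable {ρ : Measure (X × ℝ)} {Φ : X → H} {κ lam : ℝ} {e : OrthonormalBasis ι ℝ H}
  {ev : ι → ℝ} {ul : H}

lemma integral_inner_sq (hM : IsLinearModel ρ Φ κ lam e ev ul) (i : ι) :
    ∫ z, inner ℝ (e i) (Φ z.1) ^ 2 ∂ρ = ev i := by
  have h := hM.eigen i (e i)
  rw [real_inner_self_eq_norm_sq, e.orthonormal.1 i, one_pow, mul_one] at h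
  simpa only [real_inner_comm (e i), ← sq] using h

lemma ev_nonneg (hM : IsLinearModel ρ Φ κ lam e ev ul) (i : ι) : 0 ≤ ev i :=
  hM.integral_inner_sq i ▸ integral_nonneg fun _ => sq_nonneg _

lemma abs_residual_le (hM : IsLinearModel ρ Φ κ lam e ev ul) (u : H) :
    ∀ᵐ z ∂ρ, |inner ℝ (Φ z.1) u - z.2| ≤ κ * ‖u‖ + 1 := by
  filter_upwards [hM.bound, hM.label] with z hz hy
  exact (abs_sub _ _).trans
    (add_le_add ((abs_real_inner_le_norm _ _).trans (by gcongr)) hy)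

lemma norm_linGrad_le (hM : IsLinearModel ρ Φ κ lam e ev ul) (u : H) :
    ∀ᵐ z ∂ρ, ‖linGrad Φ u z‖ ≤ (κ * ‖u‖ + 1) * κ := by
  filter_upwards [hM.bound, hM.abs_residual_le u] with z hz hres
  rw [linGrad, norm_smul, Real.norm_eq_abs]
  exact mul_le_mul hres hz (norm_nonneg _) ((abs_nonneg _).trans hres)

variable [IsProbabilityMeasure ρ]

lemma kappa_nonneg (hM : IsLinearModel ρ Φ κ lam e ev ul) : 0 ≤ κ := by
  obtain ⟨z, hz⟩ := hM.bound.exists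
  exact (norm_nonneg _).trans hz

lemma memLp_label (hM : IsLinearModel ρ Φ κ lam e ev ul) :
    MemLp (fun z : X × ℝ => z.2) 2 ρ :=
  .of_bound measurable_snd.aestronglyMeasurable 1 hM.label

variable [FiniteDimensional ℝ H] [BorelSpace H]

lemma memLp_feature (hM : IsLinearModel ρ Φ κ lam e ev ul) : MemLp (fun z => Φ z.1) 2 ρ :=
  .of_bound (hM.measurable.comp measurable_fst).aestronglyMeasurable κ hM.bound

lemma memLp_linGrad (hM : IsLinearModel ρ Φ κ lam e ev ul) (u : H) : MemLp (linGrad Φ u) 2 ρ :=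
  .of_bound ((measurable_linGrad hM.measurable).comp
    (measurable_const.prodMk measurable_id)).aestronglyMeasurable _ (hM.norm_linGrad_le u)

lemma memLp_linStep (hM : IsLinearModel ρ Φ κ lam e ev ul) (s : ℝ) (u : H) :
    MemLp (linStep Φ lam s u) 2 ρ :=
  (memLp_const _).sub ((hM.memLp_linGrad u).const_smul s)

lemma sum_ev_le (hM : IsLinearModel ρ Φ κ lam e ev ul) : ∑ i, ev i ≤ κ ^ 2 := by
  simp_rw [← hM.integral_inner_sq]
  rw [← integral_norm_sq_eq_sum e hM.memLp_feature]
  calc ∫ z, ‖Φ z.1‖ ^ 2 ∂ρ ≤ ∫ _, κ ^ 2 ∂ρ := by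
        refine integral_mono_ae hM.memLp_feature.norm.integrable_sq (integrable_const _) ?_
        filter_upwards [hM.bound] with z hz
        gcongr
    _ = κ ^ 2 := by simp

lemma ev_le (hM : IsLinearModel ρ Φ κ lam e ev ul) (i : ι) : ev i ≤ κ ^ 2 :=
  (Finset.single_le_sum (fun j _ => hM.ev_nonneg j) (Finset.mem_univ i)).trans hM.sum_ev_le

lemma integral_inner_sq_eq_sum (hM : IsLinearModel ρ Φ κ lam e ev ul) (v : H) :
    ∫ z, inner ℝ (Φ z.1) v ^ 2 ∂ρ = ∑ i, ev i * inner ℝ (e i) v ^ 2 := by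
  have hint : ∀ i, Integrable
      (fun z => inner ℝ (e i) v * (inner ℝ (e i) (Φ z.1) * inner ℝ (Φ z.1) v)) ρ := fun i =>
    ((hM.memLp_feature.const_inner (e i)).integrable_mul
      (hM.memLp_feature.inner_const v)).const_mul _
  have hexpand : ∀ z : X × ℝ, inner ℝ (Φ z.1) v ^ 2
      = ∑ i, inner ℝ (e i) v * (inner ℝ (e i) (Φ z.1) * inner ℝ (Φ z.1) v) := fun z => by
    simp_rw [← mul_assoc, ← Finset.sum_mul, sq, ← e.sum_inner_mul_inner (Φ z.1) v]
    congr 1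
    exact Finset.sum_congr rfl fun i _ => by rw [real_inner_comm (e i) (Φ z.1), mul_comm]
  simp_rw [hexpand]
  rw [integral_finsetSum _ fun i _ => hint i]
  refine Finset.sum_congr rfl fun i _ => ?_
  rw [integral_const_mul, hM.eigen]
  ring

lemma integral_inner_linGrad (hM : IsLinearModel ρ Φ κ lam e ev ul) (i : ι) (u : H) :
    ∫ z, inner ℝ (e i) (linGrad Φ u z) ∂ρ
      = ev i * inner ℝ (e i) u - (ev i + lam) * inner ℝ (e i) ul := by
  have hexpand : ∀ z : X × ℝ, inner ℝ (e i) (linGrad Φ u z)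
      = inner ℝ (e i) (Φ z.1) * inner ℝ (Φ z.1) u - z.2 * inner ℝ (e i) (Φ z.1) := fun z => by
    rw [linGrad, inner_smul_right]; ring
  have hcoord := hM.memLp_feature.const_inner (𝕜 := ℝ) (e i)
  have hquad : Integrable (fun z => inner ℝ (e i) (Φ z.1) * inner ℝ (Φ z.1) u) ρ :=
    hcoord.integrable_mul (hM.memLp_feature.inner_const u)
  have hlin : Integrable (fun z => z.2 * inner ℝ (e i) (Φ z.1)) ρ :=
    hM.memLp_label.integrable_mul hcoord
  simp_rw [hexpand]
  rw [integral_sub hquad hlin, hM.eigen, hM.minimizer]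

lemma integral_inner_linStep_le (hM : IsLinearModel ρ Φ κ lam e ev ul) (i : ι) (s : ℝ) (u : H) :
    ∫ z, inner ℝ (e i) (linStep Φ lam s u z - ul) ^ 2 ∂ρ
      ≤ (1 - s * (ev i + lam)) ^ 2 * inner ℝ (e i) (u - ul) ^ 2
        + s ^ 2 * ∫ z, inner ℝ (e i) (linGrad Φ u z) ^ 2 ∂ρ := by
  have hstep : ∀ z, inner ℝ (e i) (linStep Φ lam s u z - ul)
      = ((1 - s * lam) * inner ℝ (e i) u - inner ℝ (e i) ul)
        - s * inner ℝ (e i) (linGrad Φ u z) := fun z => by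
    simp only [linStep, inner_sub_right, inner_smul_right]; ring
  simp_rw [hstep]
  refine (integral_sub_mul_sq_le ((hM.memLp_linGrad u).const_inner (e i)) _ s).trans_eq ?_
  rw [hM.integral_inner_linGrad, inner_sub_right]
  ring

lemma integral_inner_linGrad_sq_le (hM : IsLinearModel ρ Φ κ lam e ev ul) (i : ι) (u : H) :
    ∫ z, inner ℝ (e i) (linGrad Φ u z) ^ 2 ∂ρ
      ≤ ev i * (2 + 4 * κ ^ 2 * ‖ul‖ ^ 2 + 4 * κ ^ 2 * ‖u - ul‖ ^ 2) := by
  have hκ := hM.kappa_nonneg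
  have hu : ‖u‖ ≤ ‖ul‖ + ‖u - ul‖ := by simpa using norm_add_le ul (u - ul)
  have hsq : (κ * (‖ul‖ + ‖u - ul‖) + 1) ^ 2
      ≤ 2 + 4 * κ ^ 2 * ‖ul‖ ^ 2 + 4 * κ ^ 2 * ‖u - ul‖ ^ 2 := by
    linarith [sq_nonneg (κ * (‖ul‖ + ‖u - ul‖) - 1), sq_nonneg (κ * ‖ul‖ - κ * ‖u - ul‖)]
  rw [← hM.integral_inner_sq i, mul_comm, ← integral_const_mul]
  refine integral_mono_ae ((hM.memLp_linGrad u).const_inner (e i)).integrable_sq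
    ((hM.memLp_feature.const_inner (e i)).integrable_sq.const_mul _) ?_
  filter_upwards [hM.abs_residual_le u] with z hz
  rw [linGrad, inner_smul_right, mul_pow, ← sq_abs (_ - _)]
  gcongr
  exact (pow_le_pow_left₀ (abs_nonneg _) (hz.trans (by gcongr)) 2).trans hsq

lemma integral_norm_linGrad_sq_le (hM : IsLinearModel ρ Φ κ lam e ev ul) (u : H) :
    ∫ z, ‖linGrad Φ u z‖ ^ 2 ∂ρ
      ≤ κ ^ 2 * (2 * ∑ i, ev i * inner ℝ (e i) (u - ul) ^ 2 + 2 * (κ * ‖ul‖ + 1) ^ 2) := by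
  have hint : Integrable (fun z => 2 * inner ℝ (Φ z.1) (u - ul) ^ 2) ρ :=
    (hM.memLp_feature.inner_const (u - ul)).integrable_sq.const_mul 2
  calc ∫ z, ‖linGrad Φ u z‖ ^ 2 ∂ρ
      ≤ ∫ z, κ ^ 2 * (2 * inner ℝ (Φ z.1) (u - ul) ^ 2 + 2 * (κ * ‖ul‖ + 1) ^ 2) ∂ρ := by
        refine integral_mono_ae (hM.memLp_linGrad u).norm.integrable_sq
          ((hint.add (integrable_const _)).const_mul _) ?_
        filter_upwards [hM.bound, hM.abs_residual_le ul] with z hz hres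
        have hsplit : inner ℝ (Φ z.1) u - z.2
            = inner ℝ (Φ z.1) (u - ul) + (inner ℝ (Φ z.1) ul - z.2) := by
          rw [inner_sub_right]; ring
        have hres2 : (inner ℝ (Φ z.1) ul - z.2) ^ 2 ≤ (κ * ‖ul‖ + 1) ^ 2 :=
          sq_le_sq.2 (hres.trans (le_abs_self _))
        rw [linGrad, norm_smul, mul_pow, Real.norm_eq_abs, sq_abs, mul_comm, hsplit]
        gcongr
        exact (add_sq_le).trans (by linarith)
    _ = _ := by
        rw [integral_const_mul, integral_add hint (integrable_const _), integral_const_mul,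
          hM.integral_inner_sq_eq_sum]
        simp

lemma integral_norm_linStep_le (hM : IsLinearModel ρ Φ κ lam e ev ul) {s : ℝ} (hs : 0 ≤ s)
    (hsl : s * (lam + 2 * κ ^ 2) ≤ 1) (u : H) :
    ∫ z, ‖linStep Φ lam s u z - ul‖ ^ 2 ∂ρ
      ≤ ‖u - ul‖ ^ 2 + 2 * κ ^ 2 * (κ * ‖ul‖ + 1) ^ 2 * s ^ 2 := by
  set x : ι → ℝ := fun i => inner ℝ (e i) (u - ul) with hx
  calc ∫ z, ‖linStep Φ lam s u z - ul‖ ^ 2 ∂ρ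
      = ∑ i, ∫ z, inner ℝ (e i) (linStep Φ lam s u z - ul) ^ 2 ∂ρ :=
        integral_norm_sq_eq_sum e ((hM.memLp_linStep s u).sub (memLp_const ul))
    _ ≤ ∑ i, ((1 - s * (ev i + lam)) ^ 2 * x i ^ 2
        + s ^ 2 * ∫ z, inner ℝ (e i) (linGrad Φ u z) ^ 2 ∂ρ) :=
        Finset.sum_le_sum fun i _ => hM.integral_inner_linStep_le i s u
    _ = ∑ i, (1 - s * (ev i + lam)) ^ 2 * x i ^ 2 + s ^ 2 * ∫ z, ‖linGrad Φ u z‖ ^ 2 ∂ρ := by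
        rw [Finset.sum_add_distrib, ← Finset.mul_sum,
          ← integral_norm_sq_eq_sum e (hM.memLp_linGrad u)]
    _ ≤ ∑ i, (1 - s * (ev i + lam)) ^ 2 * x i ^ 2
        + s ^ 2 * (κ ^ 2 * (2 * ∑ i, ev i * x i ^ 2 + 2 * (κ * ‖ul‖ + 1) ^ 2)) := by
        gcongr
        exact hM.integral_norm_linGrad_sq_le u
    _ = ∑ i, ((1 - s * (ev i + lam)) ^ 2 + 2 * s ^ 2 * κ ^ 2 * ev i) * x i ^ 2
        + 2 * κ ^ 2 * (κ * ‖ul‖ + 1) ^ 2 * s ^ 2 := by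
        simp_rw [add_mul, Finset.sum_add_distrib, mul_assoc, ← Finset.mul_sum]
        ring
    _ ≤ ∑ i, x i ^ 2 + 2 * κ ^ 2 * (κ * ‖ul‖ + 1) ^ 2 * s ^ 2 := by
        gcongr with i
        exact mul_le_of_le_one_left (sq_nonneg _)
          (contraction_factor_le_one hs (hM.ev_nonneg i) (hM.ev_le i) hM.lam_pos.le hsl)
    _ = _ := by rw [hx, sum_inner_sq]

variable {s : ℕ → ℝ}

lemma integrable_linSgd (hM : IsLinearModel ρ Φ κ lam e ev ul) (hs : ∀ t, 0 ≤ s t)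
    (hsl : ∀ t, s t * (lam + κ ^ 2) ≤ 1) (T : ℕ) {F : H → ℝ} (hF : Continuous F) :
    Integrable (fun z => F (linSgd Φ lam s T z)) (Measure.pi fun _ : Fin T => ρ) := by
  obtain ⟨C, hC⟩ := (isCompact_closedBall (0 : H)
    (Real.sqrt (1 / lam))).exists_bound_of_continuousOn hF.continuousOn
  refine Integrable.of_bound
    (hF.measurable.comp (measurable_linSgd hM.measurable lam s T)).aestronglyMeasurable C ?_
  filter_upwards [ae_pi_of_ae hM.bound T, ae_pi_of_ae hM.label T] with z hΦ hy
  exact hC _ (mem_closedBall_zero_iff.2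
    (Real.le_sqrt_of_sq_le (norm_linSgd_sq_le hs hM.lam_pos hsl hΦ hy)))

lemma integral_linSgd_succ_le (hM : IsLinearModel ρ Φ κ lam e ev ul) (hs : ∀ t, 0 ≤ s t)
    (hsl : ∀ t, s t * (lam + κ ^ 2) ≤ 1) (T : ℕ) {F G : H → ℝ} (hF : Continuous F)
    (hG : Continuous G) (hFG : ∀ u, ∫ z, F (linStep Φ lam (s T) u z) ∂ρ ≤ G u) :
    ∫ z, F (linSgd Φ lam s (T + 1) z) ∂(Measure.pi fun _ : Fin (T + 1) => ρ)
      ≤ ∫ z, G (linSgd Φ lam s T z) ∂(Measure.pi fun _ : Fin T => ρ) := by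
  have hmp := measurePreserving_piFinSuccAbove (fun _ : Fin (T + 1) => ρ) (Fin.last T)
  set f : (X × ℝ) × (Fin T → X × ℝ) → ℝ :=
    fun q => F (linStep Φ lam (s T) (linSgd Φ lam s T q.2) q.1) with hf
  have hcomp : (fun z => F (linSgd Φ lam s (T + 1) z))
      = f ∘ (MeasurableEquiv.piFinSuccAbove (fun _ : Fin (T + 1) => X × ℝ) (Fin.last T)) := by
    funext z
    simp only [hf, linSgd, Function.comp_apply, MeasurableEquiv.piFinSuccAbove_apply,
      Fin.insertNthEquiv_symm_apply, Fin.removeNth_last]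
    rfl
  have hfi : Integrable f (ρ.prod (Measure.pi fun _ : Fin T => ρ)) := by
    have hFi := hM.integrable_linSgd hs hsl (T + 1) hF
    rw [hcomp] at hFi
    exact (hmp.integrable_comp_emb (MeasurableEquiv.measurableEmbedding _)).1 hFi
  calc ∫ z, F (linSgd Φ lam s (T + 1) z) ∂(Measure.pi fun _ : Fin (T + 1) => ρ)
      = ∫ q, f q ∂(ρ.prod (Measure.pi fun _ : Fin T => ρ)) := by
        rw [hcomp]
        exact hmp.integral_comp' f
    _ = ∫ v, ∫ z, f (z, v) ∂ρ ∂(Measure.pi fun _ : Fin T => ρ) := integral_prod_symm f hfi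
    _ ≤ _ := integral_mono hfi.integral_prod_right (hM.integrable_linSgd hs hsl T hG)
        fun z => hFG (linSgd Φ lam s T z)

lemma integral_norm_linSgd_le (hM : IsLinearModel ρ Φ κ lam e ev ul) (hs : ∀ t, 0 ≤ s t)
    (hsl : ∀ t, s t * (lam + 2 * κ ^ 2) ≤ 1) (T : ℕ) :
    ∫ z, ‖linSgd Φ lam s T z - ul‖ ^ 2 ∂(Measure.pi fun _ : Fin T => ρ)
      ≤ ‖ul‖ ^ 2 + 2 * κ ^ 2 * (κ * ‖ul‖ + 1) ^ 2 * ∑ t ∈ Finset.range T, s t ^ 2 := by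
  have hsl' : ∀ t, s t * (lam + κ ^ 2) ≤ 1 := fun t => by
    linarith [hsl t, mul_nonneg (hs t) (sq_nonneg κ)]
  induction T with
  | zero => simp [linSgd]
  | succ T ih =>
    refine (hM.integral_linSgd_succ_le hs hsl' T (F := fun u => ‖u - ul‖ ^ 2) (by fun_prop)
      (G := fun u => ‖u - ul‖ ^ 2 + 2 * κ ^ 2 * (κ * ‖ul‖ + 1) ^ 2 * s T ^ 2) (by fun_prop)
      fun u => hM.integral_norm_linStep_le (hs T) (hsl T) u).trans ?_
    rw [integral_add (hM.integrable_linSgd hs hsl' T (F := fun u => ‖u - ul‖ ^ 2) (by fun_prop))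
      (integrable_const _), Finset.sum_range_succ]
    simp only [integral_const, probReal_univ, smul_eq_mul, one_mul]
    linarith

lemma integral_inner_linSgd_succ_le (hM : IsLinearModel ρ Φ κ lam e ev ul) (hs : ∀ t, 0 ≤ s t)
    (hsl : ∀ t, s t * (lam + κ ^ 2) ≤ 1) (i : ι) (T : ℕ) :
    ∫ z, inner ℝ (e i) (linSgd Φ lam s (T + 1) z - ul) ^ 2 ∂(Measure.pi fun _ : Fin (T + 1) => ρ)
      ≤ (1 - s T * (ev i + lam)) ^ 2
          * ∫ z, inner ℝ (e i) (linSgd Φ lam s T z - ul) ^ 2 ∂(Measure.pi fun _ : Fin T => ρ)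
        + s T ^ 2 * ev i * (2 + 4 * κ ^ 2 * ‖ul‖ ^ 2 + 4 * κ ^ 2
          * ∫ z, ‖linSgd Φ lam s T z - ul‖ ^ 2 ∂(Measure.pi fun _ : Fin T => ρ)) := by
  have hnorm := hM.integrable_linSgd hs hsl T (F := fun u => ‖u - ul‖ ^ 2) (by fun_prop)
  have hcoord := hM.integrable_linSgd hs hsl T (F := fun u => inner ℝ (e i) (u - ul) ^ 2)
    (by fun_prop)
  refine (hM.integral_linSgd_succ_le hs hsl T (F := fun u => inner ℝ (e i) (u - ul) ^ 2)
    (by fun_prop) (G := fun u => (1 - s T * (ev i + lam)) ^ 2 * inner ℝ (e i) (u - ul) ^ 2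
      + s T ^ 2 * ev i * (2 + 4 * κ ^ 2 * ‖ul‖ ^ 2 + 4 * κ ^ 2 * ‖u - ul‖ ^ 2)) (by fun_prop)
    fun u => ?_).trans_eq ?_
  · rw [mul_assoc (s T ^ 2)]
    refine (hM.integral_inner_linStep_le i (s T) u).trans ?_
    gcongr
    exact hM.integral_inner_linGrad_sq_le i u
  · rw [integral_add (by fun_prop) (by fun_prop), integral_const_mul, integral_const_mul,
      integral_add (integrable_const _) (by fun_prop), integral_const_mul]
    simp only [integral_const, probReal_univ, smul_eq_mul, one_mul]

theorem integral_inner_linSgd_le (hM : IsLinearModel ρ Φ κ lam e ev ul) (hs : ∀ t, 0 ≤ s t)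
    (hsl : ∀ t, s t * (lam + 2 * κ ^ 2) ≤ 1) {V : ℝ}
    (hV : ∀ T, ∑ t ∈ Finset.range T, s t ^ 2 ≤ V) (i : ι) (T : ℕ) :
    ∫ z, inner ℝ (e i) (linSgd Φ lam s T z - ul) ^ 2 ∂(Measure.pi fun _ : Fin T => ρ)
      ≤ (∏ j ∈ Finset.range T, (1 - s j * (ev i + lam)) ^ 2) * inner ℝ (e i) ul ^ 2
        + (2 + 8 * κ ^ 2 * ‖ul‖ ^ 2 + 8 * κ ^ 4 * (κ * ‖ul‖ + 1) ^ 2 * V) * ev i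
          * accumulatedNoise s (ev i + lam) T := by
  have hsl' : ∀ t, s t * (lam + κ ^ 2) ≤ 1 := fun t => by
    linarith [hsl t, mul_nonneg (hs t) (sq_nonneg κ)]
  induction T with
  | zero => simp [linSgd, accumulatedNoise]
  | succ T ih =>
    have hev := hM.ev_nonneg i
    have hnorm : ∫ z, ‖linSgd Φ lam s T z - ul‖ ^ 2 ∂(Measure.pi fun _ : Fin T => ρ)
        ≤ ‖ul‖ ^ 2 + 2 * κ ^ 2 * (κ * ‖ul‖ + 1) ^ 2 * V :=
      (hM.integral_norm_linSgd_le hs hsl T).trans (by gcongr; exact hV T)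
    rw [accumulatedNoise_succ, Finset.prod_range_succ]
    refine (hM.integral_inner_linSgd_succ_le hs hsl' i T).trans ?_
    linarith [mul_le_mul_of_nonneg_left ih (sq_nonneg (1 - s T * (ev i + lam))),
      mul_le_mul_of_nonneg_left hnorm (show 0 ≤ s T ^ 2 * ev i * (4 * κ ^ 2) by positivity)]

end IsLinearModel

end LinearModel

section StepSizes

variable {s : ℕ → ℝ} {x : ℝ}

lemma prod_one_sub_sq_le_exp (I : Finset ℕ) (h : ∀ j, s j * x ≤ 1) :
    ∏ j ∈ I, (1 - s j * x) ^ 2 ≤ Real.exp (-2 * x * ∑ j ∈ I, s j) := by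
  rw [Finset.mul_sum, Real.exp_sum]
  refine Finset.prod_le_prod (fun _ _ => sq_nonneg _) fun j _ => ?_
  have h0 : 0 ≤ 1 - s j * x := sub_nonneg.2 (h j)
  calc (1 - s j * x) ^ 2 ≤ Real.exp (-(s j * x)) ^ 2 := by
        gcongr
        exact Real.one_sub_le_exp_neg _
    _ = Real.exp (-2 * x * s j) := by rw [← Real.exp_nat_mul]; congr 1; push_cast; ring

lemma sum_mul_prod_one_sub_sq_le_one (h0 : ∀ j, 0 ≤ s j * x) (h1 : ∀ j, s j * x ≤ 1) (n T : ℕ) :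
    ∑ t ∈ Finset.Ico n T, s t * x * ∏ j ∈ Finset.Ico (t + 1) T, (1 - s j * x) ^ 2 ≤ 1 := by
  induction T with
  | zero => simp
  | succ T ih =>
    rcases lt_or_ge T n with hn | hn
    · simp [Finset.Ico_eq_empty_of_le (Nat.succ_le_of_lt hn)]
    have hsucc : ∑ t ∈ Finset.Ico n (T + 1),
          s t * x * ∏ j ∈ Finset.Ico (t + 1) (T + 1), (1 - s j * x) ^ 2
        = (1 - s T * x) ^ 2 * (∑ t ∈ Finset.Ico n T,
          s t * x * ∏ j ∈ Finset.Ico (t + 1) T, (1 - s j * x) ^ 2) + s T * x := by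
      rw [Finset.sum_Ico_succ_top hn, Finset.mul_sum, Finset.Ico_self, Finset.prod_empty, mul_one]
      congr 1
      refine Finset.sum_congr rfl fun t ht => ?_
      rw [Finset.prod_Ico_succ_top (Finset.mem_Ico.1 ht).2]
      ring
    have hcontr : (1 - s T * x) ^ 2 ≤ 1 - s T * x :=
      pow_le_of_le_one (sub_nonneg.2 (h1 T)) (sub_le_self _ (h0 T)) two_ne_zero
    rw [hsucc]
    linarith [mul_le_of_le_one_right (sq_nonneg (1 - s T * x)) ih]

/-- The step sizes `η t ^ (-θ)` of the paper, indexed from `t = 0` instead of `t = 1`. -/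
def stepSize (η θ : ℝ) (t : ℕ) : ℝ := η * ((t + 1 : ℕ) : ℝ) ^ (-θ)

variable {η θ lam : ℝ} {T : ℕ}

lemma stepSize_nonneg (hη : 0 ≤ η) (t : ℕ) : 0 ≤ stepSize η θ t := by
  unfold stepSize; positivity

lemma stepSize_le (hη : 0 ≤ η) (hθ : 0 ≤ θ) (t : ℕ) : stepSize η θ t ≤ η :=
  mul_le_of_le_one_right hη
    (Real.rpow_le_one_of_one_le_of_nonpos (Nat.one_le_cast.2 t.succ_pos) (neg_nonpos.2 hθ))

lemma exists_sum_stepSize_sq_le (η : ℝ) (hθ : 1 / 2 < θ) :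
    ∃ V : ℝ, 0 ≤ V ∧ ∀ T, ∑ t ∈ Finset.range T, stepSize η θ t ^ 2 ≤ V := by
  have hzeta : Summable fun n : ℕ => (n : ℝ) ^ (-(2 * θ)) := by
    rw [Real.summable_nat_rpow]; linarith
  have hsum : Summable fun n : ℕ => stepSize η θ n ^ 2 := by
    refine (((summable_nat_add_iff 1).2 hzeta).mul_left (η ^ 2)).congr fun n => ?_
    rw [stepSize, mul_pow, ← Real.rpow_natCast (_ ^ (-θ)), ← Real.rpow_mul (by positivity)]
    congr 2; push_cast; ring
  exact ⟨∑' n, stepSize η θ n ^ 2, tsum_nonneg fun _ => sq_nonneg _, fun T =>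
    hsum.sum_le_tsum _ fun _ _ => sq_nonneg _⟩

lemma stepSize_le_of_half_le (hη : 0 ≤ η) (hθ : 0 ≤ θ) (hθ1 : θ ≤ 1) (hT : 1 ≤ T) {t : ℕ}
    (ht : T / 2 ≤ t) : stepSize η θ t ≤ 2 * η * (T : ℝ) ^ (-θ) := by
  have hT0 : (0 : ℝ) < T := by exact_mod_cast hT
  have hhalf : (T : ℝ) / 2 ≤ ((t + 1 : ℕ) : ℝ) := by
    have : (T : ℝ) ≤ 2 * ((t + 1 : ℕ) : ℝ) := by exact_mod_cast (by omega : T ≤ 2 * (t + 1))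
    linarith
  have hpow : ((t + 1 : ℕ) : ℝ) ^ (-θ) ≤ (T : ℝ) ^ (-θ) * 2 :=
    calc ((t + 1 : ℕ) : ℝ) ^ (-θ) ≤ ((T : ℝ) / 2) ^ (-θ) :=
          Real.rpow_le_rpow_of_nonpos (by positivity) hhalf (by linarith)
      _ = (T : ℝ) ^ (-θ) * 2 ^ θ := by
          rw [Real.div_rpow hT0.le zero_le_two, Real.rpow_neg zero_le_two, div_inv_eq_mul]
      _ ≤ (T : ℝ) ^ (-θ) * 2 := by
          gcongr
          simpa using Real.rpow_le_rpow_of_exponent_le one_le_two hθ1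
  calc stepSize η θ t ≤ η * ((T : ℝ) ^ (-θ) * 2) := mul_le_mul_of_nonneg_left hpow hη
    _ = _ := by ring

lemma le_sum_stepSize (hη : 0 ≤ η) (hθ : 0 ≤ θ) (hT : 1 ≤ T) {n : ℕ} (hn : n ≤ T / 2) :
    η / 2 * (T : ℝ) ^ (1 - θ) ≤ ∑ j ∈ Finset.Ico n T, stepSize η θ j := by
  have hT0 : (0 : ℝ) < T := by exact_mod_cast hT
  have hlast : ∀ j ∈ Finset.Ico n T, η * (T : ℝ) ^ (-θ) ≤ stepSize η θ j := fun j hj =>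
    mul_le_mul_of_nonneg_left (Real.rpow_le_rpow_of_nonpos (by positivity)
      (by exact_mod_cast (Finset.mem_Ico.1 hj).2) (by linarith)) hη
  have hcard : (T : ℝ) / 2 ≤ ((T - n : ℕ) : ℝ) := by
    have : (T : ℝ) ≤ 2 * ((T - n : ℕ) : ℝ) := by exact_mod_cast (by omega : T ≤ 2 * (T - n))
    linarith
  calc η / 2 * (T : ℝ) ^ (1 - θ) = (T : ℝ) / 2 * (η * (T : ℝ) ^ (-θ)) := by
        rw [sub_eq_add_neg, Real.rpow_add hT0, Real.rpow_one]; ring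
    _ ≤ ((T - n : ℕ) : ℝ) * (η * (T : ℝ) ^ (-θ)) := by gcongr
    _ = (Finset.Ico n T).card • (η * (T : ℝ) ^ (-θ)) := by rw [Nat.card_Ico, nsmul_eq_mul]
    _ ≤ _ := Finset.card_nsmul_le_sum _ _ _ hlast

lemma sum_early_noise_le (hη : 0 ≤ η) (hθ : 0 ≤ θ) (hT : 1 ≤ T) (hx : 0 ≤ x)
    (hstep : ∀ j, stepSize η θ j * x ≤ 1) :
    ∑ t ∈ Finset.range (T / 2), stepSize η θ t ^ 2
        * ∏ j ∈ Finset.Ico (t + 1) T, (1 - stepSize η θ j * x) ^ 2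
      ≤ (∑ t ∈ Finset.range (T / 2), stepSize η θ t ^ 2)
        * Real.exp (-x * (η * (T : ℝ) ^ (1 - θ))) := by
  rw [Finset.sum_mul]
  refine Finset.sum_le_sum fun t ht => ?_
  gcongr
  refine (prod_one_sub_sq_le_exp _ hstep).trans (Real.exp_le_exp.2 ?_)
  linarith [mul_le_mul_of_nonneg_left
    (le_sum_stepSize hη hθ hT (n := t + 1) (Finset.mem_range.1 ht)) hx]

lemma sum_late_noise_le (hη : 0 ≤ η) (hθ : 0 ≤ θ) (hθ1 : θ ≤ 1) (hT : 1 ≤ T) (hx : 0 ≤ x)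
    (hstep : ∀ j, stepSize η θ j * x ≤ 1) :
    x * ∑ t ∈ Finset.Ico (T / 2) T, stepSize η θ t ^ 2
        * ∏ j ∈ Finset.Ico (t + 1) T, (1 - stepSize η θ j * x) ^ 2
      ≤ 2 * η * (T : ℝ) ^ (-θ) := by
  have hs := stepSize_nonneg (θ := θ) hη
  calc _ = ∑ t ∈ Finset.Ico (T / 2) T, stepSize η θ t
            * (stepSize η θ t * x * ∏ j ∈ Finset.Ico (t + 1) T, (1 - stepSize η θ j * x) ^ 2) := by
        rw [Finset.mul_sum]
        exact Finset.sum_congr rfl fun t _ => by ring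
    _ ≤ ∑ t ∈ Finset.Ico (T / 2) T, 2 * η * (T : ℝ) ^ (-θ)
            * (stepSize η θ t * x * ∏ j ∈ Finset.Ico (t + 1) T, (1 - stepSize η θ j * x) ^ 2) := by
        refine Finset.sum_le_sum fun t ht => mul_le_mul_of_nonneg_right
          (stepSize_le_of_half_le hη hθ hθ1 hT (Finset.mem_Ico.1 ht).1) ?_
        exact mul_nonneg (mul_nonneg (hs t) hx) (Finset.prod_nonneg fun _ _ => sq_nonneg _)
    _ ≤ _ := by
        rw [← Finset.mul_sum]
        exact mul_le_of_le_one_right (by positivity)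
          (sum_mul_prod_one_sub_sq_le_one (fun j => mul_nonneg (hs j) hx) hstep _ _)

lemma sq_mul_accumulatedNoise_le (hη : 0 ≤ η) (hθ : 0 ≤ θ) (hθ1 : θ ≤ 1) (hT : 1 ≤ T) {V : ℝ}
    (hx : 0 ≤ x) (hlam : 0 ≤ lam) (hstep : ∀ j, stepSize η θ j * (x + lam) ≤ 1)
    (hV : ∀ T, ∑ t ∈ Finset.range T, stepSize η θ t ^ 2 ≤ V) :
    x ^ 2 * accumulatedNoise (stepSize η θ) (x + lam) T
      ≤ V * (x ^ 2 * Real.exp (-(x + lam) * (η * (T : ℝ) ^ (1 - θ))))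
        + 2 * η * (T : ℝ) ^ (-θ) * x := by
  have hxlam : 0 ≤ x + lam := add_nonneg hx hlam
  have hlate_nonneg : 0 ≤ ∑ t ∈ Finset.Ico (T / 2) T, stepSize η θ t ^ 2
        * ∏ j ∈ Finset.Ico (t + 1) T, (1 - stepSize η θ j * (x + lam)) ^ 2 :=
    Finset.sum_nonneg fun t _ => mul_nonneg (sq_nonneg _)
      (Finset.prod_nonneg fun _ _ => sq_nonneg _)
  have hearly := (sum_early_noise_le hη hθ hT hxlam hstep).trans
    (mul_le_mul_of_nonneg_right (hV (T / 2)) (Real.exp_nonneg _))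
  have hlate := (mul_le_mul_of_nonneg_right (le_add_of_nonneg_right hlam) hlate_nonneg).trans
    (sum_late_noise_le hη hθ hθ1 hT hxlam hstep)
  rw [accumulatedNoise, ← Finset.sum_range_add_sum_Ico _ (Nat.div_le_self T 2), mul_add]
  refine add_le_add ?_ ?_
  · linarith [mul_le_mul_of_nonneg_left hearly (sq_nonneg x)]
  · linarith [mul_le_mul_of_nonneg_left hlate hx]

lemma sq_mul_exp_le_effectiveDim (hx : 0 ≤ x) (hlam : 0 < lam) (hη : 0 < η) :
    x ^ 2 * Real.exp (-(x + lam) * (η * (1 / lam)))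
      ≤ 2 / η ^ 2 * lam ^ 2 * (x / (x + lam)) ^ 2 := by
  have : 0 < x + lam := by linarith
  set y := η * ((x + lam) / lam) with hy
  have hy0 : 0 < y := by positivity
  have hneg : -(x + lam) * (η * (1 / lam)) = -y := by rw [hy]; field_simp
  have hexp : y ^ 2 / 2 ≤ Real.exp y := by linarith [Real.quadratic_le_exp_of_nonneg hy0.le]
  rw [hneg, Real.exp_neg]
  calc x ^ 2 * (Real.exp y)⁻¹ ≤ x ^ 2 * (y ^ 2 / 2)⁻¹ := by gcongr
    _ = _ := by rw [hy]; field_simp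

lemma mul_exp_neg_le {S : ℝ} (hx : 0 ≤ x) (hS : 0 < S) :
    x * Real.exp (-2 * x * S) ≤ (1 / S) ^ 2 * x⁻¹ := by
  rcases hx.eq_or_lt with rfl | hx
  · simp
  have hle : x * S ≤ Real.exp (x * S) := by linarith [Real.add_one_le_exp (x * S)]
  have hexp : Real.exp (-2 * x * S) = (Real.exp (x * S) ^ 2)⁻¹ := by
    rw [← Real.exp_nat_mul, ← Real.exp_neg]; congr 1; push_cast; ring
  calc x * Real.exp (-2 * x * S) ≤ x * ((x * S) ^ 2)⁻¹ := by rw [hexp]; gcongr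
    _ = _ := by field_simp

lemma exists_exp_neg_mul_rpow_le {a : ℝ} (hη : 0 < η) (ha : 0 < a) (θ : ℝ) :
    ∃ C : ℝ, 0 ≤ C ∧ ∀ T : ℝ, 1 ≤ T → Real.exp (-(η * T ^ a)) ≤ C * T ^ (-θ) := by
  obtain ⟨k, hk⟩ := exists_nat_ge (θ / a)
  refine ⟨k.factorial / η ^ k, by positivity, fun T hT => ?_⟩
  have hT0 : 0 < T := zero_lt_one.trans_le hT
  have hexp : (η * T ^ a) ^ k / k.factorial ≤ Real.exp (η * T ^ a) :=
    Real.pow_div_factorial_le_exp _ (by positivity) k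
  rw [Real.exp_neg]
  calc (Real.exp (η * T ^ a))⁻¹ ≤ ((η * T ^ a) ^ k / k.factorial)⁻¹ := by gcongr
    _ = k.factorial / η ^ k * T ^ (-(a * k)) := by
        rw [mul_pow, ← Real.rpow_natCast (T ^ a), ← Real.rpow_mul hT0.le, Real.rpow_neg hT0.le]
        field_simp
    _ ≤ _ := by
        gcongr
        rw [div_le_iff₀ ha] at hk; linarith

end StepSizes

section Spectral

lemma sum_subtype_ne_zero {ι : Type*} [Fintype ι] {ev f : ι → ℝ}
    (hf : ∀ i, ev i = 0 → f i = 0) :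
    ∑ i : {i // ev i ≠ 0}, f i = ∑ i, f i := by
  rw [← Fintype.sum_subtype_add_sum_subtype (fun i => ev i ≠ 0), left_eq_add]
  exact Finset.sum_eq_zero fun i _ => hf i (not_not.1 i.2)

variable {K ι : Type*} [NormedAddCommGroup K] [InnerProductSpace ℝ K] [DecidableEq ι]
  {p : ι → K} {ev : ι → ℝ}

lemma norm_sq_of_inner_eq (hp : ∀ i j, inner ℝ (p i) (p j) = if i = j then ev i else 0) (i : ι) :
    ‖p i‖ ^ 2 = ev i := by
  rw [← real_inner_self_eq_norm_sq, hp, if_pos rfl]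

lemma orthonormal_normalize (hp : ∀ i j, inner ℝ (p i) (p j) = if i = j then ev i else 0) :
    Orthonormal ℝ fun i : {i // ev i ≠ 0} => (‖p i‖)⁻¹ • p i := by
  rw [orthonormal_iff_ite]
  rintro ⟨i, hi⟩ ⟨j, hj⟩
  simp only [inner_smul_left, inner_smul_right, hp, conj_trivial, Subtype.mk.injEq]
  split_ifs with h
  · subst h
    have : ‖p i‖ ≠ 0 := fun h0 => hi (by rw [← norm_sq_of_inner_eq hp, h0, zero_pow two_ne_zero])
    rw [← norm_sq_of_inner_eq hp]
    field_simp
  · simp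

variable [Fintype ι]

lemma sum_inner_sq_div_le (hp : ∀ i j, inner ℝ (p i) (p j) = if i = j then ev i else 0) (w : K) :
    ∑ i, inner ℝ (p i) w ^ 2 * (ev i)⁻¹ ≤ ‖w‖ ^ 2 := by
  calc ∑ i, inner ℝ (p i) w ^ 2 * (ev i)⁻¹
      = ∑ i : {i // ev i ≠ 0}, inner ℝ (p i) w ^ 2 * (ev i)⁻¹ :=
        (sum_subtype_ne_zero fun i hi => by rw [hi, inv_zero, mul_zero]).symm
    _ = ∑ i : {i // ev i ≠ 0}, ‖inner ℝ ((‖p i‖)⁻¹ • p i) w‖ ^ 2 := by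
        refine Finset.sum_congr rfl fun i _ => ?_
        rw [inner_smul_left, conj_trivial, Real.norm_eq_abs, sq_abs, mul_pow, inv_pow,
          norm_sq_of_inner_eq hp, mul_comm]
    _ ≤ ‖w‖ ^ 2 := (orthonormal_normalize hp).sum_inner_products_le w

variable {η θ lam V D κ : ℝ} {T : ℕ}

lemma ev_mul_error_le (hη : 0 < η) (hθ : 0 ≤ θ) (hθ1 : θ ≤ 1) (hT : 1 ≤ T)
    (hlam : (T : ℝ) ^ (-(1 - θ)) ≤ lam) {x a q : ℝ} (hx : 0 ≤ x)
    (hstep : ∀ j, stepSize η θ j * (x + lam) ≤ 1)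
    (hV : ∀ T, ∑ t ∈ Finset.range T, stepSize η θ t ^ 2 ≤ V) (hD : 0 ≤ D) (hq : 0 ≤ q)
    (ha : a ≤ (∏ j ∈ Finset.range T, (1 - stepSize η θ j * (x + lam)) ^ 2) * q
      + D * x * accumulatedNoise (stepSize η θ) (x + lam) T) :
    x * a ≤ (2 / η * lam) ^ 2 * (q * x⁻¹)
      + D * (V * (x ^ 2 * Real.exp (-(x + lam) * (η * (T : ℝ) ^ (1 - θ))))
        + 2 * η * (T : ℝ) ^ (-θ) * x) := by
  have hT0 : (0 : ℝ) < T := by exact_mod_cast hT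
  have hlam0 : 0 < lam := lt_of_lt_of_le (by positivity) hlam
  set S := η / 2 * (T : ℝ) ^ (1 - θ) with hS
  have hS0 : 0 < S := by positivity
  have hSlam : 1 / S ≤ 2 / η * lam := by
    rw [Real.rpow_neg hT0.le] at hlam
    calc 1 / S = 2 / η * ((T : ℝ) ^ (1 - θ))⁻¹ := by rw [hS]; field_simp
      _ ≤ _ := by gcongr
  have hsum : S ≤ ∑ j ∈ Finset.range T, stepSize η θ j := by
    simpa only [Finset.range_eq_Ico] using le_sum_stepSize hη.le hθ hT (Nat.zero_le (T / 2))
  have hdecay : ∏ j ∈ Finset.range T, (1 - stepSize η θ j * (x + lam)) ^ 2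
      ≤ Real.exp (-2 * x * S) := by
    refine (prod_one_sub_sq_le_exp _ hstep).trans (Real.exp_le_exp.2 ?_)
    linarith [mul_le_mul_of_nonneg_left hsum hx, mul_nonneg hlam0.le (hS0.le.trans hsum)]
  have hinit : x * (∏ j ∈ Finset.range T, (1 - stepSize η θ j * (x + lam)) ^ 2) * q
      ≤ (2 / η * lam) ^ 2 * x⁻¹ * q :=
    calc _ ≤ x * Real.exp (-2 * x * S) * q := by gcongr
      _ ≤ (1 / S) ^ 2 * x⁻¹ * q := by gcongr ?_ * q; exact mul_exp_neg_le hx hS0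
      _ ≤ _ := by gcongr
  have hnoise := mul_le_mul_of_nonneg_left
    (sq_mul_accumulatedNoise_le hη.le hθ hθ1 hT hx hlam0.le hstep hV) hD
  linarith [mul_le_mul_of_nonneg_left ha hx]

/-- The total early gradient noise, up to a factor, when the covariance has eigenvalues `ev`. -/
def earlyNoise (η θ lam : ℝ) (T : ℕ) (ev : ι → ℝ) : ℝ :=
  ∑ i, ev i ^ 2 * Real.exp (-(ev i + lam) * (η * (T : ℝ) ^ (1 - θ)))

theorem sum_ev_mul_error_le (hp : ∀ i j, inner ℝ (p i) (p j) = if i = j then ev i else 0)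
    (hη : 0 < η) (hθ : 0 ≤ θ) (hθ1 : θ ≤ 1) (hT : 1 ≤ T)
    (hlam : (T : ℝ) ^ (-(1 - θ)) ≤ lam) (hstep : ∀ i j, stepSize η θ j * (ev i + lam) ≤ 1)
    (hV : ∀ T, ∑ t ∈ Finset.range T, stepSize η θ t ^ 2 ≤ V) (hD : 0 ≤ D)
    (htr : ∑ i, ev i ≤ κ ^ 2) {w : K} {a : ι → ℝ}
    (ha : ∀ i, a i ≤ (∏ j ∈ Finset.range T, (1 - stepSize η θ j * (ev i + lam)) ^ 2)
        * inner ℝ (p i) w ^ 2 + D * ev i * accumulatedNoise (stepSize η θ) (ev i + lam) T) :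
    ∑ i, ev i * a i ≤ 4 / η ^ 2 * (lam * ‖w‖) ^ 2
      + D * (V * earlyNoise η θ lam T ev + 2 * η * (T : ℝ) ^ (-θ) * κ ^ 2) := by
  have hev : ∀ i, 0 ≤ ev i := fun i => by
    simpa only [hp, if_true] using real_inner_self_nonneg (x := p i)
  calc ∑ i, ev i * a i
      ≤ ∑ i, ((2 / η * lam) ^ 2 * (inner ℝ (p i) w ^ 2 * (ev i)⁻¹)
          + D * (V * (ev i ^ 2 * Real.exp (-(ev i + lam) * (η * (T : ℝ) ^ (1 - θ))))
            + 2 * η * (T : ℝ) ^ (-θ) * ev i)) :=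
        Finset.sum_le_sum fun i _ =>
          ev_mul_error_le hη hθ hθ1 hT hlam (hev i) (hstep i) hV hD (sq_nonneg _) (ha i)
    _ = (2 / η * lam) ^ 2 * ∑ i, inner ℝ (p i) w ^ 2 * (ev i)⁻¹
          + D * (V * earlyNoise η θ lam T ev + 2 * η * (T : ℝ) ^ (-θ) * ∑ i, ev i) := by
        rw [Finset.sum_add_distrib, ← Finset.mul_sum, ← Finset.mul_sum, Finset.sum_add_distrib,
          ← Finset.mul_sum, ← Finset.mul_sum, earlyNoise]
    _ ≤ (2 / η * lam) ^ 2 * ‖w‖ ^ 2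
          + D * (V * earlyNoise η θ lam T ev + 2 * η * (T : ℝ) ^ (-θ) * κ ^ 2) := by
        gcongr
        exact sum_inner_sq_div_le hp w
    _ = _ := by ring

end Spectral

section Concentration

lemma exp_sq_mul_gaussianPDF_le (g : ℝ) :
    gaussianPDF 0 1 g * ENNReal.ofReal (Real.exp (g ^ 2 / 4)) ≤ 2 * gaussianPDF 0 2 g := by
  have hsqrt : Real.sqrt 2 ≤ 2 := Real.sqrt_le_iff.2 (by norm_num)
  have hvar : Real.sqrt (2 * Real.pi * 2) = Real.sqrt 2 * Real.sqrt (2 * Real.pi) := by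
    rw [mul_comm, Real.sqrt_mul zero_le_two]
  have hexp : Real.exp (-g ^ 2 / 2) * Real.exp (g ^ 2 / 4) = Real.exp (-g ^ 2 / (2 * 2)) := by
    rw [← Real.exp_add]; congr 1; ring
  rw [gaussianPDF, gaussianPDF, ← ENNReal.ofReal_mul (gaussianPDFReal_nonneg _ _ _),
    ← ENNReal.ofReal_ofNat 2, ← ENNReal.ofReal_mul zero_le_two]
  refine ENNReal.ofReal_le_ofReal ?_
  simp only [gaussianPDFReal, sub_zero, NNReal.coe_one, NNReal.coe_ofNat, mul_one]
  rw [mul_assoc, hexp, hvar, mul_inv, ← mul_assoc, ← mul_assoc]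
  gcongr
  refine le_mul_of_one_le_left (by positivity) ?_
  rwa [← div_eq_mul_inv, one_le_div (by positivity)]

lemma lintegral_exp_sq_div_four_gaussianReal_le_two :
    ∫⁻ g, ENNReal.ofReal (Real.exp (g ^ 2 / 4)) ∂(gaussianReal 0 1) ≤ 2 := by
  rw [gaussianReal_of_var_ne_zero _ one_ne_zero,
    lintegral_withDensity_eq_lintegral_mul _ (measurable_gaussianPDF _ _) (by fun_prop)]
  calc _ ≤ ∫⁻ g, 2 * gaussianPDF 0 2 g := lintegral_mono exp_sq_mul_gaussianPDF_le
    _ = 2 := by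
      rw [lintegral_const_mul _ (measurable_gaussianPDF _ _),
        lintegral_gaussianPDF_eq_one _ two_ne_zero, mul_one]

lemma ofReal_exp_sq_eq_lintegral_gaussianReal (t : ℝ) :
    ENNReal.ofReal (Real.exp (t ^ 2 / 2))
      = ∫⁻ g, ENNReal.ofReal (Real.exp (t * g)) ∂(gaussianReal 0 1) := by
  have hmgf : ∫ g, Real.exp (t * g) ∂(gaussianReal 0 1) = Real.exp (t ^ 2 / 2) := by
    simpa [mgf] using mgf_gaussianReal (X := id) (Measure.map_id (μ := gaussianReal 0 1)) t
  rw [← hmgf, ofReal_integral_eq_lintegral_ofReal (integrable_exp_mul_gaussianReal t)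
    (.of_forall fun _ => (Real.exp_pos _).le)]

-- Linearize `exp (X ^ 2 / (4 * c))` as the mean of `exp (k * X * g)` over an independent standard
-- Gaussian `g`, and integrate over `X` first.
theorem lintegral_exp_sq_le_two_of_hasSubgaussianMGF {Ω : Type*} [MeasurableSpace Ω]
    {P : Measure Ω} [IsProbabilityMeasure P] {X : Ω → ℝ} {c : NNReal} (hX : Measurable X)
    (hc : 0 < c) (h : HasSubgaussianMGF X c P) :
    ∫⁻ ω, ENNReal.ofReal (Real.exp (X ω ^ 2 / (4 * c))) ∂P ≤ 2 := by
  have : (0 : ℝ) < c := hc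
  set k := (Real.sqrt (2 * c))⁻¹ with hk
  have hk2 : k ^ 2 = 1 / (2 * c) := by
    rw [hk, inv_pow, Real.sq_sqrt (by positivity), one_div]
  have hlinearize : ∀ ω, ENNReal.ofReal (Real.exp (X ω ^ 2 / (4 * c)))
      = ∫⁻ g, ENNReal.ofReal (Real.exp (k * g * X ω)) ∂(gaussianReal 0 1) := fun ω => by
    simp_rw [mul_right_comm k _ (X ω)]
    rw [← ofReal_exp_sq_eq_lintegral_gaussianReal, mul_pow, hk2]
    congr 2; field_simp; norm_num
  simp_rw [hlinearize]
  rw [lintegral_lintegral_swap (by fun_prop)]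
  refine (lintegral_mono fun g => ?_).trans lintegral_exp_sq_div_four_gaussianReal_le_two
  rw [← ofReal_integral_eq_lintegral_ofReal (h.integrable_exp_mul (k * g))
    (.of_forall fun _ => (Real.exp_pos _).le)]
  refine ENNReal.ofReal_le_ofReal ((h.mgf_le (k * g)).trans_eq ?_)
  rw [mul_pow, hk2]; congr 1; field_simp; ring

variable {B : Type*} [MeasurableSpace B] {P : Measure B} [IsProbabilityMeasure P] {A : ℝ} {m : ℕ}

lemma hasSubgaussianMGF_sum_sub_integral {ψ : B → ℝ} (hψ : Measurable ψ)
    (hbd : ∀ᵐ b ∂P, |ψ b| ≤ A) :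
    HasSubgaussianMGF (fun w : Fin m → B => ∑ r, (ψ (w r) - ∫ b, ψ b ∂P)) (m * ‖A‖₊ ^ 2)
      (Measure.pi fun _ => P) := by
  have hwidth : (‖A - -A‖₊ / 2) ^ 2 = ‖A‖₊ ^ 2 := by
    rw [sub_neg_eq_add, ← two_mul, nnnorm_mul, Real.nnnorm_ofNat,
      mul_div_cancel_left₀ _ two_ne_zero]
  have hterm : ∀ r : Fin m, HasSubgaussianMGF (fun w : Fin m → B => ψ (w r) - ∫ b, ψ b ∂P)
      (‖A‖₊ ^ 2) (Measure.pi fun _ => P) := fun r => by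
    have hmp := measurePreserving_eval (fun _ : Fin m => P) r
    have hmean : ∫ w : Fin m → B, ψ (w r) ∂(Measure.pi fun _ => P) = ∫ b, ψ b ∂P := by
      rw [← integral_map hmp.aemeasurable (hmp.map_eq ▸ hψ.aestronglyMeasurable), hmp.map_eq]
    rw [← hwidth, ← hmean]
    refine hasSubgaussianMGF_of_mem_Icc (hψ.comp hmp.measurable).aemeasurable ?_
    filter_upwards [hmp.quasiMeasurePreserving.ae hbd] with w hw using abs_le.1 hw
  have hind : iIndepFun (fun (r : Fin m) (w : Fin m → B) => ψ (w r) - ∫ b, ψ b ∂P)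
      (Measure.pi fun _ => P) :=
    iIndepFun_pi (X := fun _ b => ψ b - ∫ b, ψ b ∂P) fun _ => (hψ.sub_const _).aemeasurable
  simpa using HasSubgaussianMGF.sum_of_iIndepFun hind (s := Finset.univ) fun r _ => hterm r

lemma lintegral_exp_mean_sub_integral_sq_le_two {ψ : B → ℝ} (hψ : Measurable ψ)
    (hbd : ∀ᵐ b ∂P, |ψ b| ≤ A) (hA : 0 < A) (hm : 1 ≤ m) :
    ∫⁻ w : Fin m → B, ENNReal.ofReal (Real.exp
        (m / (4 * A ^ 2) * ((m : ℝ)⁻¹ * ∑ r, ψ (w r) - ∫ b, ψ b ∂P) ^ 2))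
        ∂(Measure.pi fun _ => P) ≤ 2 := by
  have : 0 < m := hm
  have hmeas : Measurable fun w : Fin m → B => ∑ r, (ψ (w r) - ∫ b, ψ b ∂P) := by fun_prop
  have hc : 0 < (m : NNReal) * ‖A‖₊ ^ 2 := by
    have := nnnorm_pos.2 hA.ne'
    positivity
  refine (lintegral_exp_sq_le_two_of_hasSubgaussianMGF hmeas hc
    (hasSubgaussianMGF_sum_sub_integral hψ hbd)).trans_eq' (lintegral_congr fun w => ?_)
  simp only [Finset.sum_sub_distrib, Finset.sum_const, Finset.card_univ, Fintype.card_fin,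
    nsmul_eq_mul, NNReal.coe_mul, NNReal.coe_natCast, NNReal.coe_pow, coe_nnnorm,
    Real.norm_eq_abs, sq_abs]
  congr 2
  field_simp

variable {Y : Type*} [MeasurableSpace Y] {τ : Measure Y} [IsProbabilityMeasure τ]

lemma ofReal_exp_integral_le_lintegral {f : Y → ℝ} (hf : Measurable f) {C : ℝ}
    (hC : ∀ᵐ y ∂τ, |f y| ≤ C) :
    ENNReal.ofReal (Real.exp (∫ y, f y ∂τ)) ≤ ∫⁻ y, ENNReal.ofReal (Real.exp (f y)) ∂τ := by
  have hint : Integrable f τ := .of_bound hf.aestronglyMeasurable C hC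
  have hexp : Integrable (fun y => Real.exp (f y)) τ := by
    refine .of_bound hf.exp.aestronglyMeasurable (Real.exp C) ?_
    filter_upwards [hC] with y hy
    rw [Real.norm_eq_abs, Real.abs_exp]
    exact Real.exp_le_exp.2 ((le_abs_self _).trans hy)
  rw [← ofReal_integral_eq_lintegral_ofReal hexp (.of_forall fun _ => (Real.exp_pos _).le)]
  exact ENNReal.ofReal_le_ofReal (convexOn_exp.map_integral_le Real.continuous_exp.continuousOn
    isClosed_univ (.of_forall fun _ => Set.mem_univ _) hint hexp)

lemma abs_mean_sub_le {v : Fin m → ℝ} {x : ℝ} (hv : ∀ r, |v r| ≤ A) (hx : |x| ≤ A) :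
    |(m : ℝ)⁻¹ * ∑ r, v r - x| ≤ 2 * A := by
  have hA : 0 ≤ A := (abs_nonneg _).trans hx
  have hmean : |(m : ℝ)⁻¹ * ∑ r, v r| ≤ A := by
    rw [abs_mul, abs_inv, Nat.abs_cast]
    refine inv_mul_le_of_le_mul₀ (by positivity) hA ((Finset.abs_sum_le_sum_abs _ _).trans ?_)
    simpa using Finset.sum_le_sum fun r (_ : r ∈ Finset.univ) => hv r
  linarith [abs_sub ((m : ℝ)⁻¹ * ∑ r, v r) x]

/-- The deviation at `y` of the empirical mean of `ψ · y` over the sample `w` from its expectation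
under `P`. -/
def deviation (P : Measure B) (ψ : B → Y → ℝ) (w : Fin m → B) (y : Y) : ℝ :=
  (m : ℝ)⁻¹ * ∑ r, ψ (w r) y - ∫ b, ψ b y ∂P

variable {ψ : B → Y → ℝ}

omit [IsProbabilityMeasure P] in
lemma measurable_deviation [SFinite P] (hψ : Measurable (Function.uncurry ψ)) :
    Measurable fun q : (Fin m → B) × Y => deviation P ψ q.1 q.2 := by
  have hswap : Measurable (Function.uncurry fun y b => ψ b y) := hψ.comp measurable_swap
  have hmean : Measurable fun y => ∫ b, ψ b y ∂P :=
    hswap.stronglyMeasurable.integral_prod_right.measurable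
  refine (Measurable.const_mul (Finset.measurable_sum _ fun r _ => ?_) _).sub
    (hmean.comp measurable_snd)
  exact hψ.comp (f := fun q : (Fin m → B) × Y => (q.1 r, q.2)) (by fun_prop)

lemma ae_abs_deviation_le (hψ : Measurable (Function.uncurry ψ))
    (hbd : ∀ᵐ y ∂τ, ∀ᵐ b ∂P, |ψ b y| ≤ A) :
    ∀ᵐ w ∂(Measure.pi fun _ : Fin m => P), ∀ᵐ y ∂τ, |deviation P ψ w y| ≤ 2 * A := by
  have hset : MeasurableSet {q : Y × B | |ψ q.2 q.1| ≤ A} :=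
    measurableSet_le (hψ.comp measurable_swap).abs measurable_const
  filter_upwards [ae_pi_of_ae ((Measure.ae_ae_comm hset).1 hbd) m] with w hw
  filter_upwards [ae_all_iff.2 hw, hbd] with y hy hby
  exact abs_mean_sub_le hy
    (by simpa using norm_integral_le_of_norm_le_const (f := fun b => ψ b y) hby)

lemma lintegral_exp_deviation_sq_le_two (hψ : Measurable (Function.uncurry ψ))
    (hbd : ∀ᵐ y ∂τ, ∀ᵐ b ∂P, |ψ b y| ≤ A) (hA : 0 < A) (hm : 1 ≤ m) :
    ∫⁻ w, ∫⁻ y, ENNReal.ofReal (Real.exp (m / (4 * A ^ 2) * deviation P ψ w y ^ 2)) ∂τ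
      ∂(Measure.pi fun _ : Fin m => P) ≤ 2 := by
  rw [lintegral_lintegral_swap
    (((measurable_deviation hψ).pow_const 2).const_mul _).exp.ennreal_ofReal.aemeasurable]
  calc _ ≤ ∫⁻ _, 2 ∂τ := lintegral_mono_ae <| by
        filter_upwards [hbd] with y hy
        exact lintegral_exp_mean_sub_integral_sq_le_two (ψ := fun b => ψ b y)
          hψ.of_uncurry_right hy hA hm
    _ = 2 := by simp

lemma ofReal_le_lintegral_exp_of_lt_integral_sq {f : Y → ℝ} (hf : Measurable f) {C : ℝ}
    (hC : ∀ᵐ y ∂τ, |f y| ≤ C) {a t : ℝ} (ha : 0 < a) (ht : 0 < t)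
    (h : Real.log t / a < ∫ y, f y ^ 2 ∂τ) :
    ENNReal.ofReal t ≤ ∫⁻ y, ENNReal.ofReal (Real.exp (a * f y ^ 2)) ∂τ := by
  have hbd : ∀ᵐ y ∂τ, |a * f y ^ 2| ≤ a * C ^ 2 := by
    filter_upwards [hC] with y hy
    rw [abs_mul, abs_pow, abs_of_pos ha]
    gcongr
  refine le_trans (ENNReal.ofReal_le_ofReal ?_)
    (ofReal_exp_integral_le_lintegral ((hf.pow_const 2).const_mul a) hbd)
  rw [div_lt_iff₀' ha] at h
  rw [← Real.log_le_iff_le_exp ht, integral_const_mul]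
  exact h.le

theorem measure_meanSquare_deviation_le (hψ : Measurable (Function.uncurry ψ)) (hA : 0 < A)
    (hbd : ∀ᵐ y ∂τ, ∀ᵐ b ∂P, |ψ b y| ≤ A) (hm : 1 ≤ m) {δ : ℝ} (hδ : 0 < δ) :
    (Measure.pi fun _ : Fin m => P)
        {w | 4 * A ^ 2 * Real.log (2 / δ) / m < ∫ y, deviation P ψ w y ^ 2 ∂τ}
      ≤ ENNReal.ofReal δ := by
  have : (0 : ℝ) < m := by exact_mod_cast hm
  set a : ℝ := m / (4 * A ^ 2) with ha
  have hdev := measurable_deviation (P := P) (m := m) hψ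
  have hlevel : 4 * A ^ 2 * Real.log (2 / δ) / m = Real.log (2 / δ) / a := by
    rw [ha]; field_simp
  set U : (Fin m → B) → ENNReal :=
    fun w => ∫⁻ y, ENNReal.ofReal (Real.exp (a * deviation P ψ w y ^ 2)) ∂τ
  have hU : Measurable U :=
    ((hdev.pow_const 2).const_mul a).exp.ennreal_ofReal.lintegral_prod_right'
  calc (Measure.pi fun _ : Fin m => P)
          {w | 4 * A ^ 2 * Real.log (2 / δ) / m < ∫ y, deviation P ψ w y ^ 2 ∂τ}
      ≤ (Measure.pi fun _ : Fin m => P) {w | ENNReal.ofReal (2 / δ) ≤ U w} := by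
        rw [hlevel]
        refine measure_mono_ae ?_
        filter_upwards [ae_abs_deviation_le hψ hbd] with w hw hlt
        exact ofReal_le_lintegral_exp_of_lt_integral_sq (hdev.comp measurable_prodMk_left) hw
          (by positivity) (by positivity) hlt
    _ ≤ (∫⁻ w, U w ∂(Measure.pi fun _ : Fin m => P)) / ENNReal.ofReal (2 / δ) :=
        meas_ge_le_lintegral_div hU.aemeasurable (by simpa using hδ) ENNReal.ofReal_ne_top
    _ ≤ 2 / ENNReal.ofReal (2 / δ) := by
        gcongr
        exact lintegral_exp_deviation_sq_le_two hψ hbd hA hm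
    _ = ENNReal.ofReal δ := by
        rw [ENNReal.ofReal_div_of_pos hδ, ENNReal.ofReal_ofNat,
          ENNReal.div_div_cancel two_ne_zero ENNReal.ofNat_ne_top]

end Concentration

section IntegralOperator

variable {X : Type*} [MeasurableSpace X] {ν : Measure X}

lemma inner_Lp_two (f g : Lp ℝ 2 ν) : inner ℝ f g = ∫ x, f x * g x ∂ν := by
  rw [L2.inner_def]
  simp [mul_comm]

lemma norm_sq_Lp_two (f : Lp ℝ 2 ν) : ‖f‖ ^ 2 = ∫ x, f x ^ 2 ∂ν := by
  rw [← real_inner_self_eq_norm_sq, inner_Lp_two]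
  simp only [sq]

lemma inner_toLp {g : X → ℝ} (hg : MemLp g 2 ν) (f : Lp ℝ 2 ν) :
    inner ℝ f hg.toLp = ∫ x, f x * g x ∂ν := by
  rw [inner_Lp_two]
  refine integral_congr_ae ?_
  filter_upwards [hg.coeFn_toLp] with x hx
  rw [hx]

/-- A measurable kernel that is bounded by `A` on the square of `s`, a set that will carry the
measure under consideration. -/
structure IsBoundedKernelOn (k : X → X → ℝ) (s : Set X) (A : ℝ) : Prop where
  measurable : Measurable (Function.uncurry k)
  bound : ∀ x ∈ s, ∀ x' ∈ s, |k x x'| ≤ A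

/-- `L` is the integral operator on `L²(ν)` with kernel `k`. -/
def IsIntegralOperator (k : X → X → ℝ) (L : Lp ℝ 2 ν →L[ℝ] Lp ℝ 2 ν) : Prop :=
  ∀ f : Lp ℝ 2 ν, L f =ᵐ[ν] fun x' => ∫ x, f x * k x x' ∂ν

variable {k k' : X → X → ℝ} {s : Set X} {A A' : ℝ}

namespace IsBoundedKernelOn

lemma sub (hk : IsBoundedKernelOn k s A) (hk' : IsBoundedKernelOn k' s A') :
    IsBoundedKernelOn (fun x x' => k x x' - k' x x') s (A + A') :=
  ⟨hk.measurable.sub hk'.measurable, fun x hx x' hx' =>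
    (abs_sub _ _).trans (add_le_add (hk.bound x hx x' hx') (hk'.bound x hx x' hx'))⟩

lemma ae_abs_prod_le [SFinite ν] (hk : IsBoundedKernelOn k s A) (hs : ∀ᵐ x ∂ν, x ∈ s) :
    ∀ᵐ q ∂(ν.prod ν), |k q.1 q.2| ≤ A := by
  filter_upwards [Measure.quasiMeasurePreserving_fst.ae hs,
    Measure.quasiMeasurePreserving_snd.ae hs] with q h₁ h₂ using hk.bound _ h₁ _ h₂

variable [IsProbabilityMeasure ν]

lemma memLp (hk : IsBoundedKernelOn k s A) (hs : ∀ᵐ x ∂ν, x ∈ s) {x' : X} (hx' : x' ∈ s) :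
    MemLp (fun x => k x x') 2 ν :=
  .of_bound (hk.measurable.comp measurable_prodMk_right).aestronglyMeasurable A
    (hs.mono fun x hx => hk.bound x hx x' hx')

lemma integrable_mul (hk : IsBoundedKernelOn k s A) (hs : ∀ᵐ x ∂ν, x ∈ s) (f : Lp ℝ 2 ν) {x' : X}
    (hx' : x' ∈ s) : Integrable (fun x => f x * k x x') ν :=
  (Lp.memLp f).integrable_mul (hk.memLp hs hx')

lemma abs_integral_le (hk : IsBoundedKernelOn k s A) (hs : ∀ᵐ x ∂ν, x ∈ s) (f : Lp ℝ 2 ν) {x' : X}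
    (hx' : x' ∈ s) : |∫ x, f x * k x x' ∂ν| ≤ A * ‖f‖ := by
  have hm := hk.memLp hs hx'
  have hA : 0 ≤ A := (abs_nonneg _).trans (hk.bound x' hx' x' hx')
  have hnorm : ‖(hm.toLp : Lp ℝ 2 ν)‖ ≤ A := by
    have hae : ∀ᵐ x ∂ν, ‖(hm.toLp : Lp ℝ 2 ν) x‖ ≤ A := by
      filter_upwards [hm.coeFn_toLp, hs] with x hx hxs
      rw [hx]
      exact hk.bound x hxs x' hx'
    simpa [measureUnivNNReal] using Lp.norm_le_of_ae_bound hA hae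
  rw [← inner_toLp hm, mul_comm]
  exact (abs_real_inner_le_norm _ _).trans (by gcongr)

lemma memLp_integral (hk : IsBoundedKernelOn k s A) (hs : ∀ᵐ x ∂ν, x ∈ s) (f : Lp ℝ 2 ν) :
    MemLp (fun x' => ∫ x, f x * k x x' ∂ν) 2 ν := by
  have hmeas : StronglyMeasurable (Function.uncurry fun x' x => f x * k x x') :=
    ((Lp.stronglyMeasurable f).comp_measurable measurable_snd).mul
      (hk.measurable.comp measurable_swap).stronglyMeasurable
  exact .of_bound hmeas.integral_prod_right.aestronglyMeasurable (A * ‖f‖)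
    (hs.mono fun x' hx' => hk.abs_integral_le hs f hx')

theorem exists_isIntegralOperator (hk : IsBoundedKernelOn k s A) (hs : ∀ᵐ x ∂ν, x ∈ s) :
    ∃ L : Lp ℝ 2 ν →L[ℝ] Lp ℝ 2 ν, IsIntegralOperator k L := by
  have hcoe : ∀ f : Lp ℝ 2 ν, (hk.memLp_integral hs f).toLp =ᵐ[ν] fun x' => ∫ x, f x * k x x' ∂ν :=
    fun f => (hk.memLp_integral hs f).coeFn_toLp
  obtain ⟨x₀, hx₀⟩ := hs.exists
  have hA : 0 ≤ A := (abs_nonneg _).trans (hk.bound x₀ hx₀ x₀ hx₀)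
  let L : Lp ℝ 2 ν →ₗ[ℝ] Lp ℝ 2 ν :=
    { toFun := fun f => (hk.memLp_integral hs f).toLp
      map_add' := fun f g => by
        refine Lp.ext ?_
        filter_upwards [hcoe (f + g), hcoe f, hcoe g, hs, Lp.coeFn_add
          (hk.memLp_integral hs f).toLp (hk.memLp_integral hs g).toLp] with x' hfg hf hg hx' hadd
        rw [hfg, hadd, Pi.add_apply, hf, hg,
          ← integral_add (hk.integrable_mul hs f hx') (hk.integrable_mul hs g hx')]
        refine integral_congr_ae ?_
        filter_upwards [Lp.coeFn_add f g] with x hx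
        rw [hx, Pi.add_apply, add_mul]
      map_smul' := fun c f => by
        refine Lp.ext ?_
        filter_upwards [hcoe (c • f), hcoe f, Lp.coeFn_smul c (hk.memLp_integral hs f).toLp]
          with x' hcf hf hsmul
        rw [hcf, RingHom.id_apply, hsmul, Pi.smul_apply, hf, smul_eq_mul, ← integral_const_mul]
        refine integral_congr_ae ?_
        filter_upwards [Lp.coeFn_smul c f] with x hx
        rw [hx, Pi.smul_apply, smul_eq_mul, mul_assoc] }
  refine ⟨L.mkContinuous A fun f => ?_, hcoe⟩
  have hae : ∀ᵐ x' ∂ν, ‖L f x'‖ ≤ A * ‖f‖ := by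
    filter_upwards [hcoe f, hs] with x' hf hx'
    rw [show L f x' = ∫ x, f x * k x x' ∂ν from hf]
    exact hk.abs_integral_le hs f hx'
  simpa [measureUnivNNReal] using Lp.norm_le_of_ae_bound (by positivity) hae

lemma integrable_prod (hk : IsBoundedKernelOn k s A) (hs : ∀ᵐ x ∂ν, x ∈ s) (f g : Lp ℝ 2 ν) :
    Integrable (fun q : X × X => f q.1 * k q.1 q.2 * g q.2) (ν.prod ν) := by
  have hfg : Integrable (fun q : X × X => f q.1 * g q.2) (ν.prod ν) :=
    ((Lp.memLp f).integrable one_le_two).mul_prod ((Lp.memLp g).integrable one_le_two)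
  refine (hfg.bdd_mul hk.measurable.aestronglyMeasurable (hk.ae_abs_prod_le hs)).congr
    (.of_forall fun q => ?_)
  simp only [Function.uncurry]
  ring

end IsBoundedKernelOn

namespace IsIntegralOperator

variable [IsProbabilityMeasure ν] {L L' : Lp ℝ 2 ν →L[ℝ] Lp ℝ 2 ν}

lemma sub (hL : IsIntegralOperator k L) (hL' : IsIntegralOperator k' L')
    (hk : IsBoundedKernelOn k s A) (hk' : IsBoundedKernelOn k' s A') (hs : ∀ᵐ x ∂ν, x ∈ s) :
    IsIntegralOperator (fun x x' => k x x' - k' x x') (L - L') := fun f => by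
  filter_upwards [hL f, hL' f, Lp.coeFn_sub (L f) (L' f), hs] with x' hLf hLf' hsub hx'
  rw [sub_apply, hsub, Pi.sub_apply, hLf, hLf',
    ← integral_sub (hk.integrable_mul hs f hx') (hk'.integrable_mul hs f hx')]
  simp only [mul_sub]

theorem inner_symm (hL : IsIntegralOperator k L) (hk : IsBoundedKernelOn k s A)
    (hs : ∀ᵐ x ∂ν, x ∈ s) (hsymm : ∀ x x', k x x' = k x' x) (f g : Lp ℝ 2 ν) :
    inner ℝ (L f) g = inner ℝ f (L g) :=
  calc inner ℝ (L f) g = ∫ x', ∫ x, f x * k x x' * g x' ∂ν ∂ν := by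
        rw [inner_Lp_two]
        refine integral_congr_ae ?_
        filter_upwards [hL f] with x' hx'
        rw [hx', integral_mul_const]
    _ = ∫ x, ∫ x', f x * k x x' * g x' ∂ν ∂ν :=
        integral_integral_swap (hk.integrable_prod hs f g).swap
    _ = inner ℝ f (L g) := by
        rw [inner_Lp_two]
        refine integral_congr_ae ?_
        filter_upwards [hL g] with x hx
        rw [hx, ← integral_const_mul]
        simp only [hsymm x, mul_assoc, mul_comm (k _ x)]

theorem sum_norm_sq_le (hL : IsIntegralOperator k L) (hk : IsBoundedKernelOn k s A)
    (hs : ∀ᵐ x ∂ν, x ∈ s) {ι : Type*} [Fintype ι] {f : ι → Lp ℝ 2 ν} (hf : Orthonormal ℝ f) :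
    ∑ i, ‖L (f i)‖ ^ 2 ≤ ∫ q, k q.1 q.2 ^ 2 ∂(ν.prod ν) := by
  have hsq : Integrable (fun q : X × X => k q.1 q.2 ^ 2) (ν.prod ν) :=
    (MemLp.of_bound hk.measurable.aestronglyMeasurable A (hk.ae_abs_prod_le hs)).integrable_sq
  have hLf : ∀ i, Integrable (fun x => L (f i) x ^ 2) ν := fun i => (Lp.memLp _).integrable_sq
  simp_rw [norm_sq_Lp_two]
  rw [← integral_finsetSum _ fun i _ => hLf i, integral_prod_symm _ hsq]
  refine integral_mono_ae (integrable_finsetSum _ fun i _ => hLf i) hsq.integral_prod_right ?_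
  filter_upwards [ae_all_iff.2 fun i => hL (f i), hs] with x' hx' hxs
  have hm := hk.memLp hs hxs
  calc ∑ i, L (f i) x' ^ 2 = ∑ i, ‖inner ℝ (f i) hm.toLp‖ ^ 2 := by
        simp only [hx', inner_toLp, Real.norm_eq_abs, sq_abs]
    _ ≤ ‖hm.toLp‖ ^ 2 := hf.sum_inner_products_le _
    _ = ∫ x, k x x' ^ 2 ∂ν := by
        rw [norm_sq_Lp_two]
        refine integral_congr_ae ?_
        filter_upwards [hm.coeFn_toLp] with x hx
        rw [hx]

lemma norm_apply_le (hL : IsIntegralOperator k L) (hk : IsBoundedKernelOn k s A)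
    (hs : ∀ᵐ x ∂ν, x ∈ s) (f : Lp ℝ 2 ν) :
    ‖L f‖ ≤ √(∫ q, k q.1 q.2 ^ 2 ∂(ν.prod ν)) * ‖f‖ := by
  rcases eq_or_ne f 0 with rfl | hf
  · simp
  have hunit : Orthonormal ℝ fun _ : Unit => ‖f‖⁻¹ • f :=
    ⟨fun _ => norm_smul_inv_norm hf, fun i j hij => (hij (Subsingleton.elim _ _)).elim⟩
  have hHS := hL.sum_norm_sq_le hk hs hunit
  simp only [Finset.univ_unique, Finset.sum_const, Finset.card_singleton, one_smul, map_smul,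
    norm_smul, norm_inv, norm_norm] at hHS
  rw [← inv_mul_le_iff₀' (norm_pos_iff.2 hf)]
  exact Real.le_sqrt_of_sq_le hHS

end IsIntegralOperator

end IntegralOperator

section FeatureOperator

variable {H : Type*} [NormedAddCommGroup H] [InnerProductSpace ℝ H]
  {X : Type*} [MeasurableSpace X] {ν : Measure X} {Φ : X → H}

/-- `A` maps a parameter `u` to the linear model `⟪Φ ·, u⟫`, as an element of `L²(ν)`. -/
def IsFeatureOperator (Φ : X → H) (A : H →L[ℝ] Lp ℝ 2 ν) : Prop :=
  ∀ u, A u =ᵐ[ν] fun x => inner ℝ (Φ x) u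

/-- The squared distance in `L²(ν ⊗ ν)` of the kernel `k` to the kernel of the features `Φ`. -/
def kernelError (k : X → X → ℝ) (Φ : X → H) (ν : Measure X) : ℝ :=
  ∫ q, (k q.1 q.2 - inner ℝ (Φ q.1) (Φ q.2)) ^ 2 ∂(ν.prod ν)

lemma IsFeatureOperator.inner_apply {A : H →L[ℝ] Lp ℝ 2 ν} (hA : IsFeatureOperator Φ A)
    (f : Lp ℝ 2 ν) (u : H) :
    inner ℝ f (A u) = ∫ x, f x * inner ℝ (Φ x) u ∂ν := by
  rw [inner_Lp_two]
  refine integral_congr_ae ?_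
  filter_upwards [hA u] with x hx
  rw [hx]

variable [FiniteDimensional ℝ H] {K : Type*} [NormedAddCommGroup K] [InnerProductSpace ℝ K]
  [CompleteSpace K] {A : H →L[ℝ] K}

open ContinuousLinearMap (adjoint adjoint_inner_left adjoint_inner_right)

lemma inner_comp_adjoint (f g : K) :
    inner ℝ ((A ∘L adjoint A) f) g = inner ℝ (adjoint A f) (adjoint A g) :=
  (adjoint_inner_right A _ _).symm

lemma inner_comp_adjoint_self_nonneg (f : K) : 0 ≤ inner ℝ ((A ∘L adjoint A) f) f := by
  rw [inner_comp_adjoint]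
  exact real_inner_self_nonneg

lemma exists_eigenbasis_adjoint_comp (A : H →L[ℝ] K) :
    ∃ (e : OrthonormalBasis (Fin (Module.finrank ℝ H)) ℝ H) (ev : Fin (Module.finrank ℝ H) → ℝ),
      ∀ i, adjoint A (A (e i)) = ev i • e i := by
  have hsymm : ((adjoint A ∘L A : H →L[ℝ] H) : H →ₗ[ℝ] H).IsSymmetric := fun u v => by
    simp [adjoint_inner_left, adjoint_inner_right]
  exact ⟨hsymm.eigenvectorBasis rfl, hsymm.eigenvalues rfl, hsymm.apply_eigenvectorBasis rfl⟩

lemma exists_ridge_solution {lam : ℝ} (hlam : 0 < lam) (A : H →L[ℝ] K) (g : K) :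
    ∃ w, (A ∘L adjoint A) w + lam • w = g := by
  have hpos : ∀ u, 0 ≤ inner ℝ ((adjoint A ∘L A) u) u := fun u => by
    simp [adjoint_inner_left]
  let B : H →ₗ[ℝ] H := (adjoint A ∘L A + lam • .id ℝ H : H →L[ℝ] H)
  have hinj : Function.Injective B := (injective_iff_map_eq_zero B).2 fun u hu => by
    have hle := mul_norm_le_norm_add_smul (lam := lam) hpos u
    rw [show (adjoint A ∘L A) u + lam • u = 0 from hu, norm_zero] at hle
    exact norm_le_zero_iff.1 (nonpos_of_mul_nonpos_right hle hlam)
  obtain ⟨u, hu⟩ := LinearMap.injective_iff_surjective.1 hinj (adjoint A g)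
  have hu' : adjoint A (A u) + lam • u = adjoint A g := hu
  refine ⟨lam⁻¹ • (g - A u), ?_⟩
  have hadj : adjoint A (lam⁻¹ • (g - A u)) = u := by
    rw [map_smul, map_sub, ← hu', add_sub_cancel_left, inv_smul_smul₀ hlam.ne']
  rw [ContinuousLinearMap.comp_apply, hadj, smul_inv_smul₀ hlam.ne', add_sub_cancel]

lemma norm_sq_apply_eq_sum {ι : Type*} [Fintype ι] {e : OrthonormalBasis ι ℝ H} {ev : ι → ℝ}
    (he : ∀ i, adjoint A (A (e i)) = ev i • e i) (v : H) :
    ‖A v‖ ^ 2 = ∑ i, ev i * inner ℝ (e i) v ^ 2 :=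
  calc ‖A v‖ ^ 2 = inner ℝ (adjoint A (A v)) v := by
        rw [adjoint_inner_left, real_inner_self_eq_norm_sq]
    _ = ∑ i, inner ℝ (adjoint A (A v)) (e i) * inner ℝ (e i) v := (e.sum_inner_mul_inner _ _).symm
    _ = ∑ i, ev i * inner ℝ (e i) v ^ 2 := by
        refine Finset.sum_congr rfl fun i _ => ?_
        rw [adjoint_inner_left, ← adjoint_inner_right, he, inner_smul_right, real_inner_comm]
        ring

lemma exists_isFeatureOperator (hΦ : MemLp Φ 2 ν) :
    ∃ A : H →L[ℝ] Lp ℝ 2 ν, IsFeatureOperator Φ A := by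
  let A : H →ₗ[ℝ] Lp ℝ 2 ν :=
    { toFun := fun u => (innerSL ℝ u).compLp hΦ.toLp
      map_add' := fun u v => by rw [map_add, ContinuousLinearMap.add_compLp]
      map_smul' := fun c u => by
        rw [map_smul, ContinuousLinearMap.smul_compLp, RingHom.id_apply] }
  refine ⟨LinearMap.toContinuousLinearMap A, fun u => ?_⟩
  filter_upwards [(innerSL ℝ u).coeFn_compLp hΦ.toLp, hΦ.coeFn_toLp] with x hx hΦx
  rw [LinearMap.coe_toContinuousLinearMap', ← real_inner_comm]
  exact hx.trans (by rw [hΦx, innerSL_apply_apply])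

lemma IsFeatureOperator.isIntegralOperator_comp_adjoint {A : H →L[ℝ] Lp ℝ 2 ν}
    (hA : IsFeatureOperator Φ A) :
    IsIntegralOperator (fun x x' => inner ℝ (Φ x) (Φ x')) (A ∘L adjoint A) := fun f => by
  filter_upwards [hA (adjoint A f)] with x' hx'
  rw [ContinuousLinearMap.comp_apply, hx', adjoint_inner_right, real_inner_comm, hA.inner_apply]

lemma isBoundedKernelOn_inner [MeasurableSpace H] [BorelSpace H] (hΦ : Measurable Φ) {s : Set X}
    {κ : ℝ} (hκ : ∀ x ∈ s, ‖Φ x‖ ≤ κ) :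
    IsBoundedKernelOn (fun x x' => inner ℝ (Φ x) (Φ x')) s (κ ^ 2) := by
  refine ⟨(hΦ.comp measurable_fst).inner (hΦ.comp measurable_snd), fun x hx x' hx' => ?_⟩
  calc |inner ℝ (Φ x) (Φ x')| ≤ ‖Φ x‖ * ‖Φ x'‖ := abs_real_inner_le_norm _ _
    _ ≤ κ * κ := mul_le_mul (hκ x hx) (hκ x' hx') (norm_nonneg _) ((norm_nonneg _).trans (hκ x hx))
    _ = κ ^ 2 := (sq κ).symm

end FeatureOperator

section EarlyNoise

lemma stepSize_mul_le_one {η θ x : ℝ} (hη : 0 ≤ η) (hθ : 0 ≤ θ) (hx : 0 ≤ x) (hηx : η * x ≤ 1)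
    (t : ℕ) : stepSize η θ t * x ≤ 1 :=
  (mul_le_mul_of_nonneg_right (stepSize_le hη hθ t) hx).trans hηx

variable {ι : Type*} [Fintype ι] {ev : ι → ℝ} {η θ lam κ : ℝ} {T : ℕ}

lemma earlyNoise_nonneg : 0 ≤ earlyNoise η θ lam T ev :=
  Finset.sum_nonneg fun _ _ => by positivity

lemma earlyNoise_le_exp (hev : ∀ i, 0 ≤ ev i) (htr : ∑ i, ev i ≤ κ ^ 2) (hη : 0 ≤ η) :
    earlyNoise η θ lam T ev ≤ κ ^ 4 * Real.exp (-(lam * (η * (T : ℝ) ^ (1 - θ)))) := by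
  have hsq : ∑ i, ev i ^ 2 ≤ κ ^ 4 :=
    calc ∑ i, ev i ^ 2 ≤ (∑ i, ev i) ^ 2 := Finset.sum_sq_le_sq_sum_of_nonneg fun i _ => hev i
      _ ≤ (κ ^ 2) ^ 2 := by
          gcongr
          exact Finset.sum_nonneg fun i _ => hev i
      _ = κ ^ 4 := by ring
  calc earlyNoise η θ lam T ev
      ≤ ∑ i, ev i ^ 2 * Real.exp (-(lam * (η * (T : ℝ) ^ (1 - θ)))) := by
        refine Finset.sum_le_sum fun i _ => ?_
        gcongr
        rw [neg_mul, neg_le_neg_iff]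
        gcongr
        exact le_add_of_nonneg_left (hev i)
    _ ≤ κ ^ 4 * Real.exp (-(lam * (η * (T : ℝ) ^ (1 - θ)))) := by
        rw [← Finset.sum_mul]
        gcongr

lemma earlyNoise_le_effectiveDim (hev : ∀ i, 0 ≤ ev i) (hlam : 0 < lam) (hη : 0 < η)
    (hT : (T : ℝ) ^ (1 - θ) = 1 / lam) :
    earlyNoise η θ lam T ev ≤ 2 / η ^ 2 * lam ^ 2 * ∑ i, (ev i / (ev i + lam)) ^ 2 := by
  rw [earlyNoise, hT, Finset.mul_sum]
  exact Finset.sum_le_sum fun i _ => sq_mul_exp_le_effectiveDim (hev i) hlam hη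

end EarlyNoise

section Covariance

open ContinuousLinearMap (adjoint adjoint_inner_left adjoint_inner_right)

variable {H : Type*} [NormedAddCommGroup H] [InnerProductSpace ℝ H] [CompleteSpace H]
  {K : Type*} [NormedAddCommGroup K] [InnerProductSpace ℝ K] [CompleteSpace K] {A : H →L[ℝ] K}
  {ι : Type*} [Fintype ι] {e : OrthonormalBasis ι ℝ H} {ev : ι → ℝ}

lemma norm_apply_sub_sq_le {F w : K} {lam : ℝ} (hlam : 0 ≤ lam)
    (hw : (A ∘L adjoint A) w + lam • w = F) (u : H) :
    ‖A u - F‖ ^ 2 ≤ 2 * ‖A (u - adjoint A w)‖ ^ 2 + 2 * (lam * ‖w‖) ^ 2 := by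
  have hsub : A u - F = A (u - adjoint A w) - lam • w := by
    rw [← hw, map_sub, ContinuousLinearMap.comp_apply, sub_add_eq_sub_sub]
  calc ‖A u - F‖ ^ 2 ≤ (‖A (u - adjoint A w)‖ + lam * ‖w‖) ^ 2 := by
        gcongr
        rw [hsub, ← Real.norm_of_nonneg hlam, ← norm_smul, Real.norm_of_nonneg hlam]
        exact norm_sub_le _ _
    _ ≤ _ := by linarith [add_sq_le (a := ‖A (u - adjoint A w)‖) (b := lam * ‖w‖)]

lemma inner_apply_eigenvector (he : ∀ i, adjoint A (A (e i)) = ev i • e i) (i : ι) (u : H) :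
    inner ℝ (A (e i)) (A u) = ev i * inner ℝ (e i) u := by
  rw [← adjoint_inner_left, he, inner_smul_left, conj_trivial]

lemma inner_apply_eigenvector_eq_ite [DecidableEq ι]
    (he : ∀ i, adjoint A (A (e i)) = ev i • e i) (i j : ι) :
    inner ℝ (A (e i)) (A (e j)) = if i = j then ev i else 0 := by
  rw [inner_apply_eigenvector he, orthonormal_iff_ite.1 e.orthonormal, mul_ite, mul_one, mul_zero]

theorem sum_effectiveDim_covariance_le (he : ∀ i, adjoint A (A (e i)) = ev i • e i)
    (hev : ∀ i, 0 ≤ ev i) {L : K →L[ℝ] K} (hsymm : ∀ f g, inner ℝ (L f) g = inner ℝ f (L g))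
    {κ : Type*} {μ : κ → ℝ} {φ : κ → K} (hμ : ∀ k, 0 ≤ μ k) (hφ : Orthonormal ℝ φ)
    (hL : ∀ k, L (φ k) = μ k • φ k) (hcomplete : ∀ f, (∀ k, inner ℝ (φ k) f = 0) → L f = 0)
    {lam N Q : ℝ} (hlam : 0 < lam) (hN : HasSum (fun k => (μ k / (μ k + lam)) ^ 2) N)
    (hQ : ∀ f : {i // ev i ≠ 0} → K, Orthonormal ℝ f →
      ∑ i, ‖(L - A ∘L adjoint A) (f i)‖ ^ 2 ≤ Q) :
    ∑ i, (ev i / (ev i + lam)) ^ 2 ≤ 2 * N + 2 / lam ^ 2 * Q := by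
  classical
  obtain ⟨_, b, j, hb⟩ := exists_eigen_hilbertBasis hsymm hφ hL hcomplete
  have hext : ∀ x ∉ Set.range j,
      (Function.extend j μ 0 x / (Function.extend j μ 0 x + lam)) ^ 2 = 0 := fun x hx => by
    rw [Function.extend_apply' _ _ _ hx, Pi.zero_apply, zero_div, zero_pow two_ne_zero]
  have hN' : HasSum (fun x => (Function.extend j μ 0 x / (Function.extend j μ 0 x + lam)) ^ 2) N :=
    (j.injective.hasSum_iff hext).1 <| by
      simpa only [Function.comp_def, j.injective.extend_apply] using hN
  have hext_nonneg : ∀ x, 0 ≤ Function.extend j μ 0 x := fun x => by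
    rcases em (∃ k, j k = x) with ⟨k, rfl⟩ | hx
    · rw [j.injective.extend_apply]
      exact hμ k
    · rw [Function.extend_apply' _ _ _ hx, Pi.zero_apply]
  have hortho := orthonormal_normalize (inner_apply_eigenvector_eq_ite he)
  calc ∑ i, (ev i / (ev i + lam)) ^ 2 = ∑ i : {i // ev i ≠ 0}, (ev i / (ev i + lam)) ^ 2 :=
        (sum_subtype_ne_zero fun i hi => by rw [hi, zero_div, zero_pow two_ne_zero]).symm
    _ ≤ 2 * N + 2 / lam ^ 2 * ∑ i : {i // ev i ≠ 0},
          ‖L (‖A (e i)‖⁻¹ • A (e i)) - ev i • ‖A (e i)‖⁻¹ • A (e i)‖ ^ 2 :=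
        sum_effectiveDim_le b hext_nonneg hb hortho (fun i => hev i) hlam hN'
    _ ≤ 2 * N + 2 / lam ^ 2 * Q := by
        gcongr
        refine (Finset.sum_congr rfl fun i _ => ?_).trans_le (hQ _ hortho)
        rw [sub_apply, ContinuousLinearMap.comp_apply]
        simp only [map_smul, he]
        rw [smul_comm]

end Covariance

section LinearExcess

open ContinuousLinearMap (adjoint adjoint_inner_left adjoint_inner_right)

variable {X : Type*} [MeasurableSpace X] {ρ : Measure (X × ℝ)}

lemma integral_fst {f : X → ℝ} (hf : AEStronglyMeasurable f ρ.fst) :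
    ∫ z, f z.1 ∂ρ = ∫ x, f x ∂ρ.fst := by
  rw [Measure.fst, integral_map measurable_fst.aemeasurable hf]

variable {H : Type*} [NormedAddCommGroup H] [InnerProductSpace ℝ H] [FiniteDimensional ℝ H]
  [MeasurableSpace H] [BorelSpace H] {Φ : X → H} {A : H →L[ℝ] Lp ℝ 2 ρ.fst}
  {ι : Type*} [Fintype ι] {e : OrthonormalBasis ι ℝ H} {ev : ι → ℝ} {F w : Lp ℝ 2 ρ.fst}
  {κ lam : ℝ}

theorem isLinearModel_of_ridge (hΦ : Measurable Φ) (hκ : ∀ᵐ x ∂ρ.fst, ‖Φ x‖ ≤ κ)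
    (hY : ∀ᵐ z ∂ρ, |z.2| ≤ 1) (hlam : 0 < lam) (hA : IsFeatureOperator Φ A)
    (he : ∀ i, adjoint A (A (e i)) = ev i • e i)
    (hreg : ∀ u, ∫ z, z.2 * inner ℝ (Φ z.1) u ∂ρ = ∫ x, F x * inner ℝ (Φ x) u ∂ρ.fst)
    (hw : (A ∘L adjoint A) w + lam • w = F) :
    IsLinearModel ρ Φ κ lam e ev (adjoint A w) where
  measurable := hΦ
  bound := ae_of_ae_map measurable_fst.aemeasurable hκ
  label := hY
  lam_pos := hlam
  eigen i u := by
    have hmeas : Measurable fun x => inner ℝ (e i) (Φ x) * inner ℝ (Φ x) u := by fun_prop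
    rw [integral_fst hmeas.aestronglyMeasurable, ← inner_apply_eigenvector he, inner_Lp_two]
    refine integral_congr_ae ?_
    filter_upwards [hA (e i), hA u] with x hxe hxu
    rw [hxe, hxu, real_inner_comm]
  minimizer i := by
    simp_rw [real_inner_comm (Φ _) (e i)]
    rw [hreg, ← hA.inner_apply, real_inner_comm, ← hw, inner_add_right, inner_smul_right,
      ContinuousLinearMap.comp_apply, inner_apply_eigenvector he, adjoint_inner_right, add_mul]

variable [IsProbabilityMeasure ρ] {η θ V : ℝ} {T : ℕ}

lemma IsLinearModel.integrable_continuous_linSgd {ul : H} (hM : IsLinearModel ρ Φ κ lam e ev ul)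
    (hη : 0 ≤ η) (hθ : 0 ≤ θ) (hηl : η * (lam + 2 * κ ^ 2) ≤ 1) {F : H → ℝ} (hF : Continuous F) :
    Integrable (fun z => F (linSgd Φ lam (stepSize η θ) T z)) (Measure.pi fun _ : Fin T => ρ) := by
  have hs := stepSize_nonneg (θ := θ) hη
  refine hM.integrable_linSgd hs (fun t => ?_) T hF
  have := hM.lam_pos
  linarith [stepSize_mul_le_one hη hθ (by positivity) hηl t, mul_nonneg (hs t) (sq_nonneg κ)]

/-- The factor by which the early gradient noise and the step size enter the risk of the last
iterate of stochastic gradient descent for a linear model, when `U` is the squared norm of the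
regularized minimizer and `V` bounds the sum of the squared step sizes. -/
def noiseFactor (κ V U : ℝ) : ℝ := 2 + 8 * κ ^ 2 * U + 16 * κ ^ 4 * (κ ^ 2 * U + 1) * V

lemma le_noiseFactor (hV : 0 ≤ V) (κ a : ℝ) :
    2 + 8 * κ ^ 2 * a ^ 2 + 8 * κ ^ 4 * (κ * a + 1) ^ 2 * V ≤ noiseFactor κ V (a ^ 2) := by
  have hsq : (κ * a + 1) ^ 2 ≤ 2 * (κ ^ 2 * a ^ 2 + 1) := by linarith [sq_nonneg (κ * a - 1)]
  have := mul_le_mul_of_nonneg_left hsq (show 0 ≤ 8 * κ ^ 4 * V by positivity)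
  rw [noiseFactor]
  linarith

theorem integral_norm_apply_linSgd_sub_sq_le (hM : IsLinearModel ρ Φ κ lam e ev (adjoint A w))
    (he : ∀ i, adjoint A (A (e i)) = ev i • e i) (hη : 0 < η) (hθ : 0 ≤ θ) (hθ1 : θ ≤ 1)
    (hT : 1 ≤ T) (hlam : (T : ℝ) ^ (-(1 - θ)) ≤ lam) (hηl : η * (lam + 2 * κ ^ 2) ≤ 1)
    (hV : ∀ T, ∑ t ∈ Finset.range T, stepSize η θ t ^ 2 ≤ V) :
    ∫ z, ‖A (linSgd Φ lam (stepSize η θ) T z - adjoint A w)‖ ^ 2 ∂(Measure.pi fun _ : Fin T => ρ)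
      ≤ 4 / η ^ 2 * (lam * ‖w‖) ^ 2 + noiseFactor κ V (‖adjoint A w‖ ^ 2)
        * (V * earlyNoise η θ lam T ev + 2 * η * (T : ℝ) ^ (-θ) * κ ^ 2) := by
  classical
  set ul := adjoint A w with hul
  have hs := stepSize_nonneg (η := η) (θ := θ) hη.le
  have hsl := stepSize_mul_le_one hη.le hθ (by linarith [hM.lam_pos, sq_nonneg κ]) hηl
  have hsl' : ∀ t, stepSize η θ t * (lam + κ ^ 2) ≤ 1 := fun t => by
    linarith [hsl t, mul_nonneg (hs t) (sq_nonneg κ)]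
  have hstep : ∀ i j, stepSize η θ j * (ev i + lam) ≤ 1 := fun i j =>
    le_trans (mul_le_mul_of_nonneg_left (by linarith [hM.ev_le i]) (hs j)) (hsl' j)
  have hV0 : 0 ≤ V := by simpa using hV 0
  simp_rw [norm_sq_apply_eq_sum he]
  rw [integral_finsetSum _ fun i _ => hM.integrable_linSgd hs hsl' T
    (F := fun u => ev i * inner ℝ (e i) (u - ul) ^ 2) (by fun_prop)]
  simp_rw [integral_const_mul]
  refine (sum_ev_mul_error_le (w := w)
    (D := 2 + 8 * κ ^ 2 * ‖ul‖ ^ 2 + 8 * κ ^ 4 * (κ * ‖ul‖ + 1) ^ 2 * V)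
    (inner_apply_eigenvector_eq_ite he) hη hθ hθ1 hT hlam hstep hV (by positivity)
    hM.sum_ev_le fun i => ?_).trans ?_
  · rw [← adjoint_inner_right, ← hul]
    exact hM.integral_inner_linSgd_le hs hsl hV i T
  · have := earlyNoise_nonneg (η := η) (θ := θ) (lam := lam) (T := T) (ev := ev)
    gcongr
    exact le_noiseFactor hV0 κ _

theorem integral_norm_linSgd_sub_sq_le (hM : IsLinearModel ρ Φ κ lam e ev (adjoint A w))
    (he : ∀ i, adjoint A (A (e i)) = ev i • e i) (hw : (A ∘L adjoint A) w + lam • w = F)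
    (hη : 0 < η) (hθ : 0 ≤ θ) (hθ1 : θ ≤ 1) (hT : 1 ≤ T) (hlam : (T : ℝ) ^ (-(1 - θ)) ≤ lam)
    (hηl : η * (lam + 2 * κ ^ 2) ≤ 1) (hV : ∀ T, ∑ t ∈ Finset.range T, stepSize η θ t ^ 2 ≤ V) :
    ∫ z, ‖A (linSgd Φ lam (stepSize η θ) T z) - F‖ ^ 2 ∂(Measure.pi fun _ : Fin T => ρ)
      ≤ (8 / η ^ 2 + 2) * (lam * ‖w‖) ^ 2 + 2 * noiseFactor κ V (‖adjoint A w‖ ^ 2)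
        * (V * earlyNoise η θ lam T ev + 2 * η * (T : ℝ) ^ (-θ) * κ ^ 2) := by
  have hint : Integrable (fun z => ‖A (linSgd Φ lam (stepSize η θ) T z - adjoint A w)‖ ^ 2)
      (Measure.pi fun _ : Fin T => ρ) :=
    hM.integrable_continuous_linSgd hη.le hθ hηl (F := fun u => ‖A (u - adjoint A w)‖ ^ 2)
      (by fun_prop)
  calc ∫ z, ‖A (linSgd Φ lam (stepSize η θ) T z) - F‖ ^ 2 ∂(Measure.pi fun _ : Fin T => ρ)
      ≤ ∫ z, (2 * ‖A (linSgd Φ lam (stepSize η θ) T z - adjoint A w)‖ ^ 2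
          + 2 * (lam * ‖w‖) ^ 2) ∂(Measure.pi fun _ : Fin T => ρ) :=
        integral_mono
          (hM.integrable_continuous_linSgd hη.le hθ hηl (F := fun u => ‖A u - F‖ ^ 2) (by fun_prop))
          ((hint.const_mul 2).add (integrable_const _))
          fun z => norm_apply_sub_sq_le hM.lam_pos.le hw (linSgd Φ lam (stepSize η θ) T z)
    _ = 2 * ∫ z, ‖A (linSgd Φ lam (stepSize η θ) T z - adjoint A w)‖ ^ 2
          ∂(Measure.pi fun _ : Fin T => ρ) + 2 * (lam * ‖w‖) ^ 2 := by
        rw [integral_add (hint.const_mul 2) (integrable_const _), integral_const_mul]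
        simp
    _ ≤ 2 * (4 / η ^ 2 * (lam * ‖w‖) ^ 2 + noiseFactor κ V (‖adjoint A w‖ ^ 2)
          * (V * earlyNoise η θ lam T ev + 2 * η * (T : ℝ) ^ (-θ) * κ ^ 2))
          + 2 * (lam * ‖w‖) ^ 2 := by
        gcongr
        exact integral_norm_apply_linSgd_sub_sq_le hM he hη hθ hθ1 hT hlam hηl hV
    _ = _ := by ring

end LinearExcess

section Activation

variable {σ : ℝ → ℝ} {C : ℝ}

lemma IsActivation.continuous (hσ : IsActivation σ C) : Continuous σ := hσ.diff.continuous

lemma IsActivation.continuous_deriv (hσ : IsActivation σ C) : Continuous (deriv σ) :=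
  hσ.diff_deriv.continuous

lemma IsActivation.abs_sub_le (hσ : IsActivation σ C) (u v : ℝ) :
    |σ v - σ u| ≤ C * |v - u| :=
  convex_univ.norm_image_sub_le_of_norm_deriv_le (fun x _ => hσ.diff x)
    (fun x _ => hσ.deriv_le x) (Set.mem_univ u) (Set.mem_univ v)

lemma IsActivation.abs_deriv_sub_le (hσ : IsActivation σ C) (u v : ℝ) :
    |deriv σ v - deriv σ u| ≤ C * |v - u| :=
  convex_univ.norm_image_sub_le_of_norm_deriv_le (fun x _ => hσ.diff_deriv x)
    (fun x _ => hσ.deriv_deriv_le x) (Set.mem_univ u) (Set.mem_univ v)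

lemma IsActivation.abs_taylor_le (hσ : IsActivation σ C) (u v : ℝ) :
    |σ v - σ u - deriv σ u * (v - u)| ≤ C * (v - u) ^ 2 := by
  have hderiv : ∀ t, HasDerivAt (fun t => σ t - deriv σ u * t) (deriv σ t - deriv σ u) t :=
    fun t => (hσ.diff t).hasDerivAt.sub (by simpa using (hasDerivAt_id t).const_mul (deriv σ u))
  have hmean := (convex_uIcc u v).norm_image_sub_le_of_norm_hasDerivWithin_le
    (C := C * |v - u|) (fun t _ => (hderiv t).hasDerivWithinAt)
    (fun t ht => (hσ.abs_deriv_sub_le u t).trans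
      (mul_le_mul_of_nonneg_left (Set.abs_sub_left_of_mem_uIcc ht) hσ.pos.le))
    Set.left_mem_uIcc Set.right_mem_uIcc
  calc |σ v - σ u - deriv σ u * (v - u)| = |σ v - deriv σ u * v - (σ u - deriv σ u * u)| := by
        ring_nf
    _ ≤ C * |v - u| * |v - u| := hmean
    _ = C * (v - u) ^ 2 := by rw [mul_assoc, abs_mul_abs_self, sq]

lemma IsActivation.abs_inner_le {E : Type*} [NormedAddCommGroup E] [InnerProductSpace ℝ E]
    (hσ : IsActivation σ C) {b x : E} (hb : ‖b‖ ≤ 1) (hx : ‖x‖ ≤ 1) : |σ (inner ℝ b x)| ≤ 2 := by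
  have hinner : |inner ℝ b x| ≤ 1 :=
    (abs_real_inner_le_norm _ _).trans (mul_le_one₀ hb (norm_nonneg x) hx)
  linarith [hσ.growth (inner ℝ b x)]

end Activation

section Network

/-- The parameter space of a network of width `2 m` as a Hilbert space: each neuron contributes a
block `(a, (b, c))`. -/
abbrev ParamSpace (d m : ℕ) : Type :=
  PiLp 2 fun _ : Neuron m => WithLp 2 (ℝ × WithLp 2 (Inp d × ℝ))

variable {d m : ℕ}

/-- The vector of `ParamSpace d m` with outer weights `a`, inner weights `b` and biases `c`. -/
def blocks (a : Neuron m → ℝ) (b : Neuron m → Inp d) (c : Neuron m → ℝ) : ParamSpace d m :=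
  WithLp.toLp 2 fun r => WithLp.toLp 2 (a r, WithLp.toLp 2 (b r, c r))

lemma inner_blocks (a a' : Neuron m → ℝ) (b b' : Neuron m → Inp d) (c c' : Neuron m → ℝ) :
    inner ℝ (blocks a b c) (blocks a' b' c')
      = ∑ r, (a r * a' r + (inner ℝ (b r) (b' r) + c r * c' r)) := by
  simp [blocks, PiLp.inner_apply, WithLp.prod_inner_apply, mul_comm]

lemma norm_sq_blocks (a : Neuron m → ℝ) (b : Neuron m → Inp d) (c : Neuron m → ℝ) :
    ‖blocks a b c‖ ^ 2 = ∑ r, (a r ^ 2 + (‖b r‖ ^ 2 + c r ^ 2)) := by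
  rw [← real_inner_self_eq_norm_sq, inner_blocks]
  simp only [sq, real_inner_self_eq_norm_mul_norm]

lemma blocks_sub (a a' : Neuron m → ℝ) (b b' : Neuron m → Inp d) (c c' : Neuron m → ℝ) :
    blocks a b c - blocks a' b' c'
      = blocks (fun r => a r - a' r) (fun r => b r - b' r) (fun r => c r - c' r) := rfl

lemma smul_blocks (t : ℝ) (a : Neuron m → ℝ) (b : Neuron m → Inp d) (c : Neuron m → ℝ) :
    t • blocks a b c = blocks (fun r => t * a r) (fun r => t • b r) (fun r => t * c r) := rfl

/-- The argument of the activation in neuron `r` at the input `x`. -/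
def preactivation (γ : ℝ) (Θ : Params d m) (x : Inp d) (r : Neuron m) : ℝ :=
  inner ℝ (Θ.b r) x + γ * Θ.c r

/-- The displacement `Θ - Θ₀`, as a vector of the parameter space. -/
def displacement (Θ₀ Θ : Params d m) : ParamSpace d m :=
  blocks (fun r => Θ.a r - Θ₀.a r) (fun r => Θ.b r - Θ₀.b r) (fun r => Θ.c r - Θ₀.c r)

/-- The gradient at `Θ` of the network output with respect to its parameters. -/
def gradient (σ : ℝ → ℝ) (γ : ℝ) (Θ : Params d m) (x : Inp d) : ParamSpace d m :=
  (√(2 * m : ℝ))⁻¹ • blocks (fun r => σ (preactivation γ Θ x r))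
    (fun r => (Θ.a r * deriv σ (preactivation γ Θ x r)) • x)
    (fun r => γ * (Θ.a r * deriv σ (preactivation γ Θ x r)))

/-- The gradient at `Θ` of half the squared loss `(g_Θ(x) - y) ^ 2 / 2` at the sample
`z = (x, y)`. -/
def lossGrad (σ : ℝ → ℝ) (γ : ℝ) (Θ : Params d m) (z : Inp d × ℝ) : ParamSpace d m :=
  (network σ γ Θ z.1 - z.2) • gradient σ γ Θ z.1

variable {σ : ℝ → ℝ} {C γ : ℝ}

lemma network_eq_sum (σ : ℝ → ℝ) (γ : ℝ) (Θ : Params d m) (x : Inp d) :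
    network σ γ Θ x = (√(2 * m : ℝ))⁻¹ * ∑ r, Θ.a r * σ (preactivation γ Θ x r) := rfl

lemma displacement_sgdStep (σ : ℝ → ℝ) (γ lam s : ℝ) (Θ₀ Θ : Params d m) (z : Inp d × ℝ) :
    displacement Θ₀ (sgdStep σ γ lam s Θ₀ Θ z)
      = (1 - s * lam) • displacement Θ₀ Θ - s • lossGrad σ γ Θ z := by
  simp only [displacement, lossGrad, gradient, preactivation, smul_blocks, blocks_sub, sgdStep]
  congr 1
  · funext r; ring
  · funext r; rw [add_sub_cancel_left, smul_smul, smul_smul, smul_smul]; congr 2; ring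
  · funext r; ring

lemma displacement_self (Θ : Params d m) : displacement Θ Θ = 0 := by
  have hzero : ‖displacement Θ Θ‖ ^ 2 = 0 := by rw [displacement, norm_sq_blocks]; simp
  simpa using hzero

/-- The factor of the width `2 m` in the nonlinearity of the network near a symmetric
initialization. -/
def nonlinearity (C : ℝ) (m : ℕ) : ℝ := 4 * C / √(2 * m : ℝ)

lemma nonlinearity_nonneg (hC : 0 ≤ C) (m : ℕ) : 0 ≤ nonlinearity C m := by
  rw [nonlinearity]
  positivity

lemma nonlinearity_le (hC : 0 ≤ C) (m : ℕ) : nonlinearity C m ≤ 4 * C := by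
  rcases m.eq_zero_or_pos with rfl | hm
  · simp [nonlinearity, hC]
  · have hm' : (1 : ℝ) ≤ m := by exact_mod_cast hm
    exact div_le_self (by positivity) (Real.one_le_sqrt.2 (by linarith))

lemma preactivation_sub_eq (γ : ℝ) (Θ₀ Θ : Params d m) (x : Inp d) (r : Neuron m) :
    preactivation γ Θ x r - preactivation γ Θ₀ x r
      = inner ℝ (Θ.b r - Θ₀.b r) x + γ * (Θ.c r - Θ₀.c r) := by
  rw [inner_sub_left, preactivation, preactivation]
  ring

lemma preactivation_sub_sq_le (hγ : |γ| ≤ 1) (Θ₀ Θ : Params d m) {x : Inp d} (hx : ‖x‖ ≤ 1)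
    (r : Neuron m) :
    (preactivation γ Θ x r - preactivation γ Θ₀ x r) ^ 2
      ≤ 2 * (‖Θ.b r - Θ₀.b r‖ ^ 2 + (Θ.c r - Θ₀.c r) ^ 2) := by
  have habs : |preactivation γ Θ x r - preactivation γ Θ₀ x r|
      ≤ ‖Θ.b r - Θ₀.b r‖ + |Θ.c r - Θ₀.c r| := by
    rw [preactivation_sub_eq]
    refine (abs_add_le _ _).trans (add_le_add ?_ ?_)
    · exact (abs_real_inner_le_norm _ _).trans (mul_le_of_le_one_right (norm_nonneg _) hx)
    · rw [abs_mul]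
      exact mul_le_of_le_one_left (abs_nonneg _) hγ
  rw [← sq_abs, ← sq_abs (Θ.c r - Θ₀.c r)]
  exact (pow_le_pow_left₀ (abs_nonneg _) habs 2).trans (add_sq_le)

/-- The first order Taylor error of one neuron, as a function of its outer weight and its
preactivation. -/
def neuronError (σ : ℝ → ℝ) (a₀ a p₀ p : ℝ) : ℝ :=
  a₀ * (σ p - σ p₀ - deriv σ p₀ * (p - p₀)) + (a - a₀) * (σ p - σ p₀)

lemma IsActivation.abs_neuronError_le (hσ : IsActivation σ C) {a₀ : ℝ} (ha₀ : |a₀| ≤ 1)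
    (a p₀ p : ℝ) :
    |neuronError σ a₀ a p₀ p| ≤ C / 2 * ((a - a₀) ^ 2 + 3 * (p - p₀) ^ 2) := by
  have hC := hσ.pos
  have htaylor : |a₀ * (σ p - σ p₀ - deriv σ p₀ * (p - p₀))| ≤ C * (p - p₀) ^ 2 := by
    rw [abs_mul]
    exact (mul_le_of_le_one_left (abs_nonneg _) ha₀).trans (hσ.abs_taylor_le _ _)
  have hcross : |(a - a₀) * (σ p - σ p₀)| ≤ C * (|a - a₀| * |p - p₀|) := by
    rw [abs_mul, mul_left_comm]
    exact mul_le_mul_of_nonneg_left (hσ.abs_sub_le _ _) (abs_nonneg _)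
  have hyoung : 2 * (|a - a₀| * |p - p₀|) ≤ (a - a₀) ^ 2 + (p - p₀) ^ 2 := by
    rw [← sq_abs (a - a₀), ← sq_abs (p - p₀), ← mul_assoc]
    exact two_mul_le_add_sq _ _
  calc |neuronError σ a₀ a p₀ p| ≤ C * (p - p₀) ^ 2 + C * (|a - a₀| * |p - p₀|) :=
        (abs_add_le _ _).trans (add_le_add htaylor hcross)
    _ ≤ C / 2 * ((a - a₀) ^ 2 + 3 * (p - p₀) ^ 2) := by
        linarith [mul_le_mul_of_nonneg_left hyoung hC.le]

lemma network_sub_sub_inner_eq (σ : ℝ → ℝ) (γ : ℝ) (Θ₀ Θ : Params d m) (x : Inp d) :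
    network σ γ Θ x - network σ γ Θ₀ x - inner ℝ (gradient σ γ Θ₀ x) (displacement Θ₀ Θ)
      = (√(2 * m : ℝ))⁻¹ * ∑ r, neuronError σ (Θ₀.a r) (Θ.a r)
          (preactivation γ Θ₀ x r) (preactivation γ Θ x r) := by
  rw [network_eq_sum, network_eq_sum, gradient, displacement, real_inner_smul_left, inner_blocks,
    ← mul_sub, ← mul_sub, ← Finset.sum_sub_distrib, ← Finset.sum_sub_distrib]
  congr 1
  refine Finset.sum_congr rfl fun r _ => ?_
  rw [neuronError, preactivation_sub_eq, real_inner_smul_left, real_inner_comm]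
  ring

theorem abs_network_sub_sub_inner_le (hσ : IsActivation σ C) (hγ : |γ| ≤ 1) {Θ₀ : Params d m}
    (ha₀ : ∀ r, |Θ₀.a r| ≤ 1) (Θ : Params d m) {x : Inp d} (hx : ‖x‖ ≤ 1) :
    |network σ γ Θ x - network σ γ Θ₀ x - inner ℝ (gradient σ γ Θ₀ x) (displacement Θ₀ Θ)|
      ≤ nonlinearity C m * ‖displacement Θ₀ Θ‖ ^ 2 := by
  rw [network_sub_sub_inner_eq, abs_mul, abs_of_nonneg (by positivity), nonlinearity,
    div_eq_inv_mul, mul_assoc, displacement, norm_sq_blocks, Finset.mul_sum]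
  refine mul_le_mul_of_nonneg_left ((Finset.abs_sum_le_sum_abs _ _).trans
    (Finset.sum_le_sum fun r _ => (hσ.abs_neuronError_le (ha₀ r) _ _ _).trans ?_)) (by positivity)
  rw [show 4 * C = C / 2 * 8 by ring, mul_assoc]
  refine mul_le_mul_of_nonneg_left ?_ (half_pos hσ.pos).le
  linarith [preactivation_sub_sq_le hγ Θ₀ Θ hx r, sq_nonneg (Θ.a r - Θ₀.a r),
    sq_nonneg ‖Θ.b r - Θ₀.b r‖, sq_nonneg (Θ.c r - Θ₀.c r)]

lemma IsActivation.sub_sq_le (hσ : IsActivation σ C) (u v : ℝ) :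
    (σ v - σ u) ^ 2 ≤ C ^ 2 * (v - u) ^ 2 := by
  rw [← mul_pow]
  exact sq_le_sq.2 ((hσ.abs_sub_le u v).trans_eq (by rw [abs_mul, abs_of_pos hσ.pos]))

lemma IsActivation.mul_deriv_sub_sq_le (hσ : IsActivation σ C) {a₀ : ℝ} (ha₀ : |a₀| ≤ 1)
    (a u v : ℝ) :
    (a * deriv σ v - a₀ * deriv σ u) ^ 2 ≤ 2 * C ^ 2 * ((v - u) ^ 2 + (a - a₀) ^ 2) := by
  have habs : |a * deriv σ v - a₀ * deriv σ u| ≤ C * (|v - u| + |a - a₀|) := by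
    rw [show a * deriv σ v - a₀ * deriv σ u
      = a₀ * (deriv σ v - deriv σ u) + deriv σ v * (a - a₀) by ring, mul_add]
    refine (abs_add_le _ _).trans (add_le_add ?_ ?_) <;> rw [abs_mul]
    · exact (mul_le_of_le_one_left (abs_nonneg _) ha₀).trans (hσ.abs_deriv_sub_le _ _)
    · exact mul_le_mul_of_nonneg_right (hσ.deriv_le _) (abs_nonneg _)
  calc (a * deriv σ v - a₀ * deriv σ u) ^ 2 = |a * deriv σ v - a₀ * deriv σ u| ^ 2 :=
        (sq_abs _).symm
    _ ≤ (C * (|v - u| + |a - a₀|)) ^ 2 := pow_le_pow_left₀ (abs_nonneg _) habs 2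
    _ ≤ C ^ 2 * (2 * (|v - u| ^ 2 + |a - a₀| ^ 2)) := by
        rw [mul_pow]
        exact mul_le_mul_of_nonneg_left add_sq_le (sq_nonneg C)
    _ = 2 * C ^ 2 * ((v - u) ^ 2 + (a - a₀) ^ 2) := by rw [sq_abs, sq_abs]; ring

lemma norm_gradient_sub_sq_eq (σ : ℝ → ℝ) (γ : ℝ) (Θ₀ Θ : Params d m) (x : Inp d) :
    ‖gradient σ γ Θ x - gradient σ γ Θ₀ x‖ ^ 2
      = (√(2 * m : ℝ))⁻¹ ^ 2 * ∑ r,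
        ((σ (preactivation γ Θ x r) - σ (preactivation γ Θ₀ x r)) ^ 2
          + (‖x‖ ^ 2 + γ ^ 2) * (Θ.a r * deriv σ (preactivation γ Θ x r)
            - Θ₀.a r * deriv σ (preactivation γ Θ₀ x r)) ^ 2) := by
  rw [gradient, gradient, ← smul_sub, norm_smul, mul_pow, Real.norm_eq_abs, sq_abs, blocks_sub,
    norm_sq_blocks]
  congr 1
  refine Finset.sum_congr rfl fun r _ => ?_
  rw [← sub_smul, norm_smul, mul_pow, Real.norm_eq_abs, sq_abs]
  ring

theorem norm_gradient_sub_le (hσ : IsActivation σ C) (hγ : |γ| ≤ 1) {Θ₀ : Params d m}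
    (ha₀ : ∀ r, |Θ₀.a r| ≤ 1) (Θ : Params d m) {x : Inp d} (hx : ‖x‖ ≤ 1) :
    ‖gradient σ γ Θ x - gradient σ γ Θ₀ x‖ ≤ nonlinearity C m * ‖displacement Θ₀ Θ‖ := by
  have hC := hσ.pos
  rw [nonlinearity]
  refine le_of_sq_le_sq ?_ (by positivity)
  have hxγ : ‖x‖ ^ 2 + γ ^ 2 ≤ 2 := by
    linarith [pow_le_one₀ (n := 2) (norm_nonneg x) hx, (sq_le_one_iff_abs_le_one γ).2 hγ]
  rw [norm_gradient_sub_sq_eq, mul_pow, div_eq_inv_mul, mul_pow _ (4 * C), mul_assoc,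
    displacement, norm_sq_blocks, Finset.mul_sum _ _ ((4 * C) ^ 2)]
  gcongr with r
  set Δa := (Θ.a r - Θ₀.a r) ^ 2
  set Δp := (preactivation γ Θ x r - preactivation γ Θ₀ x r) ^ 2
  have hΔp : Δp ≤ 2 * (‖Θ.b r - Θ₀.b r‖ ^ 2 + (Θ.c r - Θ₀.c r) ^ 2) :=
    preactivation_sub_sq_le hγ Θ₀ Θ hx r
  calc _ ≤ C ^ 2 * Δp + 2 * (2 * C ^ 2 * (Δp + Δa)) := by
        gcongr
        · exact hσ.sub_sq_le _ _
        · exact hσ.mul_deriv_sub_sq_le (ha₀ r) _ _ _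
    _ = C ^ 2 * (5 * Δp + 4 * Δa) := by ring
    _ ≤ C ^ 2 * (16 * (Δa + (‖Θ.b r - Θ₀.b r‖ ^ 2 + (Θ.c r - Θ₀.c r) ^ 2))) := by
        gcongr
        linarith [sq_nonneg (Θ.a r - Θ₀.a r), sq_nonneg ‖Θ.b r - Θ₀.b r‖,
          sq_nonneg (Θ.c r - Θ₀.c r)]
    _ = (4 * C) ^ 2 * (Δa + (‖Θ.b r - Θ₀.b r‖ ^ 2 + (Θ.c r - Θ₀.c r) ^ 2)) := by ring

end Network

section SymmetricInitialization

variable {d m : ℕ} {σ : ℝ → ℝ} {C γ : ℝ}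

/-- The kernel contributed by a neuron with inner weight `b`; its mean over the sphere is the
neural tangent kernel. The two arguments form a pair, so that it is a random function on the
product of the input space with itself. -/
def neuronKernel (σ : ℝ → ℝ) (γ : ℝ) (b : Inp d) (q : Inp d × Inp d) : ℝ :=
  σ (inner ℝ b q.1) * σ (inner ℝ b q.2)
    + (inner ℝ q.1 q.2 + γ ^ 2) * (deriv σ (inner ℝ b q.1) * deriv σ (inner ℝ b q.2))

lemma measurable_neuronKernel (hσ : IsActivation σ C) :
    Measurable (Function.uncurry (neuronKernel (d := d) σ γ)) := by
  have hcont := hσ.continuous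
  have hcont' := hσ.continuous_deriv
  refine Continuous.measurable ?_
  unfold neuronKernel Function.uncurry
  fun_prop

lemma abs_neuronKernel_le (hσ : IsActivation σ C) (hγ : |γ| ≤ 1) {b x x' : Inp d}
    (hb : ‖b‖ ≤ 1) (hx : ‖x‖ ≤ 1) (hx' : ‖x'‖ ≤ 1) :
    |neuronKernel σ γ b (x, x')| ≤ 4 + 2 * C ^ 2 := by
  have hC := hσ.pos
  have hinner : |inner ℝ x x' + γ ^ 2| ≤ 1 + 1 :=
    (abs_add_le _ _).trans (add_le_add
      ((abs_real_inner_le_norm _ _).trans (mul_le_one₀ hx (norm_nonneg _) hx'))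
      (by rwa [abs_sq, sq_le_one_iff_abs_le_one]))
  calc |neuronKernel σ γ b (x, x')| ≤ 2 * 2 + (1 + 1) * (C * C) := by
        refine (abs_add_le _ _).trans ?_
        rw [abs_mul, abs_mul, abs_mul]
        gcongr
        exacts [hσ.abs_inner_le hb hx, hσ.abs_inner_le hb hx', hσ.deriv_le _, hσ.deriv_le _]
    _ = 4 + 2 * C ^ 2 := by ring

/-- The tangent features of the network at a symmetric initialization with inner weights `w`. -/
def initFeature (σ : ℝ → ℝ) (γ : ℝ) (w : Fin m → Inp d) : Inp d → ParamSpace d m :=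
  gradient σ γ (initParams 1 w)

lemma abs_initParams_a_le (w : Fin m → Inp d) (r : Neuron m) : |(initParams 1 w).a r| ≤ 1 := by
  rcases r with r | r <;> simp [initParams]

lemma network_initParams (σ : ℝ → ℝ) (γ : ℝ) (w : Fin m → Inp d) (x : Inp d) :
    network σ γ (initParams 1 w) x = 0 := by
  rw [network, Fintype.sum_sum_type]
  simp [initParams]

lemma measurable_initFeature (hσ : IsActivation σ C) (w : Fin m → Inp d) :
    Measurable (initFeature σ γ w) := by
  have hcont := hσ.continuous
  have hcont' := hσ.continuous_deriv
  refine Continuous.measurable ?_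
  unfold initFeature gradient blocks preactivation
  fun_prop

lemma inner_initFeature (w : Fin m → Inp d) (x x' : Inp d) :
    inner ℝ (initFeature σ γ w x) (initFeature σ γ w x')
      = (m : ℝ)⁻¹ * ∑ r, neuronKernel σ γ (w r) (x, x') := by
  have hscale : (√(2 * m : ℝ))⁻¹ * (√(2 * m : ℝ))⁻¹ = 2⁻¹ * (m : ℝ)⁻¹ := by
    rw [← mul_inv, Real.mul_self_sqrt (by positivity), mul_inv]
  rw [initFeature, gradient, gradient, real_inner_smul_left, real_inner_smul_right, inner_blocks,
    Fintype.sum_sum_type, ← mul_assoc, hscale]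
  simp only [preactivation, initParams, Sum.elim_inl, Sum.elim_inr, mul_zero, add_zero,
    inner_smul_left, inner_smul_right, conj_trivial, one_mul, neg_mul, mul_neg]
  rw [← Finset.sum_add_distrib, mul_comm (2⁻¹ : ℝ), mul_assoc, Finset.mul_sum]
  congr 1
  refine Finset.sum_congr rfl fun r _ => ?_
  rw [neuronKernel]
  ring

/-- The constant `κ` of the paper, a bound for the tangent features. -/
def kappa (C : ℝ) : ℝ := √(4 + 2 * C ^ 2)

lemma kappa_nonneg (C : ℝ) : 0 ≤ kappa C := Real.sqrt_nonneg _

lemma kappa_sq (C : ℝ) : kappa C ^ 2 = 4 + 2 * C ^ 2 := Real.sq_sqrt (by positivity)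

lemma norm_initFeature_le (hσ : IsActivation σ C) (hγ : |γ| ≤ 1)
    {w : Fin m → Inp d} (hw : ∀ r, ‖w r‖ ≤ 1) {x : Inp d} (hx : ‖x‖ ≤ 1) :
    ‖initFeature σ γ w x‖ ≤ kappa C := by
  refine Real.le_sqrt_of_sq_le ?_
  rw [← real_inner_self_eq_norm_sq, inner_initFeature]
  have hsum : ∑ r, neuronKernel σ γ (w r) (x, x) ≤ m * (4 + 2 * C ^ 2) := by
    refine (Finset.sum_le_card_nsmul Finset.univ _ _ fun r _ =>
      (le_abs_self _).trans (abs_neuronKernel_le hσ hγ (hw r) hx hx)).trans_eq ?_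
    rw [Finset.card_univ, Fintype.card_fin, nsmul_eq_mul]
  exact inv_mul_le_of_le_mul₀ m.cast_nonneg (by positivity) hsum

end SymmetricInitialization

section Contraction

variable {X H : Type*} [NormedAddCommGroup H] [InnerProductSpace ℝ H] {Φ : X → H}
  {s lam κ : ℝ} {z : X × ℝ}

lemma norm_linStep_sub_le (hs : 0 ≤ s) (hsl : s * (lam + κ ^ 2) ≤ 1) (hΦ : ‖Φ z.1‖ ≤ κ)
    (u v : H) :
    ‖linStep Φ lam s u z - linStep Φ lam s v z‖ ≤ (1 - s * lam) * ‖u - v‖ := by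
  set f := inner ℝ (Φ z.1) (u - v) with hf
  have hdiff : linStep Φ lam s u z - linStep Φ lam s v z
      = (1 - s * lam) • (u - v) - (s * f) • Φ z.1 := by
    rw [hf, linStep, linStep, linGrad, linGrad, inner_sub_right]
    module
  have hsΦ : s * ‖Φ z.1‖ ^ 2 ≤ 1 - s * lam := by
    have : s * ‖Φ z.1‖ ^ 2 ≤ s * κ ^ 2 := by gcongr
    linarith
  have h0 : 0 ≤ 1 - s * lam := le_trans (by positivity) hsΦ
  have hexpand : ‖(1 - s * lam) • (u - v) - (s * f) • Φ z.1‖ ^ 2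
      = ((1 - s * lam) * ‖u - v‖) ^ 2
        - s * f ^ 2 * ((1 - s * lam) + ((1 - s * lam) - s * ‖Φ z.1‖ ^ 2)) := by
    rw [norm_sub_sq_real, inner_smul_left, inner_smul_right, norm_smul, norm_smul,
      real_inner_comm, ← hf]
    simp only [mul_pow, Real.norm_eq_abs, sq_abs, conj_trivial]
    ring
  rw [hdiff]
  refine le_of_sq_le_sq ?_ (by positivity)
  rw [hexpand, sub_le_self_iff]
  exact mul_nonneg (by positivity) (add_nonneg h0 (sub_nonneg.2 hsΦ))

end Contraction

section LazyTraining

variable {d m : ℕ} {σ : ℝ → ℝ} {C γ : ℝ}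

/-- The sample `(x, y)` satisfies `‖x‖ ≤ 1` and `|y| ≤ 1`. -/
def IsUnitSample (z : Inp d × ℝ) : Prop := ‖z.1‖ ≤ 1 ∧ |z.2| ≤ 1

lemma abs_network_sub_inner_le (hσ : IsActivation σ C) (hγ : |γ| ≤ 1) (w : Fin m → Inp d)
    (Θ : Params d m) {x : Inp d} (hx : ‖x‖ ≤ 1) :
    |network σ γ Θ x - inner ℝ (initFeature σ γ w x) (displacement (initParams 1 w) Θ)|
      ≤ nonlinearity C m * ‖displacement (initParams 1 w) Θ‖ ^ 2 := by
  have := abs_network_sub_sub_inner_le hσ hγ (abs_initParams_a_le w) Θ hx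
  rwa [network_initParams, sub_zero] at this

lemma norm_gradient_sub_initFeature_le (hσ : IsActivation σ C) (hγ : |γ| ≤ 1)
    (w : Fin m → Inp d) (Θ : Params d m) {x : Inp d} (hx : ‖x‖ ≤ 1) :
    ‖gradient σ γ Θ x - initFeature σ γ w x‖
      ≤ nonlinearity C m * ‖displacement (initParams 1 w) Θ‖ :=
  norm_gradient_sub_le hσ hγ (abs_initParams_a_le w) Θ hx

variable {w : Fin m → Inp d} {Θ : Params d m} {z : Inp d × ℝ} {B : ℝ}

lemma abs_network_le (hσ : IsActivation σ C) (hγ : |γ| ≤ 1) (hw : ∀ r, ‖w r‖ ≤ 1)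
    (hΘ : ‖displacement (initParams 1 w) Θ‖ ≤ B) {x : Inp d} (hx : ‖x‖ ≤ 1) :
    |network σ γ Θ x| ≤ kappa C * B + nonlinearity C m * B ^ 2 := by
  have hε := nonlinearity_nonneg hσ.pos.le m
  have hinner : |inner ℝ (initFeature σ γ w x) (displacement (initParams 1 w) Θ)|
      ≤ kappa C * B :=
    (abs_real_inner_le_norm _ _).trans (mul_le_mul (norm_initFeature_le hσ hγ hw hx) hΘ
      (norm_nonneg _) (kappa_nonneg C))
  have hnonlinear := (abs_network_sub_inner_le hσ hγ w Θ hx).trans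
    (mul_le_mul_of_nonneg_left (pow_le_pow_left₀ (norm_nonneg _) hΘ 2) hε)
  linarith [abs_sub_abs_le_abs_sub (network σ γ Θ x)
    (inner ℝ (initFeature σ γ w x) (displacement (initParams 1 w) Θ))]

lemma norm_gradient_le (hσ : IsActivation σ C) (hγ : |γ| ≤ 1) (hw : ∀ r, ‖w r‖ ≤ 1)
    (hΘ : ‖displacement (initParams 1 w) Θ‖ ≤ B) {x : Inp d} (hx : ‖x‖ ≤ 1) :
    ‖gradient σ γ Θ x‖ ≤ kappa C + nonlinearity C m * B := by
  have hnonlinear := (norm_gradient_sub_initFeature_le hσ hγ w Θ hx).trans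
    (mul_le_mul_of_nonneg_left hΘ (nonlinearity_nonneg hσ.pos.le m))
  linarith [norm_sub_norm_le (gradient σ γ Θ x) (initFeature σ γ w x),
    norm_initFeature_le hσ hγ hw hx]

lemma norm_lossGrad_sub_linGrad_le (hσ : IsActivation σ C) (hγ : |γ| ≤ 1)
    (hw : ∀ r, ‖w r‖ ≤ 1) (hΘ : ‖displacement (initParams 1 w) Θ‖ ≤ B) (hz : IsUnitSample z) :
    ‖lossGrad σ γ Θ z - linGrad (initFeature σ γ w) (displacement (initParams 1 w) Θ) z‖
      ≤ nonlinearity C m * B ^ 2 * kappa C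
        + (kappa C * B + nonlinearity C m * B ^ 2 + 1) * (nonlinearity C m * B) := by
  have hε := nonlinearity_nonneg hσ.pos.le m
  set u := displacement (initParams 1 w) Θ
  have hresidual : |network σ γ Θ z.1 - z.2| ≤ kappa C * B + nonlinearity C m * B ^ 2 + 1 :=
    (abs_sub _ _).trans (add_le_add (abs_network_le hσ hγ hw hΘ hz.1) hz.2)
  have hdecomp : lossGrad σ γ Θ z - linGrad (initFeature σ γ w) u z
      = (network σ γ Θ z.1 - inner ℝ (initFeature σ γ w z.1) u) • initFeature σ γ w z.1
        + (network σ γ Θ z.1 - z.2) • (gradient σ γ Θ z.1 - initFeature σ γ w z.1) := by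
    rw [lossGrad, linGrad]
    module
  rw [hdecomp]
  refine (norm_add_le _ _).trans (add_le_add ?_ ?_) <;> rw [norm_smul, Real.norm_eq_abs]
  · exact mul_le_mul ((abs_network_sub_inner_le hσ hγ w Θ hz.1).trans (by gcongr))
      (norm_initFeature_le hσ hγ hw hz.1) (norm_nonneg _) (by positivity)
  · exact mul_le_mul hresidual ((norm_gradient_sub_initFeature_le hσ hγ w Θ hz.1).trans
      (by gcongr)) (norm_nonneg _) ((abs_nonneg _).trans hresidual)

/-- The constant in the distance between the iterates of the network and those of its
linearization. -/
def driftConst (C : ℝ) : ℝ := 8 * kappa C + 32 * C + 2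

lemma driftConst_nonneg (hC : 0 ≤ C) : 0 ≤ driftConst C := by
  have := kappa_nonneg C
  rw [driftConst]
  positivity

lemma norm_lossGrad_sub_linGrad_le_driftConst (hσ : IsActivation σ C) (hγ : |γ| ≤ 1)
    (hw : ∀ r, ‖w r‖ ≤ 1) (hB : 1 ≤ B) (hBm : B ^ 2 ≤ 2 * m)
    (hΘ : ‖displacement (initParams 1 w) Θ‖ ≤ 2 * B) (hz : IsUnitSample z) :
    ‖lossGrad σ γ Θ z - linGrad (initFeature σ γ w) (displacement (initParams 1 w) Θ) z‖
      ≤ driftConst C * nonlinearity C m * B ^ 2 := by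
  have hC := hσ.pos
  have hε := nonlinearity_nonneg hC.le m
  have hB0 : 0 < B := zero_lt_one.trans_le hB
  have hεB : nonlinearity C m * B ≤ 4 * C := by
    have hsqrt : B ≤ √(2 * m) := Real.le_sqrt_of_sq_le hBm
    rw [nonlinearity, div_mul_eq_mul_div, div_le_iff₀ (hB0.trans_le hsqrt)]
    gcongr
  calc _ ≤ nonlinearity C m * (2 * B) ^ 2 * kappa C
        + (kappa C * (2 * B) + nonlinearity C m * (2 * B) ^ 2 + 1)
          * (nonlinearity C m * (2 * B)) := norm_lossGrad_sub_linGrad_le hσ hγ hw hΘ hz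
    _ = nonlinearity C m * (8 * kappa C * B ^ 2 + 8 * (nonlinearity C m * B) * B ^ 2
          + 2 * (1 * B)) := by ring
    _ ≤ nonlinearity C m * (8 * kappa C * B ^ 2 + 8 * (4 * C) * B ^ 2 + 2 * (B * B)) := by
        gcongr
    _ = driftConst C * nonlinearity C m * B ^ 2 := by rw [driftConst]; ring

variable {lam η θ : ℝ} {T : ℕ}

theorem norm_displacement_sub_linSgd_le (hσ : IsActivation σ C) (hγ : |γ| ≤ 1)
    (hw : ∀ r, ‖w r‖ ≤ 1) (hB : 1 ≤ B) (hBm : B ^ 2 ≤ 2 * m) (hlamB : lam * B ^ 2 = 1)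
    (hη : 0 ≤ η) (hθ : 0 ≤ θ) (hηl : η * (lam + kappa C ^ 2) ≤ 1)
    (hsmall : driftConst C * nonlinearity C m * B ^ 4 ≤ B) {z : Fin T → Inp d × ℝ}
    (hz : ∀ i, IsUnitSample (z i)) :
    ‖displacement (initParams 1 w) (sgd σ γ lam η θ (initParams 1 w) T z)
        - linSgd (initFeature σ γ w) lam (stepSize η θ) T z‖
      ≤ driftConst C * nonlinearity C m * B ^ 4 := by
  have hlam : 0 < lam := pos_of_mul_pos_left (hlamB ▸ zero_lt_one) (sq_nonneg B)
  have hdrift : 0 ≤ driftConst C * nonlinearity C m :=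
    mul_nonneg (driftConst_nonneg hσ.pos.le) (nonlinearity_nonneg hσ.pos.le m)
  have hs := stepSize_nonneg (θ := θ) hη
  have hsl := stepSize_mul_le_one hη hθ (by positivity) hηl
  induction T with
  | zero =>
    simp only [sgd, linSgd, displacement_self, sub_zero, norm_zero]
    positivity
  | succ T ih =>
    have hprev := ih (z := fun i => z i.castSucc) fun i => hz _
    set Θ := sgd σ γ lam η θ (initParams 1 w) T fun i => z i.castSucc
    set u := displacement (initParams 1 w) Θ
    set v := linSgd (initFeature σ γ w) lam (stepSize η θ) T fun i => z i.castSucc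
    have hlast := hz (Fin.last T)
    have hv : ‖v‖ ≤ B := by
      refine le_of_sq_le_sq ((norm_linSgd_sq_le hs hlam hsl
        (fun i => norm_initFeature_le hσ hγ hw (hz _).1) fun i => (hz _).2).trans_eq ?_)
        (zero_le_one.trans hB)
      rw [div_eq_iff hlam.ne', mul_comm, hlamB]
    have hu : ‖u‖ ≤ 2 * B := by linarith [norm_sub_norm_le u v]
    have hsgd : displacement (initParams 1 w) (sgd σ γ lam η θ (initParams 1 w) (T + 1) z)
        = linStep (initFeature σ γ w) lam (stepSize η θ T) u (z (Fin.last T))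
          - stepSize η θ T • (lossGrad σ γ Θ (z (Fin.last T))
            - linGrad (initFeature σ γ w) u (z (Fin.last T))) := by
      rw [smul_sub, linStep, sub_sub_sub_cancel_right]
      exact displacement_sgdStep σ γ lam _ _ Θ _
    have hshrink : 0 ≤ 1 - stepSize η θ T * lam := by
      linarith [hsl T, mul_nonneg (hs T) (sq_nonneg (kappa C))]
    rw [hsgd, linSgd, sub_right_comm]
    calc _ ≤ (1 - stepSize η θ T * lam) * ‖u - v‖
          + stepSize η θ T * (driftConst C * nonlinearity C m * B ^ 2) := by
          refine (norm_sub_le _ _).trans (add_le_add (norm_linStep_sub_le (hs T) (hsl T)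
            (norm_initFeature_le hσ hγ hw hlast.1) u v) ?_)
          rw [norm_smul, Real.norm_of_nonneg (hs T)]
          exact mul_le_mul_of_nonneg_left
            (norm_lossGrad_sub_linGrad_le_driftConst hσ hγ hw hB hBm hu hlast) (hs T)
      _ ≤ (1 - stepSize η θ T * lam) * (driftConst C * nonlinearity C m * B ^ 4)
          + stepSize η θ T * (driftConst C * nonlinearity C m * B ^ 2) := by gcongr
      _ = driftConst C * nonlinearity C m * B ^ 4
          + stepSize η θ T * (driftConst C * nonlinearity C m * B ^ 2) * (1 - lam * B ^ 2) := by
          ring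
      _ = driftConst C * nonlinearity C m * B ^ 4 := by rw [hlamB]; ring

/-- A bound for the displacement of the parameters after `T` steps, uniform in the width and in the
regularization. -/
def displacementBound (C η : ℝ) : ℕ → ℝ
  | 0 => 0
  | T + 1 => displacementBound C η T
      + η * ((kappa C * displacementBound C η T + 4 * C * displacementBound C η T ^ 2 + 1)
        * (kappa C + 4 * C * displacementBound C η T))

lemma displacementBound_nonneg (hC : 0 ≤ C) (hη : 0 ≤ η) (T : ℕ) :
    0 ≤ displacementBound C η T := by
  have := kappa_nonneg C
  induction T with
  | zero => exact le_rfl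
  | succ T ih => rw [displacementBound]; positivity

lemma displacementBound_mono (hC : 0 ≤ C) (hη : 0 ≤ η) : Monotone (displacementBound C η) := by
  refine monotone_nat_of_le_succ fun T => ?_
  have hB := displacementBound_nonneg hC hη T
  have := kappa_nonneg C
  exact le_add_of_nonneg_right (by positivity)

lemma norm_displacement_sgd_le (hσ : IsActivation σ C) (hγ : |γ| ≤ 1) (hw : ∀ r, ‖w r‖ ≤ 1)
    (hlam : 0 ≤ lam) (hη : 0 ≤ η) (hθ : 0 ≤ θ) (hηl : η * lam ≤ 1) {z : Fin T → Inp d × ℝ}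
    (hz : ∀ i, IsUnitSample (z i)) :
    ‖displacement (initParams 1 w) (sgd σ γ lam η θ (initParams 1 w) T z)‖
      ≤ displacementBound C η T := by
  induction T with
  | zero => simp [sgd, displacement_self, displacementBound]
  | succ T ih =>
    have hprev := ih (z := fun i => z i.castSucc) fun i => hz _
    have hlast := hz (Fin.last T)
    have hε := nonlinearity_le hσ.pos.le m
    have hB := displacementBound_nonneg hσ.pos.le hη T
    have := kappa_nonneg C
    have := hσ.pos
    rw [sgd, displacement_sgdStep]
    refine (norm_sub_le _ _).trans (add_le_add ?_ ?_)
    · have hsl : stepSize η θ T * lam ≤ 1 := stepSize_mul_le_one hη hθ hlam hηl T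
      have hsl0 : 0 ≤ stepSize η θ T * lam := mul_nonneg (stepSize_nonneg hη T) hlam
      refine le_trans ?_ hprev
      rw [norm_smul]
      refine mul_le_of_le_one_left (norm_nonneg _) (abs_le.2 ⟨?_, ?_⟩)
      · exact (by linarith : -1 ≤ 1 - stepSize η θ T * lam)
      · exact (by linarith : 1 - stepSize η θ T * lam ≤ 1)
    · rw [norm_smul, lossGrad, norm_smul]
      refine mul_le_mul ((Real.norm_of_nonneg (stepSize_nonneg hη T)).trans_le
        (stepSize_le hη hθ T)) (mul_le_mul ?_ ?_ (norm_nonneg _) (by positivity)) (by positivity) hη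
      · exact (abs_sub _ _).trans (add_le_add ((abs_network_le hσ hγ hw hprev hlast.1).trans
          (by gcongr)) hlast.2)
      · exact (norm_gradient_le hσ hγ hw hprev hlast.1).trans (by gcongr)

theorem abs_network_sgd_le (hσ : IsActivation σ C) (hγ : |γ| ≤ 1) (hw : ∀ r, ‖w r‖ ≤ 1)
    (hlam : 0 ≤ lam) (hη : 0 ≤ η) (hθ : 0 ≤ θ) (hηl : η * lam ≤ 1) {z : Fin T → Inp d × ℝ}
    (hz : ∀ i, IsUnitSample (z i)) {T₀ : ℕ} (hT : T ≤ T₀) {x : Inp d} (hx : ‖x‖ ≤ 1) :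
    |network σ γ (sgd σ γ lam η θ (initParams 1 w) T z) x|
      ≤ kappa C * displacementBound C η T₀ + 4 * C * displacementBound C η T₀ ^ 2 := by
  have hmono := displacementBound_mono hσ.pos.le hη hT
  refine (abs_network_le hσ hγ hw
    ((norm_displacement_sgd_le hσ hγ hw hlam hη hθ hηl hz).trans hmono) hx).trans ?_
  gcongr
  exact nonlinearity_le hσ.pos.le m

end LazyTraining

section Kernel

variable {d m : ℕ} {σ : ℝ → ℝ} {C γ : ℝ}

lemma isProbabilityMeasure_sphereUniform (hd : 1 ≤ d) :
    IsProbabilityMeasure (sphereUniform d) := by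
  have : Nonempty (Fin d) := ⟨⟨0, hd⟩⟩
  have hne : (volume : Measure (Inp d)).toSphere Set.univ ≠ 0 := by
    rw [Measure.measure_univ_ne_zero]
    exact Measure.toSphere_ne_zero _
  have : IsProbabilityMeasure (((volume : Measure (Inp d)).toSphere Set.univ)⁻¹
      • (volume : Measure (Inp d)).toSphere) :=
    ⟨by rw [Measure.smul_apply, smul_eq_mul, ENNReal.inv_mul_cancel hne (measure_ne_top _ _)]⟩
  exact Measure.isProbabilityMeasure_map measurable_subtype_coe.aemeasurable

lemma ae_sphereUniform_norm_eq (d : ℕ) : ∀ᵐ b ∂(sphereUniform d), ‖b‖ = 1 := by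
  rw [sphereUniform, ae_map_iff measurable_subtype_coe.aemeasurable
    (measurableSet_eq_fun measurable_norm measurable_const)]
  exact .of_forall fun b => by simp

lemma ae_sphereUniform_norm_le (d : ℕ) : ∀ᵐ b ∂(sphereUniform d), ‖b‖ ≤ 1 :=
  (ae_sphereUniform_norm_eq d).mono fun _ hb => hb.le

lemma integrable_activation_mul (hd : 1 ≤ d) (hσ : IsActivation σ C) (x x' : Inp d) :
    Integrable (fun b => σ (inner ℝ b x) * σ (inner ℝ b x')) (sphereUniform d) := by
  have := isProbabilityMeasure_sphereUniform hd
  have hcont := hσ.continuous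
  have hgrowth (y : Inp d) {b : Inp d} (hb : ‖b‖ = 1) : |σ (inner ℝ b y)| ≤ 1 + ‖y‖ :=
    (hσ.growth _).trans (by simpa [hb] using abs_real_inner_le_norm b y)
  refine Integrable.of_bound (Continuous.aestronglyMeasurable (by fun_prop))
    ((1 + ‖x‖) * (1 + ‖x'‖)) ?_
  filter_upwards [ae_sphereUniform_norm_eq d] with b hb
  rw [Real.norm_eq_abs, abs_mul]
  exact mul_le_mul (hgrowth x hb) (hgrowth x' hb) (abs_nonneg _) (by positivity)

lemma integrable_deriv_activation_mul (hd : 1 ≤ d) (hσ : IsActivation σ C) (x x' : Inp d) :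
    Integrable (fun b => deriv σ (inner ℝ b x) * deriv σ (inner ℝ b x')) (sphereUniform d) := by
  have := isProbabilityMeasure_sphereUniform hd
  have hcont := hσ.continuous_deriv
  refine Integrable.of_bound (Continuous.aestronglyMeasurable (by fun_prop)) (C * C)
    (.of_forall fun b => ?_)
  rw [Real.norm_eq_abs, abs_mul]
  exact mul_le_mul (hσ.deriv_le _) (hσ.deriv_le _) (abs_nonneg _) hσ.pos.le

lemma ntk_eq_integral (hd : 1 ≤ d) (hσ : IsActivation σ C) (x x' : Inp d) :
    ntk σ 1 γ x x' = ∫ b, neuronKernel σ γ b (x, x') ∂(sphereUniform d) := by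
  unfold ntk neuronKernel
  rw [integral_add (integrable_activation_mul hd hσ x x')
    ((integrable_deriv_activation_mul hd hσ x x').const_mul _), integral_const_mul, one_pow,
    one_mul]

lemma ntk_symm (x x' : Inp d) : ntk σ 1 γ x x' = ntk σ 1 γ x' x := by
  unfold ntk
  simp only [mul_comm (σ (inner ℝ _ x)), mul_comm (deriv σ (inner ℝ _ x)), real_inner_comm x x']

lemma measurable_ntk (hd : 1 ≤ d) (hσ : IsActivation σ C) :
    Measurable (Function.uncurry (ntk (d := d) σ 1 γ)) := by
  have := isProbabilityMeasure_sphereUniform hd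
  have hjoint : StronglyMeasurable (Function.uncurry fun (q : Inp d × Inp d) (b : Inp d) =>
      neuronKernel σ γ b q) :=
    ((measurable_neuronKernel hσ).comp measurable_swap).stronglyMeasurable
  have heq : Function.uncurry (ntk (d := d) σ 1 γ)
      = fun q => ∫ b, neuronKernel σ γ b q ∂(sphereUniform d) :=
    funext fun q => ntk_eq_integral hd hσ q.1 q.2
  exact heq ▸ hjoint.integral_prod_right.measurable

lemma abs_ntk_le (hd : 1 ≤ d) (hσ : IsActivation σ C) (hγ : |γ| ≤ 1) {x x' : Inp d}
    (hx : ‖x‖ ≤ 1) (hx' : ‖x'‖ ≤ 1) : |ntk σ 1 γ x x'| ≤ kappa C ^ 2 := by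
  have := isProbabilityMeasure_sphereUniform hd
  have hbound : ∀ᵐ b ∂(sphereUniform d), ‖neuronKernel σ γ b (x, x')‖ ≤ 4 + 2 * C ^ 2 :=
    (ae_sphereUniform_norm_le d).mono fun b hb => abs_neuronKernel_le hσ hγ hb hx hx'
  simpa [ntk_eq_integral hd hσ, kappa_sq] using norm_integral_le_of_norm_le_const hbound

lemma isBoundedKernelOn_ntk (hd : 1 ≤ d) (hσ : IsActivation σ C) (hγ : |γ| ≤ 1) :
    IsBoundedKernelOn (ntk (d := d) σ 1 γ) {x | ‖x‖ ≤ 1} (kappa C ^ 2) :=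
  ⟨measurable_ntk hd hσ, fun _ hx _ hx' => abs_ntk_le hd hσ hγ hx hx'⟩

lemma kernelError_eq (hd : 1 ≤ d) (hσ : IsActivation σ C) (ν : Measure (Inp d))
    (w : Fin m → Inp d) :
    kernelError (ntk σ 1 γ) (initFeature σ γ w) ν
      = ∫ q, deviation (sphereUniform d) (neuronKernel σ γ) w q ^ 2 ∂(ν.prod ν) := by
  refine integral_congr_ae (.of_forall fun q => ?_)
  simp only [ntk_eq_integral hd hσ, inner_initFeature, deviation]
  ring

theorem ofReal_one_sub_le_initLaw_kernelError_le (hd : 1 ≤ d) (hσ : IsActivation σ C) (hγ : |γ| ≤ 1)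
    {ν : Measure (Inp d)} [IsProbabilityMeasure ν] (hν : ∀ᵐ x ∂ν, ‖x‖ ≤ 1) (hm : 1 ≤ m) {δ : ℝ}
    (hδ : 0 < δ) :
    ENNReal.ofReal (1 - δ) ≤ initLaw d m {w | (∀ r, ‖w r‖ ≤ 1) ∧
      kernelError (ntk σ 1 γ) (initFeature σ γ w) ν
        ≤ 4 * (kappa C ^ 2) ^ 2 * Real.log (2 / δ) / m} := by
  have := isProbabilityMeasure_sphereUniform hd
  have hprob : IsProbabilityMeasure (initLaw d m) := by unfold initLaw; infer_instance
  set S : Set (Fin m → Inp d) := {w | (∀ r, ‖w r‖ ≤ 1) ∧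
    kernelError (ntk σ 1 γ) (initFeature σ γ w) ν ≤ 4 * (kappa C ^ 2) ^ 2 * Real.log (2 / δ) / m}
  have hbound : ∀ᵐ q ∂(ν.prod ν), ∀ᵐ b ∂(sphereUniform d),
      |neuronKernel σ γ b q| ≤ kappa C ^ 2 := by
    filter_upwards [Measure.quasiMeasurePreserving_fst.ae hν,
      Measure.quasiMeasurePreserving_snd.ae hν] with q hfst hsnd
    filter_upwards [ae_sphereUniform_norm_le d] with b hb
    exact (abs_neuronKernel_le hσ hγ hb hfst hsnd).trans_eq (kappa_sq C).symm
  have hcompl : initLaw d m Sᶜ ≤ ENNReal.ofReal δ := by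
    refine le_trans (measure_mono_ae ?_) (measure_meanSquare_deviation_le
      (measurable_neuronKernel hσ) (by rw [kappa_sq]; positivity) hbound hm hδ)
    filter_upwards [ae_pi_of_ae (ae_sphereUniform_norm_le d) m] with w hw hwS
    exact lt_of_not_ge fun hsmall => hwS ⟨hw, (kernelError_eq hd hσ ν w).trans_le hsmall⟩
  rw [ENNReal.ofReal_sub _ hδ.le, ENNReal.ofReal_one, tsub_le_iff_right,
    ← measure_univ (μ := initLaw d m), ← Set.union_compl_self S]
  exact (measure_union_le _ _).trans (by gcongr)

end Kernel

section Regression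

variable {d : ℕ} {ρ : Measure (Inp d × ℝ)} [IsProbabilityMeasure ρ]

lemma ae_abs_regression_le (hY : ∀ᵐ z ∂ρ, |z.2| ≤ 1) :
    ∀ᵐ x ∂ρ.fst, |regression ρ x| ≤ 1 := by
  rw [← ρ.disintegrate ρ.condKernel] at hY
  filter_upwards [Measure.ae_ae_of_ae_compProd hY] with x hx
  simpa [regression] using norm_integral_le_of_norm_le_const (f := fun y => y) hx

lemma integral_label_mul (hY : ∀ᵐ z ∂ρ, |z.2| ≤ 1) {f : Inp d → ℝ} (hf : Measurable f) {B : ℝ}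
    (hB : ∀ᵐ x ∂ρ.fst, |f x| ≤ B) :
    ∫ z, z.2 * f z.1 ∂ρ = ∫ x, regression ρ x * f x ∂ρ.fst := by
  have hint : Integrable (fun z : Inp d × ℝ => z.2 * f z.1) ρ := by
    refine Integrable.of_bound (Measurable.aestronglyMeasurable (by fun_prop)) (1 * B) ?_
    filter_upwards [hY, ae_of_ae_map measurable_fst.aemeasurable hB] with z hlabel hfz
    rw [Real.norm_eq_abs, abs_mul]
    gcongr
  conv_lhs => rw [← ρ.disintegrate ρ.condKernel]
  rw [Measure.integral_compProd (by rwa [ρ.disintegrate ρ.condKernel])]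
  simp only [regression, integral_mul_const]

variable {g : Inp d → ℝ} {B : ℝ}

lemma excessRisk_le_of_abs_sub_le (hB : 0 ≤ B)
    (hg : ∀ᵐ x ∂ρ.fst, |g x - regression ρ x| ≤ B) :
    excessRisk ρ g ≤ ENNReal.ofReal (B ^ 2) := by
  rw [excessRisk, ENNReal.ofReal_pow hB]
  gcongr
  simpa using eLpNorm_le_of_ae_bound (p := 2) (f := fun x => g x - regression ρ x) hg

lemma excessRisk_le_add {F G : Lp ℝ 2 ρ.fst} (hF : F =ᵐ[ρ.fst] regression ρ) (hg : Continuous g)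
    (hB : 0 ≤ B) (hgG : ∀ᵐ x ∂ρ.fst, |g x - G x| ≤ B) :
    excessRisk ρ g ≤ ENNReal.ofReal (2 * B ^ 2 + 2 * ‖G - F‖ ^ 2) := by
  have hclose : eLpNorm (fun x => g x - G x) 2 ρ.fst ≤ ENNReal.ofReal B := by
    simpa using eLpNorm_le_of_ae_bound (p := 2) (f := fun x => g x - G x) hgG
  have hnorm : eLpNorm (fun x => G x - F x) 2 ρ.fst = ENNReal.ofReal ‖G - F‖ := by
    rw [ofReal_norm, Lp.enorm_def]
    exact eLpNorm_congr_ae (Lp.coeFn_sub G F).symm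
  have htriangle : eLpNorm (fun x => g x - regression ρ x) 2 ρ.fst
      ≤ ENNReal.ofReal (B + ‖G - F‖) := by
    have hG := Lp.aestronglyMeasurable G
    calc eLpNorm (fun x => g x - regression ρ x) 2 ρ.fst
        = eLpNorm ((fun x => g x - G x) + fun x => G x - F x) 2 ρ.fst := by
          refine eLpNorm_congr_ae ?_
          filter_upwards [hF] with x hx
          simp [hx]
      _ ≤ _ := eLpNorm_add_le (hg.aestronglyMeasurable.sub hG)
        (hG.sub (Lp.aestronglyMeasurable F)) one_le_two
      _ ≤ ENNReal.ofReal B + ENNReal.ofReal ‖G - F‖ := by rw [hnorm]; gcongr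
      _ = _ := (ENNReal.ofReal_add hB (norm_nonneg _)).symm
  calc excessRisk ρ g ≤ ENNReal.ofReal (B + ‖G - F‖) ^ 2 := by rw [excessRisk]; gcongr
    _ = ENNReal.ofReal ((B + ‖G - F‖) ^ 2) := (ENNReal.ofReal_pow (by positivity) 2).symm
    _ ≤ _ := ENNReal.ofReal_le_ofReal (by linarith [add_sq_le (a := B) (b := ‖G - F‖)])

end Regression

section WideNetwork

variable {d m : ℕ} {σ : ℝ → ℝ} {C γ lam η θ : ℝ} {T : ℕ}

lemma continuous_network (hσ : IsActivation σ C) (Θ : Params d m) :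
    Continuous (network σ γ Θ) := by
  have := hσ.continuous
  unfold network
  fun_prop

lemma nonlinearity_mul_inv_sqrt_pow_le (hC : 0 ≤ C) (hlam : 0 < lam) (hlam1 : lam ≤ 1)
    (hT : 1 ≤ T) (hTm : (T : ℝ) ≤ 2 * m * lam ^ 5) {i : ℕ} (hi : i ≤ 5) :
    nonlinearity C m * (√lam)⁻¹ ^ i ≤ 4 * C / √T := by
  have hε := nonlinearity_nonneg hC m
  have hq : 0 < √lam := Real.sqrt_pos.2 hlam
  have hqle : 1 ≤ (√lam)⁻¹ := (one_le_inv₀ hq).2 (Real.sqrt_le_one.2 hlam1)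
  have hsqrt : √T ≤ √(2 * m) * √lam ^ 5 := by
    refine Real.sqrt_le_iff.2 ⟨by positivity, hTm.trans_eq ?_⟩
    rw [mul_pow, Real.sq_sqrt (by positivity), ← pow_mul, mul_comm 5 2, pow_mul,
      Real.sq_sqrt hlam.le]
  have : 0 < √(T : ℝ) := Real.sqrt_pos.2 (by exact_mod_cast hT)
  calc nonlinearity C m * (√lam)⁻¹ ^ i ≤ nonlinearity C m * (√lam)⁻¹ ^ 5 := by gcongr
    _ = 4 * C / (√(2 * m) * √lam ^ 5) := by
      rw [nonlinearity, inv_pow, ← div_eq_mul_inv, div_div]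
    _ ≤ 4 * C / √T := by gcongr

/-- The constant in the distance of the trained network to its linearization. -/
def linearizationConst (C : ℝ) : ℝ := 16 * C + kappa C * (4 * C * driftConst C)

lemma linearizationConst_nonneg (hC : 0 ≤ C) : 0 ≤ linearizationConst C := by
  have := kappa_nonneg C
  have := driftConst_nonneg hC
  rw [linearizationConst]
  positivity

variable {w : Fin m → Inp d} {z : Fin T → Inp d × ℝ}

lemma norm_displacement_sub_linSgd_le_div_sqrt (hσ : IsActivation σ C) (hγ : |γ| ≤ 1)
    (hw : ∀ r, ‖w r‖ ≤ 1) (hlam : 0 < lam) (hlam1 : lam ≤ 1) (hη : 0 ≤ η) (hθ : 0 ≤ θ)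
    (hηl : η * (lam + kappa C ^ 2) ≤ 1) (hT : 1 ≤ T) (hCT : 4 * C * driftConst C ≤ √T)
    (hTm : (T : ℝ) ≤ 2 * m * lam ^ 5) (hz : ∀ i, IsUnitSample (z i)) :
    ‖displacement (initParams 1 w) (sgd σ γ lam η θ (initParams 1 w) T z)
        - linSgd (initFeature σ γ w) lam (stepSize η θ) T z‖
      ≤ 4 * C * driftConst C / √T := by
  have hdrift := driftConst_nonneg hσ.pos.le
  have hB : 1 ≤ (√lam)⁻¹ := (one_le_inv₀ (Real.sqrt_pos.2 hlam)).2 (Real.sqrt_le_one.2 hlam1)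
  have hlamB : lam * (√lam)⁻¹ ^ 2 = 1 := by
    rw [inv_pow, Real.sq_sqrt hlam.le, mul_inv_cancel₀ hlam.ne']
  have hBm : (√lam)⁻¹ ^ 2 ≤ 2 * m := by
    have hT1 : (1 : ℝ) ≤ T := by exact_mod_cast hT
    refine le_of_mul_le_mul_left (hlamB.trans_le (hT1.trans (hTm.trans ?_))) hlam
    rw [mul_comm lam]
    exact mul_le_mul_of_nonneg_left (pow_le_of_le_one hlam.le hlam1 (by norm_num)) (by positivity)
  have hgap : driftConst C * nonlinearity C m * (√lam)⁻¹ ^ 4 ≤ 4 * C * driftConst C / √T :=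
    calc _ = driftConst C * (nonlinearity C m * (√lam)⁻¹ ^ 4) := mul_assoc _ _ _
      _ ≤ driftConst C * (4 * C / √T) := by
        gcongr
        exact nonlinearity_mul_inv_sqrt_pow_le hσ.pos.le hlam hlam1 hT hTm (by norm_num)
      _ = _ := by ring
  exact (norm_displacement_sub_linSgd_le hσ hγ hw hB hBm hlamB hη hθ hηl
    (hgap.trans ((div_le_one_of_le₀ hCT (Real.sqrt_nonneg _)).trans hB)) hz).trans hgap

lemma norm_displacement_sgd_le_two_mul_inv_sqrt (hσ : IsActivation σ C) (hγ : |γ| ≤ 1)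
    (hw : ∀ r, ‖w r‖ ≤ 1) (hlam : 0 < lam) (hlam1 : lam ≤ 1) (hη : 0 ≤ η) (hθ : 0 ≤ θ)
    (hηl : η * (lam + kappa C ^ 2) ≤ 1) (hT : 1 ≤ T) (hCT : 4 * C * driftConst C ≤ √T)
    (hTm : (T : ℝ) ≤ 2 * m * lam ^ 5) (hz : ∀ i, IsUnitSample (z i)) :
    ‖displacement (initParams 1 w) (sgd σ γ lam η θ (initParams 1 w) T z)‖ ≤ 2 * (√lam)⁻¹ := by
  set v := displacement (initParams 1 w) (sgd σ γ lam η θ (initParams 1 w) T z)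
  set u := linSgd (initFeature σ γ w) lam (stepSize η θ) T z
  have hvu : ‖v - u‖ ≤ (√lam)⁻¹ :=
    (norm_displacement_sub_linSgd_le_div_sqrt hσ hγ hw hlam hlam1 hη hθ hηl hT hCT hTm hz).trans
      ((div_le_one_of_le₀ hCT (Real.sqrt_nonneg _)).trans
        ((one_le_inv₀ (Real.sqrt_pos.2 hlam)).2 (Real.sqrt_le_one.2 hlam1)))
  have hu : ‖u‖ ≤ (√lam)⁻¹ := by
    refine le_of_sq_le_sq ((norm_linSgd_sq_le (stepSize_nonneg hη) hlam
      (stepSize_mul_le_one hη hθ (by positivity) hηl)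
      (fun i => norm_initFeature_le hσ hγ hw (hz i).1) fun i => (hz i).2).trans_eq ?_)
      (by positivity)
    rw [inv_pow, Real.sq_sqrt hlam.le, one_div]
  calc ‖v‖ = ‖(v - u) + u‖ := by rw [sub_add_cancel]
    _ ≤ ‖v - u‖ + ‖u‖ := norm_add_le _ _
    _ ≤ 2 * (√lam)⁻¹ := by linarith

theorem abs_network_sgd_sub_linear_le (hσ : IsActivation σ C) (hγ : |γ| ≤ 1)
    (hw : ∀ r, ‖w r‖ ≤ 1) (hlam : 0 < lam) (hlam1 : lam ≤ 1) (hη : 0 ≤ η) (hθ : 0 ≤ θ)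
    (hηl : η * (lam + kappa C ^ 2) ≤ 1) (hT : 1 ≤ T) (hCT : 4 * C * driftConst C ≤ √T)
    (hTm : (T : ℝ) ≤ 2 * m * lam ^ 5) (hz : ∀ i, IsUnitSample (z i)) {x : Inp d}
    (hx : ‖x‖ ≤ 1) :
    |network σ γ (sgd σ γ lam η θ (initParams 1 w) T z) x
        - inner ℝ (initFeature σ γ w x) (linSgd (initFeature σ γ w) lam (stepSize η θ) T z)|
      ≤ linearizationConst C / √T := by
  have hε := nonlinearity_nonneg hσ.pos.le m
  have hv := norm_displacement_sgd_le_two_mul_inv_sqrt hσ hγ hw hlam hlam1 hη hθ hηl hT hCT hTm hz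
  have hvu := norm_displacement_sub_linSgd_le_div_sqrt hσ hγ hw hlam hlam1 hη hθ hηl hT hCT hTm hz
  set v := displacement (initParams 1 w) (sgd σ γ lam η θ (initParams 1 w) T z)
  set u := linSgd (initFeature σ γ w) lam (stepSize η θ) T z
  have hnonlinear : nonlinearity C m * ‖v‖ ^ 2 ≤ 16 * C / √T :=
    calc _ ≤ nonlinearity C m * (2 * (√lam)⁻¹) ^ 2 := by gcongr
      _ = 4 * (nonlinearity C m * (√lam)⁻¹ ^ 2) := by ring
      _ ≤ 4 * (4 * C / √T) := by
        gcongr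
        exact nonlinearity_mul_inv_sqrt_pow_le hσ.pos.le hlam hlam1 hT hTm (by norm_num)
      _ = _ := by ring
  have hlinear : |inner ℝ (initFeature σ γ w x) (v - u)|
      ≤ kappa C * (4 * C * driftConst C / √T) :=
    (abs_real_inner_le_norm _ _).trans (mul_le_mul (norm_initFeature_le hσ hγ hw hx) hvu
      (norm_nonneg _) (kappa_nonneg C))
  rw [inner_sub_right] at hlinear
  calc _ ≤ _ := abs_sub_le _ (inner ℝ (initFeature σ γ w x) v) _
    _ ≤ 16 * C / √T + kappa C * (4 * C * driftConst C / √T) :=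
      add_le_add ((abs_network_sub_inner_le hσ hγ w _ hx).trans hnonlinear) hlinear
    _ = _ := by rw [linearizationConst]; ring

end WideNetwork

section Rates

variable {r lam l K : ℝ}

lemma sq_le_rpow_two_mul (hr1 : r ≤ 1) (hlam : 0 < lam) (hlam1 : lam ≤ 1) :
    lam ^ 2 ≤ lam ^ (2 * r) := by
  rw [← Real.rpow_natCast]
  exact Real.rpow_le_rpow_of_exponent_ge hlam hlam1 (by push_cast; linarith)

lemma sq_div_sq_le {D : ℝ} (hlam : 0 < lam) (hD : D ^ 2 ≤ K * l * lam ^ 2) :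
    (D / lam) ^ 2 ≤ K * l := by
  rwa [div_pow, div_le_iff₀ (by positivity)]

lemma bias_sq_le {D H W : ℝ} (hlam : 0 < lam) (hl : 1 / 2 ≤ l) (hD : D ^ 2 ≤ K * l * lam ^ 2)
    (hW0 : 0 ≤ W) (hW : W ≤ lam ^ r * H * (1 + D / lam)) :
    W ^ 2 ≤ 2 * H ^ 2 * (2 + K) * (lam ^ (2 * r) * l) := by
  have hrel : (1 + D / lam) ^ 2 ≤ 2 * (2 + K) * l := by
    linarith [sq_div_sq_le hlam hD, sq_nonneg (1 - D / lam)]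
  calc W ^ 2 ≤ (lam ^ r * H * (1 + D / lam)) ^ 2 := by gcongr
    _ = lam ^ (2 * r) * H ^ 2 * (1 + D / lam) ^ 2 := by
        rw [mul_pow, mul_pow, mul_comm 2 r, Real.rpow_mul hlam.le, Real.rpow_two]
    _ ≤ lam ^ (2 * r) * H ^ 2 * (2 * (2 + K) * l) := by gcongr
    _ = 2 * H ^ 2 * (2 + K) * (lam ^ (2 * r) * l) := by ring

lemma minimizer_sq_le {B D H U : ℝ} (hr : 1 / 2 ≤ r) (hlam : 0 < lam) (hlam1 : lam ≤ 1)
    (hl : 1 / 2 ≤ l) (hB : 0 ≤ B) (hD0 : 0 ≤ D) (hD : D ^ 2 ≤ K * l * lam ^ 2)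
    (hU : U ≤ 2 * (B + D * (lam ^ (r - 1)) ^ 2) * H ^ 2
      + 2 * D ^ 2 * (lam ^ (r - 1)) ^ 2 * H ^ 2 / lam) :
    U ≤ 2 * l * (2 * H ^ 2 * (B + 1 + K)) := by
  have hpow : (lam ^ (r - 1)) ^ 2 ≤ 1 / lam := by
    rw [← Real.rpow_natCast, ← Real.rpow_mul hlam.le, one_div, ← Real.rpow_neg_one]
    exact Real.rpow_le_rpow_of_exponent_ge hlam hlam1 (by push_cast; linarith)
  have hrel := sq_div_sq_le hlam hD
  calc U ≤ 2 * (B + D * (lam ^ (r - 1)) ^ 2) * H ^ 2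
        + 2 * D ^ 2 * (lam ^ (r - 1)) ^ 2 * H ^ 2 / lam := hU
    _ ≤ 2 * (B + D * (1 / lam)) * H ^ 2 + 2 * D ^ 2 * (1 / lam) * H ^ 2 / lam := by gcongr
    _ = 2 * H ^ 2 * (B + D / lam + (D / lam) ^ 2) := by field_simp
    _ ≤ 2 * H ^ 2 * (2 * l * (B + 1 + K)) := by
        gcongr
        nlinarith [sq_nonneg (1 - D / lam)]
    _ = 2 * l * (2 * H ^ 2 * (B + 1 + K)) := by ring

lemma noiseFactor_le_mul {V U s c : ℝ} (hV : 0 ≤ V) (hs : 1 ≤ s) (κ : ℝ) (hU : U ≤ s * c) :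
    noiseFactor κ V U ≤ s * noiseFactor κ V c :=
  calc noiseFactor κ V U ≤ noiseFactor κ V (s * c) := by
        unfold noiseFactor
        gcongr
    _ = s * noiseFactor κ V c - (s - 1) * (2 + 16 * κ ^ 4 * V) := by
        unfold noiseFactor
        ring
    _ ≤ s * noiseFactor κ V c :=
        sub_le_self _ (mul_nonneg (sub_nonneg.2 hs) (by positivity))

lemma noiseFactor_nonneg {κ V U : ℝ} (hV : 0 ≤ V) (hU : 0 ≤ U) : 0 ≤ noiseFactor κ V U := by
  unfold noiseFactor
  positivity

/-- The constant of the risk bound for stochastic gradient descent in a linear model whose kernel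
error is `K l lam⁵`, when the source function has norm `H`, the constant `B` bounds the powers
`μᵢ ^ (2 r - 1)`, and the early noise is at most `c` times the rate plus the kernel error. -/
def linearRiskConst (κ V η H B K c : ℝ) : ℝ :=
  (8 / η ^ 2 + 2) * (2 * H ^ 2 * (2 + K))
    + 2 * (V * c * (2 * noiseFactor κ V (2 * H ^ 2 * (B + 1 + K)) + noiseFactor κ V 1 * K)
      + 4 * η * κ ^ 2 * noiseFactor κ V (2 * H ^ 2 * (B + 1 + K)))

variable {κ V η H B c : ℝ}

lemma linearRiskConst_nonneg (hV : 0 ≤ V) (hη : 0 ≤ η) (hB : 0 ≤ B) (hK : 0 ≤ K) (hc : 0 ≤ c) :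
    0 ≤ linearRiskConst κ V η H B K c := by
  have := noiseFactor_nonneg (κ := κ) hV (show 0 ≤ 2 * H ^ 2 * (B + 1 + K) by positivity)
  have := noiseFactor_nonneg (κ := κ) hV zero_le_one
  unfold linearRiskConst
  positivity

-- The noise factor is bounded in two ways: by a multiple of `l` in front of the rate, and by the
-- crude `1 / lam` in front of the kernel error, which is of higher order in `lam`.
lemma linearRisk_le {D U W E τ Q : ℝ} (hr : 1 / 2 ≤ r) (hr1 : r ≤ 1) (hlam : 0 < lam)
    (hlam1 : lam ≤ 1) (hl : 1 / 2 ≤ l) (hV : 0 ≤ V) (hη : 0 ≤ η) (hB : 0 ≤ B) (hc : 0 ≤ c)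
    (hK : 0 ≤ K) (hD0 : 0 ≤ D) (hD : D ^ 2 ≤ Q) (hQ : Q ≤ K * l * lam ^ 5)
    (hW0 : 0 ≤ W) (hW : W ≤ lam ^ r * H * (1 + D / lam)) (hU0 : 0 ≤ U) (hU1 : U ≤ 1 / lam)
    (hU : U ≤ 2 * (B + D * (lam ^ (r - 1)) ^ 2) * H ^ 2
      + 2 * D ^ 2 * (lam ^ (r - 1)) ^ 2 * H ^ 2 / lam)
    (hE : E ≤ c * (lam ^ (2 * r) + Q)) (hτ : τ ≤ lam ^ (2 * r)) :
    (8 / η ^ 2 + 2) * W ^ 2 + 2 * noiseFactor κ V U * (V * E + 2 * η * τ * κ ^ 2)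
      ≤ linearRiskConst κ V η H B K c * (lam ^ (2 * r) * l) := by
  have : 0 ≤ l := by linarith
  have hD' : D ^ 2 ≤ K * l * lam ^ 2 := (hD.trans hQ).trans <| by
    gcongr ?_ * ?_
    exact pow_le_pow_of_le_one hlam.le hlam1 (by norm_num)
  have hU' := minimizer_sq_le hr hlam hlam1 hl hB hD0 hD' hU
  have hbias := bias_sq_le hlam hl hD' hW0 hW
  have hrate := sq_le_rpow_two_mul hr1 hlam hlam1
  set R := lam ^ (2 * r)
  set N₀ := noiseFactor κ V (2 * H ^ 2 * (B + 1 + K)) with hN₀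
  set N₁ := noiseFactor κ V 1 with hN₁
  have hN₁0 : 0 ≤ N₁ := noiseFactor_nonneg hV zero_le_one
  have hN0 : 0 ≤ noiseFactor κ V U := noiseFactor_nonneg hV hU0
  have : 0 ≤ R := (sq_nonneg lam).trans hrate
  have hNR : noiseFactor κ V U * R ≤ 2 * N₀ * (R * l) :=
    calc noiseFactor κ V U * R ≤ 2 * l * N₀ * R := by
          gcongr
          exact noiseFactor_le_mul hV (by linarith) κ hU'
      _ = 2 * N₀ * (R * l) := by ring
  have hNQ : noiseFactor κ V U * Q ≤ N₁ * K * (R * l) :=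
    calc noiseFactor κ V U * Q ≤ 1 / lam * N₁ * (K * l * lam ^ 5) := by
          gcongr
          · exact (sq_nonneg D).trans hD
          · exact noiseFactor_le_mul hV ((one_le_div hlam).2 hlam1) κ (by rwa [mul_one])
      _ = N₁ * K * (lam ^ 4 * l) := by field_simp
      _ ≤ N₁ * K * (R * l) := by
          gcongr
          exact (pow_le_pow_of_le_one hlam.le hlam1 (by norm_num)).trans hrate
  calc (8 / η ^ 2 + 2) * W ^ 2 + 2 * noiseFactor κ V U * (V * E + 2 * η * τ * κ ^ 2)
      ≤ (8 / η ^ 2 + 2) * (2 * H ^ 2 * (2 + K) * (R * l))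
        + 2 * noiseFactor κ V U * (V * (c * (R + Q)) + 2 * η * R * κ ^ 2) := by gcongr
    _ = (8 / η ^ 2 + 2) * (2 * H ^ 2 * (2 + K) * (R * l))
        + 2 * (V * c * (noiseFactor κ V U * R + noiseFactor κ V U * Q)
          + 2 * η * κ ^ 2 * (noiseFactor κ V U * R)) := by ring
    _ ≤ (8 / η ^ 2 + 2) * (2 * H ^ 2 * (2 + K) * (R * l))
        + 2 * (V * c * (2 * N₀ * (R * l) + N₁ * K * (R * l))
          + 2 * η * κ ^ 2 * (2 * N₀ * (R * l))) := by gcongr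
    _ = linearRiskConst κ V η H B K c * (R * l) := by
        rw [linearRiskConst, ← hN₀, ← hN₁]
        ring

end Rates

section NoiseControl

variable {μ : ℕ → ℝ} {r lam η θ c : ℝ} {T : ℕ}

/-- The two ways of keeping the early noise below the rate `lam ^ (2 r)`: it is forgotten
exponentially fast, or the regularization is tuned to the step sizes and the effective dimension
of the eigenvalues `μ` is small enough. -/
def NoiseControlled (μ : ℕ → ℝ) (r lam η θ c : ℝ) (T : ℕ) : Prop :=
  Real.exp (-(lam * (η * (T : ℝ) ^ (1 - θ)))) ≤ c * lam ^ (2 * r) ∨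
    ((T : ℝ) ^ (1 - θ) = 1 / lam ∧
      ∃ N, HasSum (fun i => (μ i / (μ i + lam)) ^ 2) N ∧ lam ^ 2 * N ≤ c * lam ^ (2 * r))

lemma earlyNoise_le_of_noiseControlled {ι : Type*} [Fintype ι] {ev : ι → ℝ} {κ Q : ℝ}
    (hlam : 0 < lam) (hη : 0 < η) (hc : 0 ≤ c) (hQ : 0 ≤ Q) (hev : ∀ i, 0 ≤ ev i)
    (htr : ∑ i, ev i ≤ κ ^ 2) (hnoise : NoiseControlled μ r lam η θ c T)
    (hdim : ∀ N, HasSum (fun i => (μ i / (μ i + lam)) ^ 2) N →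
      ∑ i, (ev i / (ev i + lam)) ^ 2 ≤ 2 * N + 2 / lam ^ 2 * Q) :
    earlyNoise η θ lam T ev ≤ (κ ^ 4 + 4 / η ^ 2) * (c + 1) * (lam ^ (2 * r) + Q) := by
  have hR : 0 < lam ^ (2 * r) := Real.rpow_pos_of_pos hlam _
  have hcR : c * lam ^ (2 * r) + Q ≤ (c + 1) * (lam ^ (2 * r) + Q) := by
    linarith [mul_nonneg hc hQ]
  rcases hnoise with hexp | ⟨hT, N, hN, hNle⟩
  · calc earlyNoise η θ lam T ev
        ≤ κ ^ 4 * Real.exp (-(lam * (η * (T : ℝ) ^ (1 - θ)))) := earlyNoise_le_exp hev htr hη.le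
      _ ≤ (κ ^ 4 + 4 / η ^ 2) * ((c + 1) * (lam ^ (2 * r) + Q)) := by
          gcongr
          · exact le_add_of_nonneg_right (by positivity)
          · linarith
      _ = (κ ^ 4 + 4 / η ^ 2) * (c + 1) * (lam ^ (2 * r) + Q) := by ring
  · calc earlyNoise η θ lam T ev
        ≤ 2 / η ^ 2 * lam ^ 2 * ∑ i, (ev i / (ev i + lam)) ^ 2 :=
          earlyNoise_le_effectiveDim hev hlam hη hT
      _ ≤ 2 / η ^ 2 * lam ^ 2 * (2 * N + 2 / lam ^ 2 * Q) := by
          gcongr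
          exact hdim N hN
      _ = 4 / η ^ 2 * (lam ^ 2 * N + Q) := by
          field_simp
          ring
      _ ≤ (κ ^ 4 + 4 / η ^ 2) * ((c + 1) * (lam ^ (2 * r) + Q)) := by
          refine mul_le_mul ?_ (by linarith) (add_nonneg ?_ hQ) (by positivity)
          · exact le_add_of_nonneg_left (by positivity)
          · exact mul_nonneg (sq_nonneg lam) (hN.nonneg fun i => sq_nonneg _)
      _ = (κ ^ 4 + 4 / η ^ 2) * (c + 1) * (lam ^ (2 * r) + Q) := by ring

end NoiseControl

section EffectiveDimension

variable {μ : ℕ → ℝ}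

lemma sq_div_add_le_rpow {x lam s : ℝ} (hx : 0 ≤ x) (hlam : 0 < lam) (hs0 : 0 ≤ s)
    (hs2 : s ≤ 2) : (x / (x + lam)) ^ 2 ≤ lam ^ (-s) * x ^ s := by
  have hpos : 0 < x + lam := by linarith
  have hratio : 0 ≤ x / (x + lam) := div_nonneg hx hpos.le
  calc (x / (x + lam)) ^ 2 = (x / (x + lam)) ^ (2 : ℝ) := (Real.rpow_two _).symm
    _ ≤ (x / (x + lam)) ^ s :=
        Real.rpow_le_rpow_of_exponent_ge_of_imp hratio
          ((div_le_one hpos).2 (by linarith)) hs2 fun _ h => absurd h two_ne_zero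
    _ ≤ (x / lam) ^ s :=
        Real.rpow_le_rpow hratio (div_le_div_of_nonneg_left hx hlam (by linarith)) hs0
    _ = lam ^ (-s) * x ^ s := by
        rw [Real.div_rpow hx hlam.le, Real.rpow_neg hlam.le, div_eq_inv_mul]

theorem exists_hasSum_effectiveDim {lam s : ℝ} (hμ : ∀ i, 0 ≤ μ i) (hlam : 0 < lam)
    (hs0 : 0 ≤ s) (hs2 : s ≤ 2) (hsum : Summable fun i => μ i ^ s) :
    ∃ N, HasSum (fun i => (μ i / (μ i + lam)) ^ 2) N ∧
      lam ^ 2 * N ≤ (∑' i, μ i ^ s) * lam ^ (2 - s) := by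
  have hle : ∀ i, (μ i / (μ i + lam)) ^ 2 ≤ lam ^ (-s) * μ i ^ s := fun i =>
    sq_div_add_le_rpow (hμ i) hlam hs0 hs2
  have hsum' := hsum.mul_left (lam ^ (-s))
  have hN := Summable.of_nonneg_of_le (fun i => sq_nonneg _) hle hsum'
  refine ⟨_, hN.hasSum, ?_⟩
  calc lam ^ 2 * ∑' i, (μ i / (μ i + lam)) ^ 2
      ≤ lam ^ 2 * ∑' i, lam ^ (-s) * μ i ^ s :=
        mul_le_mul_of_nonneg_left (hN.tsum_le_tsum hle hsum') (sq_nonneg lam)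
    _ = (∑' i, μ i ^ s) * lam ^ (2 - s) := by
        rw [tsum_mul_left, sub_eq_add_neg, Real.rpow_add hlam, Real.rpow_two]
        ring

theorem summable_rpow_of_polynomialDecay {β s : ℝ} (hμ : ∀ i, 0 ≤ μ i)
    (hdecay : PolynomialDecay μ β) (hs : 0 ≤ s) (hβs : 1 < β * s) :
    Summable fun i => μ i ^ s := by
  obtain ⟨_, _, c, hc, hle⟩ := hdecay
  have hsum : Summable fun i : ℕ => c ^ s * ((i : ℝ) + 1) ^ (-(β * s)) := by
    have := (summable_nat_add_iff 1).2 (Real.summable_nat_rpow.2 (by linarith : -(β * s) < -1))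
    exact Summable.mul_left _ (by simpa using this)
  refine Summable.of_nonneg_of_le (fun i => Real.rpow_nonneg (hμ i) _) (fun i => ?_) hsum
  calc μ i ^ s ≤ (c * ((i : ℝ) + 1) ^ (-β)) ^ s := Real.rpow_le_rpow (hμ i) (hle i).2 hs
    _ = c ^ s * ((i : ℝ) + 1) ^ (-(β * s)) := by
        rw [Real.mul_rpow hc.le (by positivity), ← Real.rpow_mul (by positivity), neg_mul]

end EffectiveDimension

section StepBound

variable {C lam θ η : ℝ}

lemma two_mul_kappa_sq_le (hθ : 1 / 2 < θ) (hθ1 : θ < 1) :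
    2 * kappa C ^ 2 ≤ 208 * (1 + kappa C) ^ 4 / ((1 - 2 ^ (θ - 1)) * (2 * θ - 1))
      * (Real.log (8 / (1 - θ)) + 1 / (1 - θ)) := by
  have hκ := kappa_nonneg C
  have hpow : (2 : ℝ) ^ (θ - 1) < 1 :=
    Real.rpow_lt_one_of_one_lt_of_neg one_lt_two (by linarith)
  have hden0 : 0 < (1 - (2 : ℝ) ^ (θ - 1)) * (2 * θ - 1) :=
    mul_pos (by linarith) (by linarith)
  have hden1 : (1 - (2 : ℝ) ^ (θ - 1)) * (2 * θ - 1) ≤ 1 :=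
    mul_le_one₀ (sub_le_self _ (by positivity)) (by linarith) (by linarith)
  have hlog : 1 ≤ Real.log (8 / (1 - θ)) + 1 / (1 - θ) :=
    le_add_of_nonneg_of_le (Real.log_nonneg ((one_le_div (by linarith)).2 (by linarith)))
      ((one_le_div (by linarith)).2 (by linarith))
  calc 2 * kappa C ^ 2 ≤ 208 * (1 + kappa C) ^ 4 := by
        have : kappa C ^ 2 ≤ (1 + kappa C) ^ 4 :=
          (pow_le_pow_left₀ hκ (by linarith) 2).trans
            (pow_le_pow_right₀ (by linarith) (by norm_num))
        linarith [sq_nonneg (kappa C)]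
    _ ≤ 208 * (1 + kappa C) ^ 4 / ((1 - 2 ^ (θ - 1)) * (2 * θ - 1)) :=
        le_div_self (by positivity) hden0 hden1
    _ ≤ _ := le_mul_of_one_le_right (by positivity) hlog

theorem mul_le_one_of_lt_stepBound (hlam : 0 < lam) (hθ : 1 / 2 < θ) (hθ1 : θ < 1)
    (hη : η < stepBound C lam θ) : η * (lam + 2 * kappa C ^ 2) ≤ 1 := by
  have hpos : 0 < lam + 2 * kappa C ^ 2 := by positivity
  rw [← le_div_iff₀ hpos, one_div]
  refine hη.le.trans ?_
  have hle := two_mul_kappa_sq_le (C := C) hθ hθ1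
  unfold kappa at hle hpos ⊢
  exact inv_anti₀ hpos (by linarith)

end StepBound

section KernelRegression

open ContinuousLinearMap (adjoint)

lemma norm_sq_adjoint_ridge_le {H K : Type*} [NormedAddCommGroup H] [InnerProductSpace ℝ H]
    [FiniteDimensional ℝ H] [NormedAddCommGroup K] [InnerProductSpace ℝ K] [CompleteSpace K]
    {A : H →L[ℝ] K} {lam : ℝ} (hlam : 0 < lam) {w F : K}
    (hw : (A ∘L adjoint A) w + lam • w = F) : ‖adjoint A w‖ ^ 2 ≤ ‖F‖ ^ 2 / lam := by
  rw [← real_inner_self_eq_norm_sq, ← inner_comp_adjoint]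
  exact inner_ridge_le_div inner_comp_adjoint_self_nonneg hlam hw

/-- The operator form of `IsEigensystem`: `(μ, φ)` is an orthonormal eigensystem of `L` with
non-ascending eigenvalues, complete up to the kernel of `L`. -/
structure IsEigensystemOf {K : Type*} [NormedAddCommGroup K] [InnerProductSpace ℝ K]
    (L : K →L[ℝ] K) (μ : ℕ → ℝ) (φ : ℕ → K) : Prop where
  antitone : Antitone μ
  nonneg : ∀ i, 0 ≤ μ i
  orthonormal : Orthonormal ℝ φ
  eigen : ∀ i, L (φ i) = μ i • φ i
  complete : ∀ f, (∀ i, inner ℝ (φ i) f = 0) → L f = 0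

lemma IsEigensystem.isEigensystemOf {d : ℕ} {k : Inp d → Inp d → ℝ} {ν : Measure (Inp d)}
    {μ : ℕ → ℝ} {φ : ℕ → Lp ℝ 2 ν} {L : Lp ℝ 2 ν →L[ℝ] Lp ℝ 2 ν} (h : IsEigensystem k ν μ φ)
    (hL : IsIntegralOperator k L) : IsEigensystemOf L μ φ where
  antitone := h.antitone
  nonneg := h.nonneg
  orthonormal := h.orthonormal
  eigen i := by
    refine Lp.ext ?_
    filter_upwards [hL (φ i), h.eigen i, Lp.coeFn_smul (μ i) (φ i)] with x hLx hx hsmul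
    rw [hLx, hsmul]
    exact hx
  complete f hf := by
    refine Lp.ext ?_
    filter_upwards [hL f, h.complete f hf, Lp.coeFn_zero ℝ 2 ν] with x hLx hx hzero
    rw [hLx, hzero]
    exact hx

variable {X : Type*} [MeasurableSpace X] {H : Type*} [NormedAddCommGroup H]
  [InnerProductSpace ℝ H] [FiniteDimensional ℝ H] [MeasurableSpace H] [BorelSpace H]
  {Φ : X → H} {k : X → X → ℝ} {s : Set X} {κ a : ℝ} {μ : ℕ → ℝ}

section Ridge

variable {ν : Measure X} [IsProbabilityMeasure ν] {A : H →L[ℝ] Lp ℝ 2 ν}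
  {L : Lp ℝ 2 ν →L[ℝ] Lp ℝ 2 ν} {φ : ℕ → Lp ℝ 2 ν} {lam : ℝ}

lemma isIntegralOperator_sub_covariance (hΦ : Measurable Φ) (hs : ∀ᵐ x ∂ν, x ∈ s)
    (hκ : ∀ x ∈ s, ‖Φ x‖ ≤ κ) (hA : IsFeatureOperator Φ A) (hk : IsBoundedKernelOn k s a)
    (hL : IsIntegralOperator k L) :
    IsIntegralOperator (fun x x' => k x x' - inner ℝ (Φ x) (Φ x')) (L - A ∘L adjoint A) :=
  hL.sub hA.isIntegralOperator_comp_adjoint hk (isBoundedKernelOn_inner hΦ hκ) hs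

lemma sum_effectiveDim_le_kernelError (hΦ : Measurable Φ) (hs : ∀ᵐ x ∂ν, x ∈ s)
    (hκ : ∀ x ∈ s, ‖Φ x‖ ≤ κ) (hA : IsFeatureOperator Φ A) (hk : IsBoundedKernelOn k s a)
    (hsymm : ∀ x x', k x x' = k x' x) (hL : IsIntegralOperator k L)
    (hμφ : IsEigensystemOf L μ φ) {ι : Type*} [Fintype ι] {e : OrthonormalBasis ι ℝ H}
    {ev : ι → ℝ} (he : ∀ i, adjoint A (A (e i)) = ev i • e i) (hev : ∀ i, 0 ≤ ev i)
    (hlam : 0 < lam) {N : ℝ} (hN : HasSum (fun i => (μ i / (μ i + lam)) ^ 2) N) :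
    ∑ i, (ev i / (ev i + lam)) ^ 2 ≤ 2 * N + 2 / lam ^ 2 * kernelError k Φ ν := by
  classical
  exact sum_effectiveDim_covariance_le he hev (hL.inner_symm hk hs hsymm) hμφ.nonneg
    hμφ.orthonormal hμφ.eigen hμφ.complete hlam hN fun f hf =>
      (isIntegralOperator_sub_covariance hΦ hs hκ hA hk hL).sum_norm_sq_le
        (hk.sub (isBoundedKernelOn_inner hΦ hκ)) hs hf

lemma ridge_bounds_of_kernelError (hΦ : Measurable Φ) (hs : ∀ᵐ x ∂ν, x ∈ s)
    (hκ : ∀ x ∈ s, ‖Φ x‖ ≤ κ) (hA : IsFeatureOperator Φ A) (hk : IsBoundedKernelOn k s a)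
    (hL : IsIntegralOperator k L) (hμφ : IsEigensystemOf L μ φ) (hlam : 0 < lam)
    {w h F : Lp ℝ 2 ν} (hw : (A ∘L adjoint A) w + lam • w = F) {r : ℝ} (hr : 1 / 2 ≤ r)
    (hr1 : r ≤ 1) (hF : HasSum (fun i => (μ i ^ r * inner ℝ (φ i) h) • φ i) F) :
    lam * ‖w‖ ≤ lam ^ r * ‖h‖ * (1 + √(kernelError k Φ ν) / lam) ∧
      ‖adjoint A w‖ ^ 2 ≤ 2 * (μ 0 ^ (2 * r - 1) + √(kernelError k Φ ν) * (lam ^ (r - 1)) ^ 2)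
          * ‖h‖ ^ 2
        + 2 * √(kernelError k Φ ν) ^ 2 * (lam ^ (r - 1)) ^ 2 * ‖h‖ ^ 2 / lam := by
  have hclose := (isIntegralOperator_sub_covariance hΦ hs hκ hA hk hL).norm_apply_le
    (hk.sub (isBoundedKernelOn_inner hΦ hκ)) hs
  have hbounds := ridge_bounds_of_source inner_comp_adjoint_self_nonneg hlam (Real.sqrt_nonneg _)
    hclose hw hμφ.nonneg (fun i => hμφ.antitone i.zero_le) (hμφ.nonneg 0) hμφ.orthonormal
    hμφ.eigen hr hr1 hF
  rwa [inner_comp_adjoint, real_inner_self_eq_norm_sq] at hbounds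

end Ridge

variable {ρ : Measure (X × ℝ)} [IsProbabilityMeasure ρ] {A : H →L[ℝ] Lp ℝ 2 ρ.fst}
  {L : Lp ℝ 2 ρ.fst →L[ℝ] Lp ℝ 2 ρ.fst} {φ : ℕ → Lp ℝ 2 ρ.fst} {h F : Lp ℝ 2 ρ.fst}
  {r lam η θ V K l c : ℝ} {T : ℕ}

theorem lintegral_norm_linSgd_sub_sq_le (hΦ : Measurable Φ) (hs : ∀ᵐ x ∂ρ.fst, x ∈ s)
    (hκ : ∀ x ∈ s, ‖Φ x‖ ≤ κ) (hY : ∀ᵐ z ∂ρ, |z.2| ≤ 1) (hA : IsFeatureOperator Φ A)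
    (hk : IsBoundedKernelOn k s a) (hsymm : ∀ x x', k x x' = k x' x)
    (hL : IsIntegralOperator k L) (hμφ : IsEigensystemOf L μ φ) (hr : 1 / 2 ≤ r) (hr1 : r ≤ 1)
    (hF : HasSum (fun i => (μ i ^ r * inner ℝ (φ i) h) • φ i) F) (hF1 : ‖F‖ ≤ 1)
    (hreg : ∀ u, ∫ z, z.2 * inner ℝ (Φ z.1) u ∂ρ = ∫ x, F x * inner ℝ (Φ x) u ∂ρ.fst)
    (hη : 0 < η) (hθ : 0 ≤ θ) (hθ1 : θ ≤ 1) (hT : 1 ≤ T) (hlam1 : lam ≤ 1)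
    (hTlam : (T : ℝ) ^ (-(1 - θ)) ≤ lam) (hTr : (T : ℝ) ^ (-θ) ≤ lam ^ (2 * r))
    (hηl : η * (lam + 2 * κ ^ 2) ≤ 1)
    (hV : ∀ T, ∑ t ∈ Finset.range T, stepSize η θ t ^ 2 ≤ V) (hK : 0 ≤ K) (hl : 1 / 2 ≤ l)
    (hQ : kernelError k Φ ρ.fst ≤ K * l * lam ^ 5) (hc : 0 ≤ c)
    (hnoise : NoiseControlled μ r lam η θ c T) :
    ∫⁻ z, ENNReal.ofReal (‖A (linSgd Φ lam (stepSize η θ) T z) - F‖ ^ 2)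
        ∂(Measure.pi fun _ : Fin T => ρ)
      ≤ ENNReal.ofReal (linearRiskConst κ V η ‖h‖ (μ 0 ^ (2 * r - 1)) K
          ((κ ^ 4 + 4 / η ^ 2) * (c + 1)) * (lam ^ (2 * r) * l)) := by
  have hlam : 0 < lam := lt_of_lt_of_le
    (Real.rpow_pos_of_pos (Nat.cast_pos.2 (by omega)) _) hTlam
  have hQ0 : 0 ≤ kernelError k Φ ρ.fst := integral_nonneg fun _ => sq_nonneg _
  obtain ⟨e, ev, he⟩ := exists_eigenbasis_adjoint_comp A
  obtain ⟨w, hw⟩ := exists_ridge_solution hlam A F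
  have hM := isLinearModel_of_ridge hΦ (hs.mono hκ) hY hlam hA he hreg hw
  obtain ⟨hbias, hmin⟩ := ridge_bounds_of_kernelError hΦ hs hκ hA hk hL hμφ hlam hw hr hr1 hF
  have hmin' : ‖adjoint A w‖ ^ 2 ≤ 1 / lam := (norm_sq_adjoint_ridge_le hlam hw).trans <| by
    gcongr
    exact pow_le_one₀ (norm_nonneg F) hF1
  have hearly := earlyNoise_le_of_noiseControlled hlam hη hc hQ0 hM.ev_nonneg hM.sum_ev_le hnoise
    fun N hN => sum_effectiveDim_le_kernelError hΦ hs hκ hA hk hsymm hL hμφ he hM.ev_nonneg hlam hN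
  rw [← ofReal_integral_eq_lintegral_ofReal (hM.integrable_continuous_linSgd hη.le hθ hηl
    (F := fun u => ‖A u - F‖ ^ 2) (by fun_prop)) (.of_forall fun _ => sq_nonneg _)]
  refine ENNReal.ofReal_le_ofReal ((integral_norm_linSgd_sub_sq_le hM he hw hη hθ hθ1 hT hTlam hηl
    hV).trans ?_)
  exact linearRisk_le hr hr1 hlam hlam1 hl (by simpa using hV 0) hη.le
    (Real.rpow_nonneg (hμφ.nonneg 0) _) (by positivity) hK (Real.sqrt_nonneg _)
    (Real.sq_sqrt hQ0).le hQ (by positivity) hbias (sq_nonneg _) hmin' hmin hearly hTr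

end KernelRegression

section TrainedNetwork

variable {d m : ℕ} {σ : ℝ → ℝ} {C γ lam η θ : ℝ} {T : ℕ} {ρ : Measure (Inp d × ℝ)}
  [IsProbabilityMeasure ρ] {w : Fin m → Inp d}

lemma ae_isUnitSample (hX : ∀ᵐ x ∂ρ.fst, ‖x‖ ≤ 1) (hY : ∀ᵐ z ∂ρ, |z.2| ≤ 1) (T : ℕ) :
    ∀ᵐ z ∂(Measure.pi fun _ : Fin T => ρ), ∀ i, IsUnitSample (z i) :=
  ae_pi_of_ae ((ae_of_ae_map measurable_fst.aemeasurable hX).and hY) T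

lemma norm_le_one_of_ae_eq_regression (hY : ∀ᵐ z ∂ρ, |z.2| ≤ 1) {F : Lp ℝ 2 ρ.fst}
    (hF : F =ᵐ[ρ.fst] regression ρ) : ‖F‖ ≤ 1 := by
  have hle : ∀ᵐ x ∂ρ.fst, ‖F x‖ ≤ 1 := by
    filter_upwards [hF, ae_abs_regression_le hY] with x hx hregx
    rwa [hx]
  simpa [measureUnivNNReal] using Lp.norm_le_of_ae_bound zero_le_one hle

lemma integral_label_mul_initFeature (hσ : IsActivation σ C) (hγ : |γ| ≤ 1)
    (hX : ∀ᵐ x ∂ρ.fst, ‖x‖ ≤ 1) (hY : ∀ᵐ z ∂ρ, |z.2| ≤ 1) (hw : ∀ r, ‖w r‖ ≤ 1)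
    {F : Lp ℝ 2 ρ.fst} (hF : F =ᵐ[ρ.fst] regression ρ) (u : ParamSpace d m) :
    ∫ z, z.2 * inner ℝ (initFeature σ γ w z.1) u ∂ρ
      = ∫ x, F x * inner ℝ (initFeature σ γ w x) u ∂ρ.fst := by
  have hbound : ∀ᵐ x ∂ρ.fst, |inner ℝ (initFeature σ γ w x) u| ≤ kappa C * ‖u‖ := by
    filter_upwards [hX] with x hx
    exact (abs_real_inner_le_norm _ _).trans (by gcongr; exact norm_initFeature_le hσ hγ hw hx)
  rw [integral_label_mul (f := fun x => inner ℝ (initFeature σ γ w x) u) hY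
    ((measurable_initFeature hσ w).inner_const) hbound]
  refine integral_congr_ae ?_
  filter_upwards [hF] with x hx
  rw [hx]

lemma expectedExcessRisk_le_of_le (hσ : IsActivation σ C) (hγ : |γ| ≤ 1)
    (hX : ∀ᵐ x ∂ρ.fst, ‖x‖ ≤ 1) (hY : ∀ᵐ z ∂ρ, |z.2| ≤ 1) (hw : ∀ r, ‖w r‖ ≤ 1)
    (hlam : 0 ≤ lam) (hη : 0 ≤ η) (hθ : 0 ≤ θ) (hηl : η * lam ≤ 1) {T₀ : ℕ} (hT : T ≤ T₀) :
    expectedExcessRisk σ γ 1 lam η θ ρ T w ≤ ENNReal.ofReal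
      ((kappa C * displacementBound C η T₀ + 4 * C * displacementBound C η T₀ ^ 2 + 1) ^ 2) := by
  have hC := hσ.pos.le
  have := kappa_nonneg C
  have := displacementBound_nonneg hC hη T₀
  calc expectedExcessRisk σ γ 1 lam η θ ρ T w
      ≤ ∫⁻ _, ENNReal.ofReal ((kappa C * displacementBound C η T₀
          + 4 * C * displacementBound C η T₀ ^ 2 + 1) ^ 2) ∂(Measure.pi fun _ : Fin T => ρ) := by
        refine lintegral_mono_ae ?_
        filter_upwards [ae_isUnitSample hX hY T] with z hz
        refine excessRisk_le_of_abs_sub_le (by positivity) ?_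
        filter_upwards [hX, ae_abs_regression_le hY] with x hx hregx
        exact (abs_sub _ _).trans
          (add_le_add (abs_network_sgd_le hσ hγ hw hlam hη hθ hηl hz hT hx) hregx)
    _ = _ := by simp

lemma expectedExcessRisk_le_add_linear (hσ : IsActivation σ C) (hγ : |γ| ≤ 1)
    (hX : ∀ᵐ x ∂ρ.fst, ‖x‖ ≤ 1) (hY : ∀ᵐ z ∂ρ, |z.2| ≤ 1) (hw : ∀ r, ‖w r‖ ≤ 1)
    (hlam : 0 < lam) (hlam1 : lam ≤ 1) (hη : 0 ≤ η) (hθ : 0 ≤ θ)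
    (hηl : η * (lam + kappa C ^ 2) ≤ 1) (hT : 1 ≤ T) (hCT : 4 * C * driftConst C ≤ √T)
    (hTm : (T : ℝ) ≤ 2 * m * lam ^ 5) {A : ParamSpace d m →L[ℝ] Lp ℝ 2 ρ.fst}
    (hA : IsFeatureOperator (initFeature σ γ w) A) {F : Lp ℝ 2 ρ.fst}
    (hF : F =ᵐ[ρ.fst] regression ρ) :
    expectedExcessRisk σ γ 1 lam η θ ρ T w
      ≤ ENNReal.ofReal (2 * linearizationConst C ^ 2 * (T : ℝ)⁻¹)
        + 2 * ∫⁻ z, ENNReal.ofReal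
          (‖A (linSgd (initFeature σ γ w) lam (stepSize η θ) T z) - F‖ ^ 2)
            ∂(Measure.pi fun _ : Fin T => ρ) := by
  have hlin := linearizationConst_nonneg hσ.pos.le
  calc expectedExcessRisk σ γ 1 lam η θ ρ T w
      ≤ ∫⁻ z, (ENNReal.ofReal (2 * linearizationConst C ^ 2 * (T : ℝ)⁻¹) + 2 * ENNReal.ofReal
          (‖A (linSgd (initFeature σ γ w) lam (stepSize η θ) T z) - F‖ ^ 2))
            ∂(Measure.pi fun _ : Fin T => ρ) := by
        refine lintegral_mono_ae ?_
        filter_upwards [ae_isUnitSample hX hY T] with z hz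
        set u := linSgd (initFeature σ γ w) lam (stepSize η θ) T z
        have hclose : ∀ᵐ x ∂ρ.fst, |network σ γ (sgd σ γ lam η θ (initParams 1 w) T z) x - A u x|
            ≤ linearizationConst C / √T := by
          filter_upwards [hX, hA u] with x hx hAx
          rw [hAx]
          exact abs_network_sgd_sub_linear_le hσ hγ hw hlam hlam1 hη hθ hηl hT hCT hTm hz hx
        refine (excessRisk_le_add hF (continuous_network hσ _) (by positivity) hclose).trans_eq ?_
        rw [ENNReal.ofReal_add (by positivity) (by positivity), ENNReal.ofReal_mul zero_le_two,
          div_pow, Real.sq_sqrt T.cast_nonneg, ENNReal.ofReal_ofNat, mul_assoc, div_eq_mul_inv]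
        simp
    _ = _ := by
        rw [lintegral_add_left measurable_const, lintegral_const_mul' _ _ ENNReal.ofNat_ne_top]
        simp

variable {μ : ℕ → ℝ} {φ : ℕ → Lp ℝ 2 ρ.fst} {r K l c V : ℝ}

lemma expectedExcessRisk_le_of_kernelError (hd : 1 ≤ d) (hσ : IsActivation σ C) (hγ : |γ| ≤ 1)
    (hX : ∀ᵐ x ∂ρ.fst, ‖x‖ ≤ 1) (hY : ∀ᵐ z ∂ρ, |z.2| ≤ 1)
    (hμφ : IsEigensystem (ntk σ 1 γ) ρ.fst μ φ) (hr : 1 / 2 ≤ r) (hr1 : r ≤ 1)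
    {h F : Lp ℝ 2 ρ.fst} (hF : HasSum (fun i => (μ i ^ r * inner ℝ (φ i) h) • φ i) F)
    (hFreg : F =ᵐ[ρ.fst] regression ρ) (hη : 0 < η) (hθ : 0 ≤ θ) (hθ1 : θ ≤ 1)
    (hV : ∀ T, ∑ t ∈ Finset.range T, stepSize η θ t ^ 2 ≤ V) (hT : 1 ≤ T)
    (hCT : 4 * C * driftConst C ≤ √T) (hlam1 : lam ≤ 1)
    (hTlam : (T : ℝ) ^ (-(1 - θ)) ≤ lam) (hTr : (T : ℝ) ^ (-θ) ≤ lam ^ (2 * r))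
    (hηl : η * (lam + 2 * kappa C ^ 2) ≤ 1) (hTm : (T : ℝ) ≤ 2 * m * lam ^ 5)
    (hw : ∀ r, ‖w r‖ ≤ 1) (hK : 0 ≤ K) (hl : 1 / 2 ≤ l)
    (hQ : kernelError (ntk σ 1 γ) (initFeature σ γ w) ρ.fst ≤ K * l * lam ^ 5) (hc : 0 ≤ c)
    (hnoise : NoiseControlled μ r lam η θ c T) :
    expectedExcessRisk σ γ 1 lam η θ ρ T w
      ≤ ENNReal.ofReal (2 * linearizationConst C ^ 2 * (T : ℝ)⁻¹
        + 2 * (linearRiskConst (kappa C) V η ‖h‖ (μ 0 ^ (2 * r - 1)) K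
          ((kappa C ^ 4 + 4 / η ^ 2) * (c + 1)) * (lam ^ (2 * r) * l))) := by
  have hlam : 0 < lam := lt_of_lt_of_le
    (Real.rpow_pos_of_pos (Nat.cast_pos.2 (by omega)) _) hTlam
  have hηl' : η * (lam + kappa C ^ 2) ≤ 1 := by linarith [mul_nonneg hη.le (sq_nonneg (kappa C))]
  have hmeas := measurable_initFeature (γ := γ) hσ w
  have hfeature : ∀ x ∈ {x : Inp d | ‖x‖ ≤ 1}, ‖initFeature σ γ w x‖ ≤ kappa C :=
    fun x hx => norm_initFeature_le hσ hγ hw hx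
  have hk := isBoundedKernelOn_ntk hd hσ hγ
  obtain ⟨A, hA⟩ := exists_isFeatureOperator
    (MemLp.of_bound hmeas.aestronglyMeasurable (kappa C) (hX.mono hfeature))
  obtain ⟨L, hL⟩ := hk.exists_isIntegralOperator hX
  have hlinear := lintegral_norm_linSgd_sub_sq_le hmeas hX hfeature hY hA hk ntk_symm hL
    (hμφ.isEigensystemOf hL) hr hr1 hF (norm_le_one_of_ae_eq_regression hY hFreg)
    (integral_label_mul_initFeature hσ hγ hX hY hw hFreg) hη hθ hθ1 hT hlam1 hTlam hTr hηl hV hK hl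
    hQ hc hnoise
  refine (expectedExcessRisk_le_add_linear hσ hγ hX hY hw hlam hlam1 hη.le hθ hηl' hT hCT hTm hA
    hFreg).trans ?_
  have hV0 : 0 ≤ V := by simpa using hV 0
  have hconst := linearRiskConst_nonneg (κ := kappa C) (H := ‖h‖) hV0 hη.le
    (Real.rpow_nonneg (hμφ.nonneg 0) (2 * r - 1)) hK
    (show 0 ≤ (kappa C ^ 4 + 4 / η ^ 2) * (c + 1) by positivity)
  rw [ENNReal.ofReal_add (by positivity) (by positivity),
    ENNReal.ofReal_mul zero_le_two (q := _ * _), ENNReal.ofReal_ofNat]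
  gcongr

end TrainedNetwork

section Tuning

variable {r ε η θ lam x : ℝ} {T : ℕ}

lemma inv_natCast_le_two_mul {R l : ℝ} (hT : 1 ≤ T) (hθ1 : θ ≤ 1) (hR : (T : ℝ) ^ (-θ) ≤ R)
    (hl : 1 / 2 ≤ l) : (T : ℝ)⁻¹ ≤ 2 * (R * l) :=
  calc (T : ℝ)⁻¹ = (T : ℝ) ^ (-1 : ℝ) := (Real.rpow_neg_one _).symm
    _ ≤ (T : ℝ) ^ (-θ) :=
        Real.rpow_le_rpow_of_exponent_le (by exact_mod_cast hT) (by linarith)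
    _ ≤ R := hR
    _ ≤ R * (2 * l) :=
        le_mul_of_one_le_right ((by positivity : 0 ≤ (T : ℝ) ^ (-θ)).trans hR) (by linarith)
    _ = 2 * (R * l) := by ring

lemma rpow_width_le_mul_pow {q M : ℝ} (hx : 0 < x) (hM : 0 ≤ M)
    (hlam : x ^ (-(1 / q)) ≤ lam) (hxM : x ^ (1 + 5 / q) ≤ M) : x ≤ M * lam ^ 5 := by
  have hpow : x ^ (-(5 / q)) ≤ lam ^ 5 :=
    calc x ^ (-(5 / q)) = (x ^ (-(1 / q))) ^ 5 := by
          rw [← Real.rpow_natCast, ← Real.rpow_mul hx.le]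
          congr 1
          push_cast
          ring
      _ ≤ lam ^ 5 := by gcongr
  calc x = x ^ (1 + 5 / q) * x ^ (-(5 / q)) := by
        rw [← Real.rpow_add hx, add_neg_cancel_right, Real.rpow_one]
    _ ≤ M * lam ^ 5 := by gcongr

lemma one_sub_two_mul_div (hr : 0 < r) : 1 - 2 * r / (2 * r + 1) = 1 / (2 * r + 1) := by
  have : 2 * r + 1 ≠ 0 := by positivity
  field_simp
  ring

lemma rpow_regularization_rpow (hr : 0 < r) (hx : 0 ≤ x) :
    (x ^ (-(1 / (2 * r + 1)) + ε / (2 * r))) ^ (2 * r) = x ^ (-(2 * r / (2 * r + 1)) + ε) := by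
  rw [← Real.rpow_mul hx]
  congr 1
  field_simp

lemma noiseControlled_of_summable {μ : ℕ → ℝ} (hμ : ∀ i, 0 ≤ μ i) (hr : 0 ≤ r) (hr1 : r ≤ 1)
    (hsum : Summable fun i => μ i ^ (2 - 2 * r)) (hlam : 0 < lam)
    (hT : (T : ℝ) ^ (1 - θ) = 1 / lam) :
    NoiseControlled μ r lam η θ (∑' i, μ i ^ (2 - 2 * r)) T := by
  obtain ⟨N, hN, hNle⟩ :=
    exists_hasSum_effectiveDim hμ hlam (by linarith) (by linarith) hsum
  exact .inr ⟨hT, N, hN, by rwa [sub_sub_cancel] at hNle⟩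

lemma exists_noiseControlled_of_pos (μ : ℕ → ℝ) (hη : 0 < η) (hr : 0 < r) (hε : 0 < ε) :
    ∃ c : ℝ, 0 ≤ c ∧ ∀ T : ℕ, 1 ≤ T →
      NoiseControlled μ r ((T : ℝ) ^ (-(1 / (2 * r + 1)) + ε / (2 * r))) η
        (2 * r / (2 * r + 1)) c T := by
  obtain ⟨c, hc, hexp⟩ := exists_exp_neg_mul_rpow_le hη (a := ε / (2 * r)) (by positivity)
    (2 * r / (2 * r + 1))
  refine ⟨c, hc, fun T hT => .inl ?_⟩
  have hT1 : (1 : ℝ) ≤ T := by exact_mod_cast hT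
  have hexponent : (T : ℝ) ^ (-(1 / (2 * r + 1)) + ε / (2 * r))
      * (η * (T : ℝ) ^ (1 - 2 * r / (2 * r + 1))) = η * (T : ℝ) ^ (ε / (2 * r)) := by
    rw [mul_left_comm, ← Real.rpow_add (by linarith), one_sub_two_mul_div hr]
    ring_nf
  rw [hexponent, rpow_regularization_rpow hr (by linarith)]
  refine (hexp T hT1).trans ?_
  gcongr
  linarith

end Tuning

section RiskBound

variable {d : ℕ} {σ : ℝ → ℝ} {C γ η θ r c : ℝ} {ρ : Measure (Inp d × ℝ)}
  [IsProbabilityMeasure ρ] {μ : ℕ → ℝ} {φ : ℕ → Lp ℝ 2 ρ.fst}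

theorem exists_expectedExcessRisk_le_of_kernelError (hd : 1 ≤ d) (hσ : IsActivation σ C)
    (hγ : |γ| ≤ 1) (hX : ∀ᵐ x ∂ρ.fst, ‖x‖ ≤ 1) (hY : ∀ᵐ z ∂ρ, |z.2| ≤ 1)
    (hμφ : IsEigensystem (ntk σ 1 γ) ρ.fst μ φ) (hr : 1 / 2 ≤ r) (hr1 : r ≤ 1)
    (hsource : InPowRange μ φ r (regression ρ)) (hη : 0 < η) (hθ : 1 / 2 < θ) (hθ1 : θ ≤ 1)
    {K : ℝ} (hK : 0 ≤ K) (hc : 0 ≤ c) :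
    ∃ B : ℝ, 0 < B ∧ ∀ {T m : ℕ} {lam l : ℝ} {w : Fin m → Inp d}, 1 ≤ T → lam ≤ 1 →
      (T : ℝ) ^ (-(1 - θ)) ≤ lam → (T : ℝ) ^ (-θ) ≤ lam ^ (2 * r) →
      η * (lam + 2 * kappa C ^ 2) ≤ 1 → (T : ℝ) ≤ 2 * m * lam ^ 5 →
      NoiseControlled μ r lam η θ c T → (∀ r, ‖w r‖ ≤ 1) → 1 / 2 ≤ l →
      kernelError (ntk σ 1 γ) (initFeature σ γ w) ρ.fst ≤ K * l * lam ^ 5 →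
      expectedExcessRisk σ γ 1 lam η θ ρ T w ≤ ENNReal.ofReal (B * (lam ^ (2 * r) * l)) := by
  obtain ⟨h, F, hF, hFreg⟩ := hsource
  obtain ⟨V, hV0, hV⟩ := exists_sum_stepSize_sq_le η hθ
  obtain ⟨T₀, hT₀⟩ := exists_nat_ge ((4 * C * driftConst C) ^ 2)
  have hC := hσ.pos.le
  have hκ := kappa_nonneg C
  have hD := displacementBound_nonneg hC hη.le T₀
  set B₀ := (kappa C * displacementBound C η T₀ + 4 * C * displacementBound C η T₀ ^ 2 + 1) ^ 2
  have : 0 < B₀ := by positivity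
  set B₁ := linearRiskConst (kappa C) V η ‖h‖ (μ 0 ^ (2 * r - 1)) K
    ((kappa C ^ 4 + 4 / η ^ 2) * (c + 1))
  have hB₁ : 0 ≤ B₁ := linearRiskConst_nonneg hV0 hη.le
    (Real.rpow_nonneg (hμφ.nonneg 0) (2 * r - 1)) hK (by positivity)
  refine ⟨2 * B₀ * (T₀ + 1) + (4 * linearizationConst C ^ 2 + 2 * B₁), by positivity, ?_⟩
  intro T m lam l w hT hlam1 hTlam hTr hηl hTm hnoise hw hl hQ
  have hT0 : (0 : ℝ) < T := by exact_mod_cast hT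
  have hlam : 0 < lam := (Real.rpow_pos_of_pos hT0 _).trans_le hTlam
  have hrate := inv_natCast_le_two_mul hT hθ1 hTr hl
  have hrate0 : 0 ≤ lam ^ (2 * r) * l := by positivity
  rcases le_total T T₀ with hTT₀ | hTT₀
  · have hηl0 : η * lam ≤ 1 := by nlinarith [sq_nonneg (kappa C)]
    refine (expectedExcessRisk_le_of_le hσ hγ hX hY hw hlam.le hη.le (by linarith) hηl0
      hTT₀).trans (ENNReal.ofReal_le_ofReal ?_)
    calc B₀ = B₀ * (T * (T : ℝ)⁻¹) := by rw [mul_inv_cancel₀ hT0.ne', mul_one]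
      _ ≤ B₀ * ((T₀ + 1) * (2 * (lam ^ (2 * r) * l))) := by
          gcongr
          exact_mod_cast hTT₀.trans T₀.le_succ
      _ = 2 * B₀ * (T₀ + 1) * (lam ^ (2 * r) * l) := by ring
      _ ≤ _ := mul_le_mul_of_nonneg_right (le_add_of_nonneg_right (by positivity)) hrate0
  · have hCT : 4 * C * driftConst C ≤ √T :=
      Real.le_sqrt_of_sq_le (hT₀.trans (by exact_mod_cast hTT₀))
    refine (expectedExcessRisk_le_of_kernelError hd hσ hγ hX hY hμφ hr hr1 hF hFreg hη
      (by linarith) hθ1 hV hT hCT hlam1 hTlam hTr hηl hTm hw hK hl hQ hc hnoise).trans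
      (ENNReal.ofReal_le_ofReal ?_)
    calc 2 * linearizationConst C ^ 2 * (T : ℝ)⁻¹ + 2 * (B₁ * (lam ^ (2 * r) * l))
        ≤ 2 * linearizationConst C ^ 2 * (2 * (lam ^ (2 * r) * l))
          + 2 * (B₁ * (lam ^ (2 * r) * l)) := by gcongr
      _ = (4 * linearizationConst C ^ 2 + 2 * B₁) * (lam ^ (2 * r) * l) := by ring
      _ ≤ _ := mul_le_mul_of_nonneg_right (le_add_of_nonneg_left (by positivity)) hrate0

lemma half_le_log_two_div {δ : ℝ} (hδ : 0 < δ) (hδ1 : δ ≤ 1) : 1 / 2 ≤ Real.log (2 / δ) := by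
  have : Real.log 2 ≤ Real.log (2 / δ) :=
    Real.log_le_log two_pos (le_div_self zero_le_two hδ hδ1)
  linarith [Real.log_two_gt_d9]

theorem exists_ofReal_one_sub_le_initLaw_expectedExcessRisk_le (hd : 1 ≤ d)
    (hσ : IsActivation σ C) (hγ : |γ| ≤ 1) (hX : ∀ᵐ x ∂ρ.fst, ‖x‖ ≤ 1)
    (hY : ∀ᵐ z ∂ρ, |z.2| ≤ 1) (hμφ : IsEigensystem (ntk σ 1 γ) ρ.fst μ φ) (hr : 1 / 2 ≤ r)
    (hr1 : r ≤ 1) (hsource : InPowRange μ φ r (regression ρ)) (hη : 0 < η) (hθ : 1 / 2 < θ)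
    (hθ1 : θ ≤ 1) (hc : 0 ≤ c) :
    ∃ B : ℝ, 0 < B ∧ ∀ {T m : ℕ} {lam δ : ℝ}, 1 ≤ T → lam ≤ 1 →
      (T : ℝ) ^ (-(1 - θ)) ≤ lam → (T : ℝ) ^ (-θ) ≤ lam ^ (2 * r) →
      η * (lam + 2 * kappa C ^ 2) ≤ 1 → (T : ℝ) ≤ 2 * m * lam ^ 5 →
      NoiseControlled μ r lam η θ c T → 0 < δ → δ ≤ 1 →
      ENNReal.ofReal (1 - δ) ≤ initLaw d m {w | expectedExcessRisk σ γ 1 lam η θ ρ T w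
        ≤ ENNReal.ofReal (B * lam ^ (2 * r) * Real.log (2 / δ))} := by
  obtain ⟨B, hB, hbound⟩ := exists_expectedExcessRisk_le_of_kernelError hd hσ hγ hX hY hμφ hr hr1
    hsource hη hθ hθ1 (K := 8 * (kappa C ^ 2) ^ 2) (by positivity) hc
  refine ⟨B, hB, fun {T m lam δ} hT hlam1 hTlam hTr hηl hTm hnoise hδ hδ1 => ?_⟩
  have hl := half_le_log_two_div hδ hδ1
  have hwidth : 1 ≤ 2 * m * lam ^ 5 := le_trans (by exact_mod_cast hT) hTm
  have hm : 1 ≤ m := Nat.one_le_iff_ne_zero.2 fun hm => by norm_num [hm] at hwidth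
  have hm0 : (0 : ℝ) < m := by exact_mod_cast hm
  refine (ofReal_one_sub_le_initLaw_kernelError_le hd hσ hγ hX hm hδ).trans
    (measure_mono fun w ⟨hw, hQ⟩ => ?_)
  rw [Set.mem_ofPred_eq, mul_assoc]
  refine hbound hT hlam1 hTlam hTr hηl hTm hnoise hw hl (hQ.trans ?_)
  rw [div_le_iff₀ hm0]
  calc 4 * (kappa C ^ 2) ^ 2 * Real.log (2 / δ)
      ≤ 4 * (kappa C ^ 2) ^ 2 * Real.log (2 / δ) * (2 * m * lam ^ 5) :=
        le_mul_of_one_le_right (by positivity) hwidth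
    _ = 8 * (kappa C ^ 2) ^ 2 * Real.log (2 / δ) * lam ^ 5 * m := by ring

theorem exists_expectedExcessRisk_rate (hd : 1 ≤ d) (hσ : IsActivation σ C) (hγ : |γ| ≤ 1)
    (hX : ∀ᵐ x ∂ρ.fst, ‖x‖ ≤ 1) (hY : ∀ᵐ z ∂ρ, |z.2| ≤ 1)
    (hμφ : IsEigensystem (ntk σ 1 γ) ρ.fst μ φ) (hr : 1 / 2 < r) (hr1 : r ≤ 1)
    (hsource : InPowRange μ φ r (regression ρ)) (hη : 0 < η) {ε : ℝ} (hε : 0 ≤ ε)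
    (hε1 : ε ≤ 2 * r / (2 * r + 1)) (hc : 0 ≤ c)
    (hnoise : ∀ T : ℕ, 1 ≤ T → NoiseControlled μ r
      ((T : ℝ) ^ (-(1 / (2 * r + 1)) + ε / (2 * r))) η (2 * r / (2 * r + 1)) c T) :
    ∃ B : ℝ, 0 < B ∧ ∀ T : ℕ, 1 ≤ T →
      ∀ lam : ℝ, lam = (T : ℝ) ^ (-(1 / (2 * r + 1)) + ε / (2 * r)) →
      η * (lam + 2 * kappa C ^ 2) ≤ 1 →
      ∀ m : ℕ, (T : ℝ) ^ (1 + 5 / (2 * r + 1)) ≤ ((2 * m : ℕ) : ℝ) →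
      ∀ δ : ℝ, 0 < δ → δ < 1 →
        ENNReal.ofReal (1 - δ) ≤ initLaw d m
          {w | expectedExcessRisk σ γ 1 lam η (2 * r / (2 * r + 1)) ρ T w ≤
            ENNReal.ofReal (B * (T : ℝ) ^ (-(2 * r / (2 * r + 1)) + ε) * Real.log (2 / δ))} := by
  have hr0 : 0 < r := by linarith
  have h2r : 0 < 2 * r + 1 := by linarith
  have hθ : 1 / 2 < 2 * r / (2 * r + 1) := by rw [lt_div_iff₀ h2r]; linarith
  have hθ1 : 2 * r / (2 * r + 1) ≤ 1 := by rw [div_le_one h2r]; linarith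
  obtain ⟨B, hB, hbound⟩ := exists_ofReal_one_sub_le_initLaw_expectedExcessRisk_le hd hσ hγ hX hY
    hμφ hr.le hr1 hsource hη hθ hθ1 hc
  refine ⟨B, hB, fun T hT lam hlam hηl m hm δ hδ hδ1 => ?_⟩
  have hT1 : (1 : ℝ) ≤ T := by exact_mod_cast hT
  have hT0 : (0 : ℝ) < T := by linarith
  have hrate := rpow_regularization_rpow (ε := ε) hr0 hT0.le
  have hεr : ε / (2 * r) ≤ 1 / (2 * r + 1) := by
    rw [div_le_iff₀ (by positivity)]
    exact hε1.trans_eq (by ring)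
  have hlam1 : lam ≤ 1 :=
    hlam.trans_le (Real.rpow_le_one_of_one_le_of_nonpos hT1 (by linarith))
  have hTlam : (T : ℝ) ^ (-(1 / (2 * r + 1))) ≤ lam :=
    hlam ▸ Real.rpow_le_rpow_of_exponent_le hT1 (le_add_of_nonneg_right (by positivity))
  rw [← hlam] at hrate
  rw [← hrate]
  refine hbound hT hlam1 (by rwa [one_sub_two_mul_div hr0]) ?_ hηl ?_ (hlam ▸ hnoise T hT) hδ hδ1.le
  · rw [hrate]
    exact Real.rpow_le_rpow_of_exponent_le hT1 (by linarith)
  · exact_mod_cast rpow_width_le_mul_pow hT0 (Nat.cast_nonneg _) hTlam hm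

end RiskBound

end TwoLayerSGD

end

theorem corollary1_general (d : ℕ) (hd : 1 ≤ d)
    (σ : ℝ → ℝ) (Cσ : ℝ) (hσ : TwoLayerSGD.IsActivation σ Cσ) (γ : ℝ) (hγ : |γ| ≤ 1)
    (ρ : Measure (TwoLayerSGD.Inp d × ℝ)) [IsProbabilityMeasure ρ]
    (hX : ∀ᵐ x ∂ρ.fst, ‖x‖ ≤ 1) (hY : ∀ᵐ z ∂ρ, |z.2| ≤ 1)
    (μ : ℕ → ℝ) (φ : ℕ → Lp ℝ 2 ρ.fst)
    (hμφ : TwoLayerSGD.IsEigensystem (TwoLayerSGD.ntk σ 1 γ) ρ.fst μ φ)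
    (r : ℝ) (hr : 1 / 2 < r) (hr1 : r ≤ 1)
    (hsource : TwoLayerSGD.InPowRange μ φ r (TwoLayerSGD.regression ρ)) (η : ℝ) (hη : 0 < η) :
    (Summable (fun i => μ i ^ (2 - 2 * r)) →
      ∃ C : ℝ, 0 < C ∧ ∀ T : ℕ, 1 ≤ T → ∀ lam : ℝ, lam = (T : ℝ) ^ (-(1 / (2 * r + 1))) →
        η * (lam + 2 * TwoLayerSGD.kappa Cσ ^ 2) ≤ 1 →
        ∀ m : ℕ, (T : ℝ) ^ (1 + 5 / (2 * r + 1)) ≤ ((2 * m : ℕ) : ℝ) →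
        ∀ δ : ℝ, 0 < δ → δ < 1 →
          ENNReal.ofReal (1 - δ) ≤ TwoLayerSGD.initLaw d m
            {w | TwoLayerSGD.expectedExcessRisk σ γ 1 lam η (2 * r / (2 * r + 1)) ρ T w ≤
              ENNReal.ofReal (C * (T : ℝ) ^ (-(2 * r / (2 * r + 1))) * Real.log (2 / δ))}) ∧
    (∀ ε : ℝ, 0 < ε → ε ≤ 2 * r / (2 * r + 1) →
      ∃ C : ℝ, 0 < C ∧ ∀ T : ℕ, 1 ≤ T →
        ∀ lam : ℝ, lam = (T : ℝ) ^ (-(1 / (2 * r + 1)) + ε / (2 * r)) →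
        η * (lam + 2 * TwoLayerSGD.kappa Cσ ^ 2) ≤ 1 →
        ∀ m : ℕ, (T : ℝ) ^ (1 + 5 / (2 * r + 1)) ≤ ((2 * m : ℕ) : ℝ) →
        ∀ δ : ℝ, 0 < δ → δ < 1 →
          ENNReal.ofReal (1 - δ) ≤ TwoLayerSGD.initLaw d m
            {w | TwoLayerSGD.expectedExcessRisk σ γ 1 lam η (2 * r / (2 * r + 1)) ρ T w ≤
              ENNReal.ofReal
                (C * (T : ℝ) ^ (-(2 * r / (2 * r + 1)) + ε) * Real.log (2 / δ))}) := by
  have hr0 : 0 < r := by linarith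
  refine ⟨fun hsum => ?_, fun ε hε hε1 => ?_⟩
  · have hnoise (T : ℕ) (hT : 1 ≤ T) : TwoLayerSGD.NoiseControlled μ r
        ((T : ℝ) ^ (-(1 / (2 * r + 1)) + 0 / (2 * r))) η (2 * r / (2 * r + 1))
        (∑' i, μ i ^ (2 - 2 * r)) T := by
      refine TwoLayerSGD.noiseControlled_of_summable hμφ.nonneg hr0.le hr1 hsum
        (Real.rpow_pos_of_pos (by exact_mod_cast hT) _) ?_
      rw [TwoLayerSGD.one_sub_two_mul_div hr0, zero_div, add_zero, Real.rpow_neg T.cast_nonneg,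
        one_div _⁻¹, inv_inv]
    simpa only [zero_div, add_zero] using TwoLayerSGD.exists_expectedExcessRisk_rate hd hσ hγ hX hY
      hμφ hr hr1 hsource hη le_rfl (by positivity)
      (tsum_nonneg fun i => Real.rpow_nonneg (hμφ.nonneg i) _) hnoise
  · obtain ⟨c, hc, hnoise⟩ := TwoLayerSGD.exists_noiseControlled_of_pos μ hη hr0 hε
    exact TwoLayerSGD.exists_expectedExcessRisk_rate hd hσ hγ hX hY hμφ hr hr1 hsource hη hε.le hε1
      hc hnoise

theorem corollary1 (d : ℕ) (hd : 1 ≤ d)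
    (σ : ℝ → ℝ) (Cσ : ℝ) (hσ : TwoLayerSGD.IsActivation σ Cσ)
    (γ : ℝ) (hγ : γ ∈ Set.Icc (0 : ℝ) 1)
    (ρ : Measure (TwoLayerSGD.Inp d × ℝ)) [IsProbabilityMeasure ρ]
    (hX : ρ.fst.support = Metric.closedBall (0 : TwoLayerSGD.Inp d) 1)
    (hY : ∀ᵐ z ∂ρ, z.2 ∈ Set.Icc (-1 : ℝ) 1)
    (μ : ℕ → ℝ) (φ : ℕ → Lp ℝ 2 ρ.fst)
    (hμφ : TwoLayerSGD.IsEigensystem (TwoLayerSGD.ntk σ 1 γ) ρ.fst μ φ)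
    (r : ℝ) (hr : 1 / 2 < r) (hr1 : r ≤ 1)
    (hsource : TwoLayerSGD.InPowRange μ φ r (TwoLayerSGD.regression ρ))
    (β : ℝ) (hβ : 1 < β) (hcap : TwoLayerSGD.PolynomialDecay μ β)
    (η : ℝ) (hη : 0 < η) :
    (r < 1 - 1 / (2 * β) →
      ∃ C : ℝ, 0 < C ∧ ∀ T : ℕ, 1 ≤ T → ∀ lam : ℝ, lam = (T : ℝ) ^ (-(1 / (2 * r + 1))) →
        η < TwoLayerSGD.stepBound Cσ lam (2 * r / (2 * r + 1)) →
        ∀ m : ℕ, (T : ℝ) ^ (1 + 5 / (2 * r + 1)) ≤ ((2 * m : ℕ) : ℝ) →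
        ∀ δ : ℝ, 0 < δ → δ < 1 →
          ENNReal.ofReal (1 - δ) ≤ TwoLayerSGD.initLaw d m
            {w | TwoLayerSGD.expectedExcessRisk σ γ 1 lam η (2 * r / (2 * r + 1)) ρ T w ≤
              ENNReal.ofReal (C * (T : ℝ) ^ (-(2 * r / (2 * r + 1))) * Real.log (2 / δ))}) ∧
    (1 - 1 / (2 * β) ≤ r → ∀ ε : ℝ, 0 < ε → ε < 2 * r / (2 * r + 1) →
      ∃ C : ℝ, 0 < C ∧ ∀ T : ℕ, 1 ≤ T →
        ∀ lam : ℝ, lam = (T : ℝ) ^ (-(1 / (2 * r + 1)) + ε / (2 * r)) →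
        η < TwoLayerSGD.stepBound Cσ lam (2 * r / (2 * r + 1)) →
        ∀ m : ℕ, (T : ℝ) ^ (1 + 5 / (2 * r + 1)) ≤ ((2 * m : ℕ) : ℝ) →
        ∀ δ : ℝ, 0 < δ → δ < 1 →
          ENNReal.ofReal (1 - δ) ≤ TwoLayerSGD.initLaw d m
            {w | TwoLayerSGD.expectedExcessRisk σ γ 1 lam η (2 * r / (2 * r + 1)) ρ T w ≤
              ENNReal.ofReal
                (C * (T : ℝ) ^ (-(2 * r / (2 * r + 1)) + ε) * Real.log (2 / δ))}) := by
  have hX' : ∀ᵐ x ∂ρ.fst, ‖x‖ ≤ 1 := by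
    filter_upwards [Measure.support_mem_ae] with x hx
    simpa [hX] using hx
  obtain ⟨hrate, hrateε⟩ := corollary1_general d hd σ Cσ hσ γ (abs_le.2 ⟨by linarith [hγ.1], hγ.2⟩)
    ρ hX' (hY.mono fun z => abs_le.2) μ φ hμφ r hr hr1 hsource η hη
  have h2r : 0 < 2 * r + 1 := by linarith
  have hθ : 1 / 2 < 2 * r / (2 * r + 1) := by rw [lt_div_iff₀ h2r]; linarith
  have hθ1 : 2 * r / (2 * r + 1) < 1 := by rw [div_lt_one h2r]; linarith
  have hstep {T : ℕ} {a lam : ℝ} (hT : 1 ≤ T) (hlam : lam = (T : ℝ) ^ a)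
      (hηlam : η < TwoLayerSGD.stepBound Cσ lam (2 * r / (2 * r + 1))) :
      η * (lam + 2 * TwoLayerSGD.kappa Cσ ^ 2) ≤ 1 :=
    TwoLayerSGD.mul_le_one_of_lt_stepBound
      (hlam ▸ Real.rpow_pos_of_pos (by exact_mod_cast hT) a) hθ hθ1 hηlam
  refine ⟨fun hrβ => ?_, fun _ ε hε hε1 => ?_⟩
  · have hβr : 1 < β * (2 - 2 * r) := by
      rw [lt_sub_comm, div_lt_iff₀ (by positivity)] at hrβ
      linarith
    obtain ⟨C, hC, hbound⟩ := hrate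
      (TwoLayerSGD.summable_rpow_of_polynomialDecay hμφ.nonneg hcap (by linarith) hβr)
    exact ⟨C, hC, fun T hT lam hlam hηlam => hbound T hT lam hlam (hstep hT hlam hηlam)⟩
  · obtain ⟨C, hC, hbound⟩ := hrateε ε hε hε1.le
    exact ⟨C, hC, fun T hT lam hlam hηlam => hbound T hT lam hlam (hstep hT hlam hηlam)⟩
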